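/- Let $T$ be a finite simplicial complex with vertex set $V$ whose underlying space $|T|$ is homeomorphic to a closed disk. A triangulation of a convex polygon is a topological embedding $\varphi:|T|\to\mathbb R^2$ that is linear on every simplex of $T$ and such that, for every boundary vertex $v$ of $T$, the inner angle of the polygon $\varphi(|T|)$ at $\varphi(v)$ (the sum of the angles at $\varphi(v)$ of the triangles $\varphi(f)$, where $f$ runs over the triangles of $T$ containing $v$) is less than $\pi$. It is called strictly Delaunay if for any two distinct triangles $abc$ and $abd$ of $T$ with the common edge $ab$, the point $\varphi(d)$ lies strictly outside the circumcircle of $\varphi(a)\varphi(b)\varphi(c)$. Two such embeddings $\varphi,\psi$ have the same orientation if $\psi\circ\varphi^{-1}$ is an orientation-preserving map on $\varphi(|T|)$, i.e. on every triangle $\varphi(f)$ it is affine with linear part of positive determinant. Let $\psi:|T|\to\mathbb R^2$ be a strictly Delaunay triangulation of a convex polygon, and let $e_{ij}$ be a directed edge of $T$ from the vertex $i$ to the vertex $j\neq i$. Let $Z(T,\psi,e_{ij})$ be the set of all strictly Delaunay triangulations $\varphi:|T|\to\mathbb R^2$ of convex polygons which have the same orientation as $\psi$ and satisfy $\varphi(j)-\varphi(i)=(\lambda,0)$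 for some $\lambda>0$, with the topology of uniform convergence on $|T|$. Then $Z(T,\psi,e_{ij})$ is homeomorphic to $\mathbb R^{2|V|-1}$. -/

import Mathlib

/-- The Euclidean plane. -/
abbrev Plane := EuclideanSpace ℝ (Fin 2)

/-- `|T|`: the points of the standard simplex on the (finite) vertex set `V`
whose support is a simplex of `T`, with the subspace topology. -/
def realization {V : Type*} [Fintype V] (T : AbstractSimplicialComplex V) : Set (V → ℝ) :=
  {x | x ∈ stdSimplex ℝ V ∧ ∃ s ∈ T.faces, ∀ v, x v ≠ 0 ↔ v ∈ s}

/-- A vertex of `T`, as a point of `|T|`. -/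
def vertexPt {V : Type*} [Fintype V] [DecidableEq V] (T : AbstractSimplicialComplex V) (v : V) :
    realization T :=
  ⟨Pi.single v 1, single_mem_stdSimplex ℝ v, {v}, T.singleton_mem v, by
    intro w
    by_cases h : w = v <;> simp [h]⟩

/-- `|T|` is homeomorphic to a closed disk. -/
def IsDisk {V : Type*} [Fintype V] (T : AbstractSimplicialComplex V) : Prop :=
  Nonempty (realization T ≃ₜ Metric.closedBall (0 : Plane) 1)

/-- `f` is a triangle (a 2-simplex) of `T`. -/
def IsTriangle {V : Type*} (T : AbstractSimplicialComplex V) (f : Finset V) : Prop :=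
  f ∈ T.faces ∧ f.card = 3

/-- A boundary edge lies in exactly one triangle. -/
def IsBoundaryEdge {V : Type*} (T : AbstractSimplicialComplex V) (e : Finset V) : Prop :=
  e ∈ T.faces ∧ e.card = 2 ∧ ∃! f, IsTriangle T f ∧ e ⊆ f

/-- A boundary vertex is an endpoint of a boundary edge. -/
def IsBoundaryVertex {V : Type*} (T : AbstractSimplicialComplex V) (v : V) : Prop :=
  ∃ e, IsBoundaryEdge T e ∧ v ∈ e

section

variable {V : Type*} [Fintype V] [DecidableEq V] {T : AbstractSimplicialComplex V}

/-- The image of a vertex under a map `|T| → ℝ²`. -/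
def vertexImage (φ : C(realization T, Plane)) (v : V) : Plane := φ (vertexPt T v)

/-- `φ` is an embedding that is linear on every simplex of `T`, i.e. given there in barycentric
coordinates by the images of the vertices. -/
structure IsPolygonTriangulation (φ : C(realization T, Plane)) : Prop where
  isEmbedding : Topology.IsEmbedding φ
  linear : ∀ x : realization T, φ x = ∑ v, (x : V → ℝ) v • vertexImage φ v

/-- The inner angle at `v` of the triangle `φ(f)`, where `f` is a triangle of `T` with vertex `v`:
the value of `∠ (φ a) (φ v) (φ b)`, where `a`, `b` are the other two vertices of `f`. The angle is
symmetric in `a`, `b`; the average over the two orders of `a` and `b` is that value. -/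
noncomputable def cornerAngle (φ : C(realization T, Plane)) (v : V) (f : Finset V) : ℝ :=
  (∑ p ∈ (f.erase v).offDiag,
    EuclideanGeometry.angle (vertexImage φ p.1) (vertexImage φ v) (vertexImage φ p.2)) / 2

open Classical in
/-- The inner angle of the polygon `φ(|T|)` at a boundary vertex `v`: the sum of the angles at `v`
of all triangles with vertex `v`. -/
noncomputable def innerAngle (φ : C(realization T, Plane)) (v : V) : ℝ :=
  ∑ f ∈ Finset.univ.filter (fun f : Finset V => IsTriangle T f ∧ v ∈ f), cornerAngle φ v f

/-- Triangulation of a convex polygon: all the inner angles at boundary vertices are `< π`. -/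
structure IsConvexPolygonTriangulation (φ : C(realization T, Plane)) : Prop
    extends IsPolygonTriangulation φ where
  innerAngle_lt : ∀ v, IsBoundaryVertex T v → innerAngle φ v < Real.pi

/-- For any two adjacent triangles `abc`, `abd`, the point `φ d` is strictly outside the circle
through `φ a`, `φ b`, `φ c`. -/
def IsStrictlyDelaunay (φ : C(realization T, Plane)) : Prop :=
  ∀ a b c d : V, c ≠ d → IsTriangle T {a, b, c} → IsTriangle T {a, b, d} →
    ∃ S : EuclideanGeometry.Sphere Plane,
      vertexImage φ a ∈ S ∧ vertexImage φ b ∈ S ∧ vertexImage φ c ∈ S ∧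
        S.radius < dist (vertexImage φ d) S.center

/-- `ψ ∘ φ⁻¹` preserves orientation: on every triangle `φ(f)` of its domain, it is an affine map
whose linear part `A` has positive determinant. -/
def SameOrientation (φ ψ : C(realization T, Plane)) : Prop :=
  ∀ f, IsTriangle T f → ∃ A : Plane →ₗ[ℝ] Plane, 0 < LinearMap.det A ∧
    ∀ v ∈ f, ∀ w ∈ f, A (vertexImage φ w - vertexImage φ v) = vertexImage ψ w - vertexImage ψ v

/-- `Z(T, ψ)`: the strictly Delaunay triangulations of convex polygons with the orientation
of `ψ`. -/
def delaunaySpace (ψ : C(realization T, Plane)) : Set C(realization T, Plane) :=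
  {φ | IsConvexPolygonTriangulation φ ∧ IsStrictlyDelaunay φ ∧ SameOrientation φ ψ}

/-- `Z(T, ψ, e_ij)`, a subspace of `C(|T|, ℝ²)` with the compact-open topology, which is the
topology of uniform convergence as `|T|` is compact. -/
def normalizedDelaunaySpace (ψ : C(realization T, Plane)) (i j : V) :
    Set C(realization T, Plane) :=
  {φ | φ ∈ delaunaySpace ψ ∧ ∃ l : ℝ, 0 < l ∧ vertexImage φ j - vertexImage φ i = !₂[l, 0]}

end

/-!
# Strictly Delaunay triangulations of convex polygons

The space of strictly Delaunay triangulations is parametrized by the angle sums over the edges. Let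
`ψ` be the given triangulation. A piecewise linear map is described by its vertex positions in `ℂ`,
and a positively oriented one, up to similarity, by the angles of its corners. In terms of the
angles, the Delaunay condition says that the two angles opposite to an inner edge add up to less
than `π`, and convexity says that the angles at a boundary vertex add up to less than `π`
(`mem_delaunaySpace_iff`). For a Delaunay triangulation, the sums over the edges determine all
angles.

**The parametrization.** Angles with triangle sums `π` and sums `2π` at inner vertices need not
belong to a triangulation: when the triangles are drawn with these angles, the lengths of common
edges may disagree. By a theorem of Rivin, there is, among the angles with given Delaunay edge sums
and triangle sums, exactly one choice without this defect (`exists_isGeometric`,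
`IsGeometric.unique`). It is found by minimizing a strictly convex energy in the logarithms of the
ratios of the circumradii at the edges, and it depends continuously on the data. Turning the edges
and changing their lengths according to these angles gives closed edge vectors, hence vertex
positions, since the first cohomology of the disk vanishes (`exists_develop`). They are unique up
to similarity (`exists_similarity`).

**Embeddedness.** The developed map is injective on each triangle; its injectivity on `|T|` is a
separate matter. Along the segment of angles from `ψ` to the given triangulation, injectivity is
preserved (`injOn_of_path`): if the angles at every vertex fill a convex set of directions, the
image of an injective map is locally convex, hence convex by the theorem of Tietze and Nakajima
(`convex_of_locallyConvex`). On a convex image, the Lipschitz constant of the inverse is bounded by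
the triangles alone (`mul_norm_le_of_convex`), so that injectivity is an open and closed condition.

**The dimension.** The edge sums that occur form a bounded open convex set in a vector space of
dimension `2 * |V| - 4`, by Euler's formula (`finrank_map_edgeSum`, `exists_parametrization`). The
position of the vertex `i` and the length of the edge from `i` to `j` contribute the other three
dimensions (`nonempty_homeomorph`).

**Topology.** Of the topological disk, three facts are used: punctured neighbourhoods of its points
are connected, so that links of vertices are connected; it is connected; and maps to the circle
lift to the line, so that closed cochains are exact (`IsDisk.exact`). With the embedding `ψ`, which
orients the triangles, they give the combinatorial structure `OrientedDisk`
(`IsDisk.orientedDisk`).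
-/

open Set Filter Topology

set_option linter.unusedSectionVars false

/-! ### Locally convex sets -/

/-- A closed, locally convex subset of `ℝ²` that contains two sides of the triangle
`0 ≤ y ≤ t ≤ 1` contains the triangle. -/
theorem triangle_subset_of_locallyConvex {K : Set (ℝ × ℝ)} (hK : IsClosed K)
    (hloc : ∀ x ∈ K, ∃ ε > 0, Convex ℝ (K ∩ Metric.ball x ε))
    (h0 : ∀ t ∈ Icc (0 : ℝ) 1, ((t, 0) : ℝ × ℝ) ∈ K)
    (h1 : ∀ t ∈ Icc (0 : ℝ) 1, ((t, t) : ℝ × ℝ) ∈ K) {t y : ℝ} (hy : 0 ≤ y) (hyt : y ≤ t)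
    (ht : t ≤ 1) : ((t, y) : ℝ × ℝ) ∈ K := by
  by_contra hbad
  set B : Set (ℝ × ℝ) := {q | (0 ≤ q.2 ∧ q.2 ≤ q.1 ∧ q.1 ≤ 1) ∧ q ∉ K} with hB
  set D : Set (ℝ × ℝ) := {q | 0 ≤ q.2 ∧ q.2 ≤ q.1 ∧ q.1 ≤ 1} with hD
  have hDcl : IsClosed D := by
    have e : D = {q : ℝ × ℝ | 0 ≤ q.2} ∩ ({q | q.2 ≤ q.1} ∩ {q | q.1 ≤ 1}) := rfl
    rw [e]
    exact (isClosed_le continuous_const continuous_snd).inter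
      ((isClosed_le continuous_snd continuous_fst).inter
        (isClosed_le continuous_fst continuous_const))
  have hDcp : IsCompact D := by
    refine (isCompact_Icc (a := ((0, 0) : ℝ × ℝ)) (b := (1, 1))).of_isClosed_subset hDcl ?_
    rintro ⟨a, b⟩ ⟨h1, h2, h3⟩
    simp only at h1 h2 h3
    exact ⟨⟨by simp; linarith, by simpa using h1⟩, ⟨by simpa using h3, by simp; linarith⟩⟩
  have hBD : closure B ⊆ D := closure_minimal (fun q hq => hq.1) hDcl
  have hBcp : IsCompact (closure B) := hDcp.of_isClosed_subset isClosed_closure hBD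
  have hBne : (closure B).Nonempty := ⟨(t, y), subset_closure ⟨⟨hy, hyt, ht⟩, hbad⟩⟩
  obtain ⟨m, hmB, hmin⟩ := hBcp.exists_isMinOn hBne (f := Prod.fst) continuous_fst.continuousOn
  -- the first level `t₀` at which points outside of `K` accumulate, and the lowest such point `p`
  set t₀ := m.1 with ht₀
  have ht₀0 : 0 ≤ t₀ := (hBD hmB).1.trans (hBD hmB).2.1
  -- all points of the triangle up to the level `t₀` belong to `K`
  have hlt : ∀ q ∈ D, q.1 < t₀ → q ∈ K := by
    intro q hq hqt
    by_contra hqK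
    exact absurd (hmin (subset_closure ⟨hq, hqK⟩ : q ∈ closure B)) (not_le.2 hqt)
  have hle : ∀ q ∈ D, q.1 ≤ t₀ → q ∈ K := by
    intro q hq hqt
    rcases eq_or_lt_of_le (hq.1.trans hq.2.1) with h | h
    · have : q = (0, 0) := by
        have := hq.1; have := hq.2.1
        ext <;> simp <;> linarith
      rw [this]; exact h0 0 (by simp)
    have hc : Tendsto (fun s : ℝ => s • q) (𝓝[<] 1) (𝓝 q) := by
      have : Tendsto (fun s : ℝ => s • q) (𝓝 1) (𝓝 ((1 : ℝ) • q)) :=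
        (continuous_id.smul continuous_const).tendsto 1
      rw [one_smul] at this
      exact this.mono_left nhdsWithin_le_nhds
    refine hK.mem_of_tendsto hc ?_
    have h01 : Ioo (0 : ℝ) 1 ∈ 𝓝[<] (1 : ℝ) := Ioo_mem_nhdsLT (by norm_num)
    filter_upwards [h01] with s hs
    refine hlt _ ⟨?_, ?_, ?_⟩ ?_ <;> simp only [Prod.smul_fst, Prod.smul_snd, smul_eq_mul]
    · exact mul_nonneg hs.1.le hq.1
    · exact mul_le_mul_of_nonneg_left hq.2.1 hs.1.le
    · nlinarith [hs.1, hs.2, hq.2.2]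
    · nlinarith [hs.1, hs.2]
  have ht₀1 : t₀ < 1 := by
    refine lt_of_le_of_ne (hBD hmB).2.2 fun h => hbad (hle (t, y) ⟨hy, hyt, ht⟩ ?_)
    simpa [h] using ht
  obtain ⟨p, ⟨hpB, hpt⟩, hpmin⟩ := (hBcp.inter_right
    (isClosed_eq continuous_fst continuous_const : IsClosed {q : ℝ × ℝ | q.1 = t₀})).exists_isMinOn
    ⟨m, hmB, rfl⟩ (f := Prod.snd) continuous_snd.continuousOn
  have hpt : p.1 = t₀ := hpt
  have hpD := hBD hpB
  obtain ⟨ε, hε, hconv⟩ := hloc p (hle p hpD hpt.le)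
  -- it suffices that a neighbourhood of `p` in the triangle is contained in `K`
  suffices h : ∀ᶠ q in 𝓝 p, q ∈ D → q ∈ K by
    obtain ⟨q, hq, hqB⟩ := ((mem_closure_iff_frequently.1 hpB).and_eventually h).exists
    exact hq.2 (hqB hq.1)
  rcases eq_or_lt_of_le ht₀0 with h00 | h00
  · have hp0 : p = (0, 0) := by
      have := hpD.1; have := hpD.2.1
      ext <;> simp <;> linarith
    filter_upwards [Metric.ball_mem_nhds p hε] with q hq hqD
    have hq1 : 0 ≤ q.1 := hqD.1.trans hqD.2.1
    rcases eq_or_lt_of_le hq1 with h | h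
    · exact hle q hqD (by rw [← h, ← h00])
    have hq1ε : q.1 < ε := by
      rw [hp0, Metric.mem_ball, Prod.dist_eq, max_lt_iff, Real.dist_eq, sub_zero] at hq
      exact (le_abs_self _).trans_lt hq.1
    have hmem : ∀ z : ℝ, 0 ≤ z → z ≤ q.1 → ((q.1, z) : ℝ × ℝ) ∈ Metric.ball p ε := by
      intro z hz hzq
      rw [hp0, Metric.mem_ball, Prod.dist_eq, max_lt_iff, Real.dist_eq, Real.dist_eq, sub_zero,
        sub_zero, abs_of_nonneg hz, abs_of_nonneg hq1]
      exact ⟨hq1ε, hzq.trans_lt hq1ε⟩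
    have := hconv ⟨h0 q.1 ⟨hq1, hqD.2.2⟩, hmem 0 le_rfl hq1⟩
      ⟨h1 q.1 ⟨hq1, hqD.2.2⟩, hmem q.1 hq1 le_rfl⟩ (a := 1 - q.2 / q.1) (b := q.2 / q.1)
      (by rw [sub_nonneg, div_le_one h]; exact hqD.2.1) (div_nonneg hqD.1 hq1) (by ring)
    convert this.1 using 1
    ext
    · simp; ring
    · simp; field_simp
  · -- a point `u` of `K` above the level `t₀`, close to `p`, whose joins with the points of `K`
    -- at the level `t₀` cover a neighbourhood of `p` in the triangle
    obtain ⟨u, hu1, huK, huB, hcov⟩ : ∃ u : ℝ × ℝ, t₀ < u.1 ∧ u ∈ K ∧ u ∈ Metric.ball p ε ∧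
        ((u.2 = 0 ∧ p.2 < t₀) ∨ (u.2 = u.1 ∧ 0 < p.2) ∨ (0 < p.2 ∧ p.2 < t₀)) := by
      have hc : ∀ f : ℝ → ℝ × ℝ, Continuous f → f t₀ = p → ∀ᶠ t in 𝓝[>] t₀,
          f t ∈ Metric.ball p ε := by
        intro f hf hfp
        have : Tendsto f (𝓝[>] t₀) (𝓝 p) := hfp ▸ (hf.tendsto t₀).mono_left nhdsWithin_le_nhds
        exact this (Metric.ball_mem_nhds p hε)
      have hIoo : ∀ᶠ t in 𝓝[>] t₀, t ∈ Ioo t₀ 1 := Ioo_mem_nhdsGT ht₀1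
      rcases eq_or_lt_of_le hpD.1 with hp0 | hp0
      · obtain ⟨t, ht, htI⟩ := ((hc (fun t => (t, 0)) (by fun_prop)
          (by ext <;> simp [hpt, hp0])).and hIoo).exists
        exact ⟨(t, 0), htI.1, h0 t ⟨by linarith [htI.1], htI.2.le⟩, ht, .inl ⟨rfl, by linarith⟩⟩
      rcases eq_or_lt_of_le hpD.2.1 with hp1 | hp1
      · obtain ⟨t, ht, htI⟩ := ((hc (fun t => (t, t)) (by fun_prop)
          (by ext <;> simp [hpt, hp1])).and hIoo).exists
        exact ⟨(t, t), htI.1, h1 t ⟨by linarith [htI.1], htI.2.le⟩, ht, .inr (.inl ⟨rfl, hp0⟩)⟩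
      · -- a point of the level `t₀` slightly below `p`, which is not in the closure of `B`
        obtain ⟨z, hz, hzB⟩ : ∃ z ∈ Ioo 0 p.2, ((t₀, z) : ℝ × ℝ) ∈ Metric.ball p ε := by
          have h3 : Tendsto (fun z : ℝ => ((t₀, z) : ℝ × ℝ)) (𝓝[<] p.2) (𝓝 p) := by
            have : Continuous (fun z : ℝ => ((t₀, z) : ℝ × ℝ)) := by fun_prop
            have h4 := this.tendsto p.2
            rw [← hpt] at h4
            rw [← hpt]
            exact h4.mono_left nhdsWithin_le_nhds
          obtain ⟨z, h5, h6⟩ := ((h3.eventually (Metric.ball_mem_nhds p hε)).and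
            (Ioo_mem_nhdsLT hp0 : ∀ᶠ z in 𝓝[<] p.2, z ∈ Ioo 0 p.2)).exists
          exact ⟨z, h6, h5⟩
        have hzn : ((t₀, z) : ℝ × ℝ) ∉ closure B := fun h =>
          absurd (hpmin ⟨h, rfl⟩ : p.2 ≤ z) (not_le.2 hz.2)
        have h3 : ∀ᶠ q in 𝓝 ((t₀, z) : ℝ × ℝ), q ∉ B ∧ q ∈ Metric.ball p ε := by
          refine Filter.Eventually.and ?_ (Metric.isOpen_ball.mem_nhds hzB)
          filter_upwards [isClosed_closure.isOpen_compl.mem_nhds hzn] with q hq hqB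
          exact hq (subset_closure hqB)
        have h4 : Tendsto (fun t : ℝ => ((t, z) : ℝ × ℝ)) (𝓝[>] t₀) (𝓝 (t₀, z)) :=
          ((by fun_prop : Continuous (fun t : ℝ => ((t, z) : ℝ × ℝ))).tendsto t₀).mono_left
            nhdsWithin_le_nhds
        obtain ⟨t, ⟨h5, h6⟩, h7⟩ := ((h4.eventually h3).and hIoo).exists
        refine ⟨(t, z), h7.1, ?_, h6, .inr (.inr ⟨hp0, by linarith⟩)⟩
        by_contra h8
        exact h5 ⟨⟨hz.1.le, by simp only; linarith [hz.2, h7.1, hpD.2.1], h7.2.le⟩, h8⟩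
    set θ : ℝ × ℝ → ℝ := fun q => (q.1 - t₀) / (u.1 - t₀) with hθ
    set F : ℝ × ℝ → ℝ := fun q => (q.2 - θ q * u.2) / (1 - θ q) with hF
    have hd : 0 < u.1 - t₀ := by linarith
    have hθp : θ p = 0 := by simp [hθ, hpt]
    have hθc : Continuous θ := by fun_prop
    have hFc : ContinuousAt F p := by
      refine ContinuousAt.div (by fun_prop) (by fun_prop) (by simp [hθp])
    have hFp : F p = p.2 := by simp [hF, hθp]
    have hG : ContinuousAt (fun q => ((t₀, F q) : ℝ × ℝ)) p := continuousAt_const.prodMk hFc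
    have hG' : ∀ᶠ q in 𝓝 p, ((t₀, F q) : ℝ × ℝ) ∈ Metric.ball p ε := by
      refine hG (Metric.isOpen_ball.mem_nhds ?_)
      simp only [hFp, ← hpt]; exact Metric.mem_ball_self hε
    have hθ1 : ∀ᶠ q in 𝓝 p, θ q < 1 :=
      hθc.continuousAt.eventually (gt_mem_nhds (by rw [hθp]; norm_num))
    have hlow : 0 < p.2 → ∀ᶠ q in 𝓝 p, 0 < F q := fun h =>
      hFc.eventually (lt_mem_nhds (by rwa [hFp]))
    have hupp : p.2 < t₀ → ∀ᶠ q in 𝓝 p, F q < t₀ := fun h =>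
      hFc.eventually (gt_mem_nhds (by rwa [hFp]))
    have hFD : ∀ᶠ q in 𝓝 p, q ∈ D → 0 ≤ F q ∧ F q ≤ t₀ := by
      rcases hcov with ⟨hu, h⟩ | ⟨hu, h⟩ | ⟨h, h'⟩
      · filter_upwards [hθ1, hupp h] with q hq1 hq2 hqD
        refine ⟨?_, hq2.le⟩
        simp only [hF, hu, mul_zero, sub_zero]
        exact div_nonneg hqD.1 (by linarith)
      · filter_upwards [hθ1, hlow h] with q hq1 hq2 hqD
        refine ⟨hq2.le, ?_⟩
        simp only [hF, hu]
        rw [div_le_iff₀ (by linarith)]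
        have : θ q * (u.1 - t₀) = q.1 - t₀ := by simp only [hθ]; field_simp
        nlinarith [hqD.2.1]
      · filter_upwards [hlow h, hupp h'] with q hq1 hq2 _
        exact ⟨hq1.le, hq2.le⟩
    filter_upwards [hθ1, hG', hFD] with q hq1 hq2 hq3 hqD
    rcases le_or_gt q.1 t₀ with h | h
    · exact hle q hqD h
    have hθ0 : 0 ≤ θ q := div_nonneg (by linarith) hd.le
    obtain ⟨h3, h4⟩ := hq3 hqD
    have := hconv ⟨huK, huB⟩ ⟨hle (t₀, F q) ⟨h3, h4, ht₀1.le⟩ le_rfl, hq2⟩ (a := θ q)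
      (b := 1 - θ q) hθ0 (by linarith) (by ring)
    convert this.1 using 1
    have e : θ q * (u.1 - t₀) = q.1 - t₀ := by simp only [hθ]; field_simp
    have e2 : (1 - θ q) * F q = q.2 - θ q * u.2 := by
      simp only [hF]; field_simp [show 1 - θ q ≠ 0 by linarith]
    ext
    · simp only [Prod.fst_add, Prod.smul_fst, smul_eq_mul]; linarith
    · simp only [Prod.snd_add, Prod.smul_snd, smul_eq_mul]; linarith

/-- The theorem of Tietze and Nakajima, for compact sets: the relation "the segment between `a`
and `b` lies in `K`" is transitive by `triangle_subset_of_locallyConvex`, so its classes are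
relatively open. -/
theorem convex_of_locallyConvex {E : Type*} [NormedAddCommGroup E] [NormedSpace ℝ E] {K : Set E}
    (hK : IsClosed K) (hconn : IsPreconnected K)
    (hloc : ∀ x ∈ K, ∃ ε > 0, Convex ℝ (K ∩ Metric.ball x ε)) : Convex ℝ K := by
  have htrans : ∀ a b c, segment ℝ b a ⊆ K → segment ℝ b c ⊆ K → segment ℝ a c ⊆ K := by
    intro a b c hab hbc
    set q : ℝ × ℝ → E := fun z => b + (z.1 - z.2) • (a - b) + z.2 • (c - b) with hq
    have hqc : Continuous q := by fun_prop
    have hqa : ∀ (x y : ℝ × ℝ) (s t : ℝ), s + t = 1 → q (s • x + t • y) = s • q x + t • q y := by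
      intro x y s t hst
      obtain rfl : s = 1 - t := by linarith
      simp only [hq, Prod.fst_add, Prod.snd_add, Prod.smul_fst, Prod.smul_snd, smul_eq_mul]
      module
    have key := @triangle_subset_of_locallyConvex (q ⁻¹' K) (hK.preimage hqc) ?_ ?_ ?_
    · rintro x ⟨s, t, hs, ht, hst, rfl⟩
      have := key (t := 1) (y := t) ht (by linarith) le_rfl
      have e : q (1, t) = s • a + t • c := by
        obtain rfl : s = 1 - t := by linarith
        simp only [hq]; module
      rw [← e]; exact this
    · intro x hx
      obtain ⟨ε, hε, hcv⟩ := hloc _ hx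
      obtain ⟨δ, hδ, hδε⟩ := Metric.continuousAt_iff.1 (hqc.continuousAt (x := x)) ε hε
      refine ⟨δ, hδ, ?_⟩
      intro y hy z hz s t hs ht hst
      refine ⟨?_, (convex_ball x δ) hy.2 hz.2 hs ht hst⟩
      rw [mem_preimage, hqa _ _ _ _ hst]
      exact (hcv ⟨hy.1, hδε hy.2⟩ ⟨hz.1, hδε hz.2⟩ hs ht hst).1
    · intro t ht
      refine hab ⟨1 - t, t, by linarith [ht.2], ht.1, by ring, ?_⟩
      simp only [hq]; module
    · intro t ht
      refine hbc ⟨1 - t, t, by linarith [ht.2], ht.1, by ring, ?_⟩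
      simp only [hq]; module
  have hnear : ∀ x ∈ K, ∃ ε > 0, ∀ y ∈ K, y ∈ Metric.ball x ε → segment ℝ x y ⊆ K := by
    intro x hx
    obtain ⟨ε, hε, hcv⟩ := hloc x hx
    refine ⟨ε, hε, fun y hy hyε z hz => ?_⟩
    exact (hcv.segment_subset ⟨hx, Metric.mem_ball_self hε⟩ ⟨hy, hyε⟩ hz).1
  rw [convex_iff_segment_subset]
  intro x hx y hy
  by_contra hxy
  choose! r hr hr2 using hnear
  set U : Set E := ⋃ z ∈ {z | z ∈ K ∧ segment ℝ x z ⊆ K}, Metric.ball z (r z)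
  set U' : Set E := ⋃ z ∈ {z | z ∈ K ∧ ¬ segment ℝ x z ⊆ K}, Metric.ball z (r z)
  have hUo : IsOpen U := isOpen_biUnion fun _ _ => Metric.isOpen_ball
  have hUo' : IsOpen U' := isOpen_biUnion fun _ _ => Metric.isOpen_ball
  have hmem : ∀ z ∈ K, z ∈ Metric.ball z (r z) := fun z hz => Metric.mem_ball_self (hr z hz)
  obtain ⟨z, hzK, hz, hz'⟩ := hconn U U' hUo hUo' (fun z hz => by
      by_cases h : segment ℝ x z ⊆ K
      · exact .inl (mem_biUnion (x := z) ⟨hz, h⟩ (hmem z hz))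
      · exact .inr (mem_biUnion (x := z) ⟨hz, h⟩ (hmem z hz)))
    ⟨x, hx, mem_biUnion (x := x) ⟨hx, by simpa using hx⟩ (hmem x hx)⟩
    ⟨y, hy, mem_biUnion (x := y) ⟨hy, hxy⟩ (hmem y hy)⟩
  simp only [U, U', mem_iUnion, exists_prop] at hz hz'
  obtain ⟨v, ⟨hvK, hv⟩, hvz⟩ := hz
  obtain ⟨w, ⟨hwK, hw⟩, hwz⟩ := hz'
  have h1 := hr2 v hvK z hzK hvz
  have h2 := hr2 w hwK z hzK hwz
  rw [segment_symm] at hv h2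
  have h3 := htrans _ _ _ hv h1
  rw [segment_symm] at h3
  exact hw (htrans _ _ _ h3 h2)

/-! ### Oriented triangulated disks -/

/-- A combinatorial triangulated disk: `O a b c` says that `a b c` is a positively oriented
triangle. The fields record what is needed of a disk: there is at most one triangle to the left of
a directed edge, links of vertices and the whole complex are connected, there is a boundary edge,
and the first cohomology group vanishes. -/
class OrientedDisk {V : Type*} (O : V → V → V → Prop) : Prop where
  rot : ∀ {a b c}, O a b c → O b c a
  ne : ∀ {a b c}, O a b c → a ≠ b
  unique : ∀ {a b c d}, O a b c → O a b d → c = d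
  asymm : ∀ {a b c}, O a b c → ¬ O b a c
  link : ∀ (a : V) (A : V → Prop), (∀ b c, O a b c → (A b ↔ A c)) →
    ∀ b c b' c', O a b c → O a b' c' → A b → A b'
  conn : ∀ A : V → Prop, (∀ a b c, O a b c → (A a ↔ A b)) → ∀ a b, A a → A b
  exists_triangle : ∀ a, ∃ b c, O a b c
  exists_boundary : ∃ a b c, O a b c ∧ ∀ d, ¬ O b a d
  exact : ∀ κ : V → V → ℝ, (∀ a b, κ b a = -κ a b) →
    (∀ a b c, O a b c → κ a b + κ b c + κ c a = 0) → ∃ u : V → ℝ, ∀ a b c, O a b c →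
      κ a b = u a - u b

/-- The corners of an oriented triangulated surface: `(a, b, c)` is the corner at `a` of the
positive triangle `a b c`. It also stands for the directed edge from `b` to `c`, which is opposite
to the corner. -/
abbrev Corner {V : Type*} (O : V → V → V → Prop) : Type _ :=
  {t : V × V × V // O t.1 t.2.1 t.2.2}

namespace Corner

variable {V : Type*} [Fintype V] {O : V → V → V → Prop}

noncomputable instance : Fintype (Corner O) := Fintype.ofFinite _

variable [hO : OrientedDisk O]

/-- The next corner of the same triangle. -/
def nxt (t : Corner O) : Corner O := ⟨(t.1.2.1, t.1.2.2, t.1.1), hO.rot t.2⟩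

@[simp] theorem nxt_nxt_nxt (t : Corner O) : t.nxt.nxt.nxt = t := rfl

/-- The directed edge opposite to the corner `t` is a boundary edge. -/
def IsBdry (t : Corner O) : Prop := ∀ d, ¬ O d t.1.2.2 t.1.2.1

open Classical in
/-- The corner on the other side of the edge opposite to `t`; it is `t` itself if that edge lies
on the boundary. -/
noncomputable def twin (t : Corner O) : Corner O :=
  if h : ∃ d, O d t.1.2.2 t.1.2.1 then ⟨(h.choose, t.1.2.2, t.1.2.1), h.choose_spec⟩ else t

theorem twin_of_isBdry {t : Corner O} (h : t.IsBdry) : t.twin = t := by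
  rw [twin, dif_neg (by simpa [IsBdry] using h)]

theorem twin_eq {a b c d : V} (h : O a b c) (h' : O d c b) :
    twin (⟨(a, b, c), h⟩ : Corner O) = ⟨(d, c, b), h'⟩ := by
  have hex : ∃ d, O d c b := ⟨d, h'⟩
  rw [twin, dif_pos hex]
  have : hex.choose = d := hO.unique (hO.rot hex.choose_spec) (hO.rot h')
  simp only [this]

theorem twin_twin (t : Corner O) : t.twin.twin = t := by
  obtain ⟨⟨a, b, c⟩, h⟩ := t
  by_cases hd : ∃ d, O d c b
  · obtain ⟨d, hd⟩ := hd
    rw [twin_eq h hd, twin_eq hd h]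
  · have : IsBdry (⟨(a, b, c), h⟩ : Corner O) := by simpa [IsBdry] using hd
    rw [twin_of_isBdry this, twin_of_isBdry this]

theorem twin_ne {t : Corner O} (h : ¬ t.IsBdry) : t.twin ≠ t := by
  obtain ⟨⟨a, b, c⟩, ht⟩ := t
  simp only [IsBdry, not_forall, not_not] at h
  obtain ⟨d, hd⟩ := h
  rw [twin_eq ht hd]
  intro e
  simp only [Subtype.mk.injEq, Prod.mk.injEq] at e
  exact hO.ne (hO.rot ht) e.2.2

theorem twin_eq_self_iff {t : Corner O} : t.twin = t ↔ t.IsBdry :=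
  ⟨fun h => by_contra fun h' => twin_ne h' h, twin_of_isBdry⟩

theorem twin_fst_ne {a b c : V} (h : O a b c) (hb : ¬ IsBdry (⟨(a, b, c), h⟩ : Corner O)) :
    ∃ (d : V) (hd : O d c b), twin (⟨(a, b, c), h⟩ : Corner O) = ⟨(d, c, b), hd⟩ := by
  simp only [IsBdry, not_forall, not_not] at hb
  obtain ⟨d, hd⟩ := hb
  exact ⟨d, hd, twin_eq h hd⟩

variable (O) in
/-- `nxt` as a permutation. -/
def nxtPerm : Equiv.Perm (Corner O) where
  toFun := nxt
  invFun t := t.nxt.nxt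
  left_inv _ := rfl
  right_inv _ := rfl

variable (O) in
/-- `twin` as a permutation. -/
noncomputable def twinPerm : Equiv.Perm (Corner O) where
  toFun := twin
  invFun := twin
  left_inv := twin_twin
  right_inv := twin_twin

theorem sum_nxt (f : Corner O → ℝ) : ∑ t : Corner O, f t.nxt = ∑ t, f t :=
  Equiv.sum_comp (nxtPerm O) f

theorem sum_twin (f : Corner O → ℝ) : ∑ t : Corner O, f t.twin = ∑ t, f t :=
  Equiv.sum_comp (twinPerm O) f

variable (O) in
/-- The vertex `v` is an inner vertex: all its edges have triangles on both sides. -/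
def Inner (v : V) : Prop := ∀ b c, O v b c → (∃ d, O v c d) ∧ ∃ d, O v d b

theorem nxt_ne (t : Corner O) : t.nxt ≠ t := by
  intro e
  have := congrArg (fun s : Corner O => s.1.1) e
  exact hO.ne t.2 this.symm

theorem nxt_nxt_ne (t : Corner O) : t.nxt.nxt ≠ t := fun e =>
  nxt_ne t (congrArg nxt e).symm

/-- The three vertices of the triangle of a corner. -/
def face [DecidableEq V] (t : Corner O) : Finset V := {t.1.1, t.1.2.1, t.1.2.2}

theorem face_eq_iff [DecidableEq V] {s t : Corner O} :
    s.face = t.face ↔ s = t ∨ s = t.nxt ∨ s = t.nxt.nxt := by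
  constructor
  · intro h
    -- after a rotation, the first vertices agree
    have key : ∀ s t : Corner O, s.face = t.face → s.1.1 = t.1.1 → s = t := by
      rintro ⟨⟨a, b, c⟩, hs⟩ ⟨⟨a', b', c'⟩, ht⟩ h h1
      simp only at h1 hs ht
      subst h1
      simp only [face] at h
      have hb : b ∈ ({a, b', c'} : Finset V) := h ▸ by simp
      have hc : c ∈ ({a, b', c'} : Finset V) := h ▸ by simp
      have h1 := hO.ne hs
      have h2 := hO.ne (hO.rot (hO.rot hs))
      have h3 := hO.ne (hO.rot hs)
      simp only [Finset.mem_insert, Finset.mem_singleton, Ne.symm h1, h2, false_or] at hb hc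
      rcases hb with rfl | rfl
      · obtain rfl := hO.unique hs ht; rfl
      · rcases hc with rfl | rfl
        · exact absurd (hO.rot (hO.rot ht)) (hO.asymm hs)
        · exact absurd rfl h3
    have hs : s.1.1 ∈ t.face := h ▸ by simp [face]
    simp only [face, Finset.mem_insert, Finset.mem_singleton] at hs
    rcases hs with hs | hs | hs
    · exact .inl (key _ _ h hs)
    · refine .inr (.inl (key _ _ (h.trans ?_) hs))
      ext; simp [face, nxt]; tauto
    · refine .inr (.inr (key _ _ (h.trans ?_) hs))
      ext; simp [face, nxt]; tauto
  · rintro (rfl | rfl | rfl)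
    · rfl
    · ext; simp [face, nxt]; tauto
    · ext; simp [face, nxt]; tauto

theorem sum_face_eq [DecidableEq V] (f : Corner O → ℝ) (t : Corner O) :
    ∑ s : Corner O, (if s.face = t.face then f s else 0) = f t + f t.nxt + f t.nxt.nxt := by
  classical
  rw [← Finset.sum_filter]
  have : (Finset.univ.filter fun s : Corner O => s.face = t.face) = {t, t.nxt, t.nxt.nxt} := by
    ext s; simp [face_eq_iff]
  rw [this, Finset.sum_insert, Finset.sum_insert, Finset.sum_singleton]
  · ring
  · simpa using (nxt_ne t.nxt).symm
  · simp only [Finset.mem_insert, Finset.mem_singleton, not_or]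
    exact ⟨(nxt_ne t).symm, (nxt_nxt_ne t).symm⟩

/-- The corner before `t` at the same vertex (if there is one). -/
noncomputable def prev (t : Corner O) : Corner O := t.nxt.nxt.twin.nxt.nxt

theorem prev_eq {v b c d : V} (h : O v b c) (hd : O v d b) :
    prev (⟨(v, b, c), h⟩ : Corner O) = ⟨(v, d, b), hd⟩ := by
  have : twin (nxt (nxt (⟨(v, b, c), h⟩ : Corner O))) = ⟨(d, b, v), hO.rot hd⟩ :=
    twin_eq (hO.rot (hO.rot h)) (hO.rot hd)
  rw [prev, this]; rfl

theorem prev_injective : Function.Injective (prev : Corner O → Corner O) := by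
  have : (prev : Corner O → Corner O) =
      (nxtPerm O ∘ nxtPerm O) ∘ twinPerm O ∘ (nxtPerm O ∘ nxtPerm O) := rfl
  rw [this]
  exact ((nxtPerm O).injective.comp (nxtPerm O).injective).comp ((twinPerm O).injective.comp
    ((nxtPerm O).injective.comp (nxtPerm O).injective))

theorem sum_prev [DecidableEq V] {v : V} (hv : Inner O v) (f : Corner O → ℝ) :
    ∑ t : Corner O with t.1.1 = v, f t.prev = ∑ t : Corner O with t.1.1 = v, f t := by
  have hmaps : ∀ t ∈ Finset.univ.filter (fun t : Corner O => t.1.1 = v),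
      t.prev ∈ Finset.univ.filter (fun t : Corner O => t.1.1 = v) := by
    rintro ⟨⟨a, b, c⟩, h⟩ ht
    simp only [Finset.mem_filter, Finset.mem_univ, true_and] at ht h ⊢
    subst ht
    obtain ⟨d, hd⟩ := (hv b c h).2
    rw [prev_eq h hd]
  refine Finset.sum_nbij prev hmaps (prev_injective.injOn) ?_ fun _ _ => rfl
  exact Finset.surjOn_of_injOn_of_card_le _ hmaps prev_injective.injOn le_rfl

/-- The corners at a vertex are connected by passing from a corner to an adjacent one. -/
theorem link_induction (v : V) (A : Corner O → Prop)
    (hA : ∀ b c d (h : O v b c) (h' : O v c d), A ⟨(v, b, c), h⟩ ↔ A ⟨(v, c, d), h'⟩)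
    {b c b' c' : V} (h : O v b c) (h' : O v b' c') (hAb : A ⟨(v, b, c), h⟩) :
    A ⟨(v, b', c'), h'⟩ := by
  have huniq : ∀ {b c b' : V}, O v b c → O v b' c → b = b' := fun h h' =>
    hO.unique (hO.rot (hO.rot h)) (hO.rot (hO.rot h'))
  have key := hO.link v (fun w => (∃ c, ∃ h : O v w c, A ⟨(v, w, c), h⟩) ∨
    ∃ b, ∃ h : O v b w, A ⟨(v, b, w), h⟩) ?_ b c b' c' h h' (.inl ⟨c, h, hAb⟩)
  · rcases key with ⟨c'', h2, h3⟩ | ⟨b'', h2, h3⟩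
    · obtain rfl := hO.unique h' h2; exact h3
    · exact (hA _ _ _ h2 h').1 h3
  · intro b c h
    constructor
    · rintro (⟨c', h2, h3⟩ | ⟨x, h2, h3⟩)
      · obtain rfl := hO.unique h h2; exact .inr ⟨b, h, h3⟩
      · exact .inr ⟨b, h, (hA _ _ _ h2 h).1 h3⟩
    · rintro (⟨d, h2, h3⟩ | ⟨x, h2, h3⟩)
      · exact .inl ⟨c, h, (hA _ _ _ h h2).2 h3⟩
      · obtain rfl := huniq h h2; exact .inl ⟨c, h, h3⟩

theorem connected_induction (A : Corner O → Prop) (hn : ∀ t, A t → A t.nxt)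
    (ht : ∀ t, A t → A t.twin) (s t : Corner O) (hs : A s) : A t := by
  have hn' : ∀ t : Corner O, A t.nxt → A t := fun t h => hn _ (hn _ h)
  have ht' : ∀ t : Corner O, A t.twin → A t := fun t h => by simpa [twin_twin] using ht _ h
  have hadj : ∀ v b c d (h : O v b c) (h' : O v c d),
      A ⟨(v, b, c), h⟩ ↔ A ⟨(v, c, d), h'⟩ := by
    intro v b c d h h'
    have : prev (⟨(v, c, d), h'⟩ : Corner O) = ⟨(v, b, c), h⟩ := prev_eq h' h
    rw [← this]
    exact ⟨fun h => hn' _ (hn' _ (ht' _ (hn' _ (hn' _ h)))),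
      fun h => hn _ (hn _ (ht _ (hn _ (hn _ h))))⟩
  have key := hO.conn (fun v => ∀ b c (h : O v b c), A ⟨(v, b, c), h⟩) (fun a b c h => ?_)
    s.1.1 t.1.1 (fun b c h => link_induction _ A (hadj _) s.2 h hs)
  · exact key _ _ t.2
  · constructor
    · exact fun hA b' c' h' => link_induction _ A (hadj _) (hO.rot h) h' (hn _ (hA b c h))
    · exact fun hB b' c' h' => link_induction _ A (hadj _) h h' (hn' _ (hB c a (hO.rot h)))

end Corner

/-! ### Angle changes: rotations and dimensions -/

/-- A vector lies in the range of a linear map if all relations between the coordinates of the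
range hold for it. -/
theorem mem_range_of_forall_orthogonal {A ι : Type*} [AddCommGroup A] [Module ℝ A] [Fintype ι]
    (L : A →ₗ[ℝ] (ι → ℝ)) (b : ι → ℝ)
    (h : ∀ y : ι → ℝ, (∀ a, ∑ i, y i * L a i = 0) → ∑ i, y i * b i = 0) :
    b ∈ LinearMap.range L := by
  classical
  by_contra hb
  obtain ⟨f, hf, hfb⟩ := Submodule.exists_le_ker_of_notMem hb
  have hrep : ∀ z : ι → ℝ, f z = ∑ i, f (Pi.single i 1) * z i := by
    intro z
    conv_lhs => rw [pi_eq_sum_univ' z]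
    simp [map_sum, mul_comm]
  refine hf ?_
  rw [hrep]
  refine h _ fun a => ?_
  rw [← hrep]
  exact hfb ⟨a, rfl⟩

namespace Corner

variable {V : Type*} [Fintype V] [DecidableEq V] {O : V → V → V → Prop} [hO : OrientedDisk O]

variable (O) in
/-- The changes of angles that preserve the angle sums of triangles and of inner vertices. -/
def angleChange : Submodule ℝ (Corner O → ℝ) where
  carrier := {α | (∀ t, α t + α t.nxt + α t.nxt.nxt = 0) ∧
    ∀ v, Inner O v → ∑ t : Corner O with t.1.1 = v, α t = 0}
  add_mem' := by
    rintro α β ⟨h1, h2⟩ ⟨h3, h4⟩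
    refine ⟨fun t => ?_, fun v hv => ?_⟩
    · have := h1 t; have := h3 t; simp only [Pi.add_apply]; linarith
    · simp [Finset.sum_add_distrib, h2 v hv, h4 v hv]
  zero_mem' := by simp
  smul_mem' := by
    rintro r α ⟨h1, h2⟩
    refine ⟨fun t => ?_, fun v hv => ?_⟩
    · have := h1 t; simp only [Pi.smul_apply, smul_eq_mul, ← mul_add, this, mul_zero]
    · simp [← Finset.mul_sum, h2 v hv]

variable (O) in
/-- The functions of edges: both directions of an edge have the same value. -/
noncomputable def symmetric : Submodule ℝ (Corner O → ℝ) where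
  carrier := {δ | ∀ t, δ t.twin = δ t}
  add_mem' := by intro α β h1 h2 t; simp [h1 t, h2 t]
  zero_mem' := by simp
  smul_mem' := by intro r α h t; simp [h t]

variable (O) in
/-- The functions of directed inner edges that change the sign with the direction. They vanish at
boundary edges, where `twin t = t`. -/
noncomputable def antisymmetric : Submodule ℝ (Corner O → ℝ) where
  carrier := {δ | ∀ t, δ t.twin = -δ t}
  add_mem' := by intro α β h1 h2 t; simp [h1 t, h2 t]; ring
  zero_mem' := by simp
  smul_mem' := by intro r α h t; simp [h t]

variable (O) in
/-- The change of the angles if each edge `e` is turned by `δ e`. -/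
def turn : (Corner O → ℝ) →ₗ[ℝ] (Corner O → ℝ) where
  toFun δ t := δ t.nxt - δ t.nxt.nxt
  map_add' _ _ := by ext; simp; ring
  map_smul' _ _ := by ext; simp; ring

variable (O) in
/-- The sum of a function over the two sides of an edge (twice its value at a boundary edge). -/
noncomputable def edgeSum : (Corner O → ℝ) →ₗ[ℝ] (Corner O → ℝ) where
  toFun α t := α t + α t.twin
  map_add' _ _ := by ext; simp; ring
  map_smul' _ _ := by ext; simp; ring

theorem turn_mem {δ : Corner O → ℝ} (hδ : δ ∈ symmetric O) : turn O δ ∈ angleChange O := by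
  refine ⟨fun t => ?_, fun v hv => ?_⟩
  · simp only [turn, LinearMap.coe_mk, AddHom.coe_mk, nxt_nxt_nxt]; ring
  · simp only [turn, LinearMap.coe_mk, AddHom.coe_mk, Finset.sum_sub_distrib]
    have := sum_prev hv (fun t => δ t.nxt)
    rw [sub_eq_zero, ← this]
    refine Finset.sum_congr rfl fun t _ => ?_
    simp only [prev, nxt_nxt_nxt]
    exact hδ _

/-- Angles that add up to zero at inner vertices are differences of directions of edges. -/
theorem exists_direction {α : Corner O → ℝ}
    (hα : ∀ v, Inner O v → ∑ t : Corner O with t.1.1 = v, α t = 0) :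
    ∃ ω : V × V → ℝ, ∀ a b c (h : O a b c), ω (a, c) - ω (a, b) = α ⟨(a, b, c), h⟩ := by
  classical
  set L : (V × V → ℝ) →ₗ[ℝ] (Corner O → ℝ) :=
    { toFun := fun ω t => ω (t.1.1, t.1.2.2) - ω (t.1.1, t.1.2.1)
      map_add' := fun _ _ => by ext; simp; ring
      map_smul' := fun _ _ => by ext; simp; ring } with hL
  obtain ⟨ω, hω⟩ : α ∈ LinearMap.range L := by
    refine mem_range_of_forall_orthogonal L α fun y hy => ?_
    -- `y` is constant at each vertex, and vanishes at boundary vertices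
    have hsum : ∀ v w : V, ∑ t : Corner O, (if t.1.1 = v ∧ t.1.2.2 = w then y t else 0) =
        ∑ t : Corner O, (if t.1.1 = v ∧ t.1.2.1 = w then y t else 0) := by
      intro v w
      have := hy (Pi.single (v, w) 1)
      rw [← sub_eq_zero, ← Finset.sum_sub_distrib]
      refine Eq.trans ?_ this
      refine Finset.sum_congr rfl fun t _ => ?_
      simp only [hL, LinearMap.coe_mk, AddHom.coe_mk, Pi.single_apply, Prod.mk.injEq, mul_sub,
        mul_ite, mul_one, mul_zero]
    have hin : ∀ v b w (h : O v b w), ∑ t : Corner O,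
        (if t.1.1 = v ∧ t.1.2.2 = w then y t else 0) = y ⟨(v, b, w), h⟩ := by
      intro v b w h
      rw [Finset.sum_eq_single ⟨(v, b, w), h⟩]
      · simp
      · rintro ⟨⟨a, b', c⟩, h'⟩ - hne
        refine if_neg ?_
        rintro ⟨rfl, rfl⟩
        obtain rfl := hO.unique (hO.rot (hO.rot h)) (hO.rot (hO.rot h'))
        exact hne rfl
      · simp
    have hout : ∀ v w c (h : O v w c), ∑ t : Corner O,
        (if t.1.1 = v ∧ t.1.2.1 = w then y t else 0) = y ⟨(v, w, c), h⟩ := by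
      intro v w c h
      rw [Finset.sum_eq_single ⟨(v, w, c), h⟩]
      · simp
      · rintro ⟨⟨a, b', c⟩, h'⟩ - hne
        refine if_neg ?_
        rintro ⟨rfl, rfl⟩
        obtain rfl := hO.unique h h'
        exact hne rfl
      · simp
    have hadj : ∀ v b c d (h : O v b c) (h' : O v c d),
        y ⟨(v, b, c), h⟩ = y ⟨(v, c, d), h'⟩ := by
      intro v b c d h h'
      rw [← hin, ← hout, hsum]
    have hconst : ∀ (v b c b' c' : V) (h : O v b c) (h' : O v b' c'),
        y ⟨(v, b', c'), h'⟩ = y ⟨(v, b, c), h⟩ := by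
      intro v b c b' c' h h'
      exact link_induction v (fun t => y t = y ⟨(v, b, c), h⟩)
        (fun b c d h h' => by rw [hadj _ _ _ _ h h']) h h' rfl
    have hzero : ∀ v, ¬ Inner O v → ∀ b c (h : O v b c), y ⟨(v, b, c), h⟩ = 0 := by
      intro v hv b c h
      simp only [Inner, not_forall, not_and_or] at hv
      obtain ⟨b', c', h', hb⟩ := hv
      rw [hconst v b' c' b c h' h]
      rcases hb with hb | hb
      · rw [← hin, hsum]
        refine Finset.sum_eq_zero ?_
        rintro ⟨⟨a, x, d⟩, hd⟩ -
        refine if_neg ?_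
        rintro ⟨rfl, rfl⟩
        exact hb ⟨d, hd⟩
      · rw [← hout, ← hsum]
        refine Finset.sum_eq_zero ?_
        rintro ⟨⟨a, d, x⟩, hd⟩ -
        refine if_neg ?_
        rintro ⟨rfl, rfl⟩
        exact hb ⟨d, hd⟩
    rw [← Finset.sum_fiberwise _ (fun t : Corner O => t.1.1)]
    refine Finset.sum_eq_zero fun v _ => ?_
    obtain ⟨b, c, h⟩ := hO.exists_triangle v
    have : ∀ t ∈ Finset.univ.filter (fun t : Corner O => t.1.1 = v),
        y t * α t = y ⟨(v, b, c), h⟩ * α t := by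
      rintro ⟨⟨a, x, d⟩, hd⟩ ht
      simp only [Finset.mem_filter, Finset.mem_univ, true_and] at ht hd
      subst ht
      rw [hconst a b c x d h hd]
    rw [Finset.sum_congr rfl this, ← Finset.mul_sum]
    by_cases hv : Inner O v
    · rw [hα v hv, mul_zero]
    · rw [hzero v hv, zero_mul]
  exact ⟨ω, fun a b c h => congrFun hω ⟨(a, b, c), h⟩⟩

/-- A change of angles that preserves the angle sums is caused by turning the edges. At each vertex
the turns are determined up to a constant; the constants fit together as the disk has no
cohomology. -/
theorem exists_turn_eq {α : Corner O → ℝ} (hα : α ∈ angleChange O) :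
    ∃ δ ∈ symmetric O, turn O δ = α := by
  obtain ⟨ω, hω'⟩ := exists_direction hα.2
  obtain ⟨u, hu⟩ := hO.exact (fun a b => ω (a, b) - ω (b, a)) (fun a b => by ring) (by
    intro a b c h
    have h1 := hω' a b c h
    have h2 := hω' b c a (hO.rot h)
    have h3 := hω' c a b (hO.rot (hO.rot h))
    have h4 := hα.1 ⟨(a, b, c), h⟩
    simp only [nxt] at h4
    linarith)
  refine ⟨fun t => ω (t.1.2.1, t.1.2.2) - u t.1.2.1, ?_, ?_⟩
  · rintro ⟨⟨a, b, c⟩, h⟩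
    by_cases hb : IsBdry (⟨(a, b, c), h⟩ : Corner O)
    · rw [twin_of_isBdry hb]
    · obtain ⟨d, hd, e⟩ := twin_fst_ne h hb
      rw [e]
      have := hu _ _ _ (hO.rot h)
      simp only
      linarith
  · ext ⟨⟨a, b, c⟩, h⟩
    have h1 := hω' a b c h
    have := hu _ _ _ (hO.rot (hO.rot h))
    simp only [turn, nxt, LinearMap.coe_mk, AddHom.coe_mk]
    linarith

theorem eq_const_of_turn_eq_zero {δ : Corner O → ℝ} (hδ : δ ∈ symmetric O) (h : turn O δ = 0)
    (s t : Corner O) : δ s = δ t := by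
  refine connected_induction (fun t => δ s = δ t) (fun t h1 => ?_) (fun t h1 => ?_) s t rfl
  · have := congrFun h t.nxt.nxt
    simp only [turn, LinearMap.coe_mk, AddHom.coe_mk, nxt_nxt_nxt, Pi.zero_apply] at this
    linarith
  · rw [hδ t, h1]

end Corner

theorem finrank_inf_ker_add_finrank_map {M N : Type*} [AddCommGroup M] [Module ℝ M]
    [AddCommGroup N] [Module ℝ N] [FiniteDimensional ℝ M] (L : M →ₗ[ℝ] N) (p : Submodule ℝ M) :
    Module.finrank ℝ (p ⊓ LinearMap.ker L : Submodule ℝ M) + Module.finrank ℝ (p.map L) =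
      Module.finrank ℝ p := by
  have h := (L.domRestrict p).finrank_range_add_finrank_ker
  rw [LinearMap.range_domRestrict, LinearMap.ker_domRestrict] at h
  have h2 : Module.finrank ℝ (LinearMap.ker L |>.submoduleOf p) =
      Module.finrank ℝ (p ⊓ LinearMap.ker L : Submodule ℝ M) := by
    rw [Submodule.submoduleOf, ← Submodule.map_comap_subtype]
    exact (Submodule.finrank_map_subtype_eq p _).symm
  rw [Submodule.submoduleOf] at h2
  omega

namespace Corner

variable {V : Type*} [Fintype V] [DecidableEq V] {O : V → V → V → Prop} [hO : OrientedDisk O]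

variable (O) in
/-- The type of triangles. -/
abbrev Triangle : Type _ := Set.range (face : Corner O → Finset V)

noncomputable instance : Fintype (Triangle O) := Fintype.ofFinite _

/-- The triangle of a corner. -/
def tri (t : Corner O) : Triangle O := ⟨t.face, t, rfl⟩

variable (O) in
/-- The sum of a function of corners over the corners of each triangle. -/
noncomputable def triangleSum : (Corner O → ℝ) →ₗ[ℝ] (Triangle O → ℝ) where
  toFun α f := ∑ t : Corner O, if t.face = f then α t else 0
  map_add' α β := by
    ext f; simp only [Pi.add_apply, ← Finset.sum_add_distrib]
    exact Finset.sum_congr rfl fun t _ => by split_ifs <;> simp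
  map_smul' r α := by
    ext f; simp only [Pi.smul_apply, smul_eq_mul, RingHom.id_apply, Finset.mul_sum, mul_ite,
      mul_zero]

theorem triangleSum_tri (α : Corner O → ℝ) (t : Corner O) :
    triangleSum O α t.tri = α t + α t.nxt + α t.nxt.nxt := sum_face_eq α t

theorem triangleSum_eq_zero_iff {α : Corner O → ℝ} :
    triangleSum O α = 0 ↔ ∀ t, α t + α t.nxt + α t.nxt.nxt = 0 := by
  constructor
  · intro h t; rw [← triangleSum_tri, h]; rfl
  · intro h; ext ⟨f, t, rfl⟩; exact (triangleSum_tri α t).trans (h t)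

theorem tri_nxt (t : Corner O) : t.nxt.tri = t.tri :=
  Subtype.ext (face_eq_iff.2 (.inr (.inl rfl)))

theorem sum_mul_triangleSum (y : Triangle O → ℝ) (α : Corner O → ℝ) :
    ∑ f, y f * triangleSum O α f = ∑ t : Corner O, y t.tri * α t := by
  simp only [triangleSum, LinearMap.coe_mk, AddHom.coe_mk, Finset.mul_sum]
  rw [Finset.sum_comm]
  refine Finset.sum_congr rfl fun t _ => ?_
  rw [Finset.sum_eq_single t.tri]
  · simp [tri]
  · intro f _ hf
    rw [if_neg, mul_zero]
    intro h; exact hf (Subtype.ext h.symm)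
  · simp

theorem card_corner : Fintype.card (Corner O) = 3 * Fintype.card (Triangle O) := by
  have h := sum_mul_triangleSum (O := O) 1 1
  have h1 : ∀ f, triangleSum O 1 f = 3 := by
    rintro ⟨f, t, rfl⟩
    have := triangleSum_tri 1 t
    simp only [Pi.one_apply] at this
    exact this.trans (by norm_num)
  simp only [h1, Pi.one_apply, one_mul, mul_one, Finset.sum_const, Finset.card_univ,
    nsmul_eq_mul] at h
  have : (Fintype.card (Corner O) : ℝ) = (3 * Fintype.card (Triangle O) : ℕ) := by
    push_cast; linarith
  exact_mod_cast this

theorem finrank_symmetric_add_antisymmetric :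
    Module.finrank ℝ (symmetric O) + Module.finrank ℝ (antisymmetric O) =
      Fintype.card (Corner O) := by
  set L : (Corner O → ℝ) →ₗ[ℝ] (Corner O → ℝ) :=
    { toFun := fun α t => α t - α t.twin
      map_add' := fun _ _ => by ext; simp; ring
      map_smul' := fun _ _ => by ext; simp; ring } with hL
  have h := L.finrank_range_add_finrank_ker
  have h1 : LinearMap.ker L = symmetric O := by
    ext α
    rw [LinearMap.mem_ker]
    exact ⟨fun h t => by have := congrFun h t; simp only [hL, LinearMap.coe_mk, AddHom.coe_mk,
      Pi.zero_apply] at this; linarith,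
      fun h => by ext t; have := h t; simp only [hL, LinearMap.coe_mk, AddHom.coe_mk,
        Pi.zero_apply]; linarith⟩
  have h2 : LinearMap.range L = antisymmetric O := by
    ext α
    constructor
    · rintro ⟨β, rfl⟩ t
      simp only [hL, LinearMap.coe_mk, AddHom.coe_mk, twin_twin]; ring
    · intro h
      refine ⟨(1 / 2 : ℝ) • α, ?_⟩
      ext t
      have := h t
      simp only [hL, LinearMap.coe_mk, AddHom.coe_mk, Pi.smul_apply, smul_eq_mul, this]; ring
  rw [h1, h2, Module.finrank_fintype_fun_eq_card] at h
  omega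

/-- Angle changes are turns of the edges, up to a common turn of all edges. -/
theorem finrank_angleChange : Module.finrank ℝ (angleChange O) + 1 =
    Module.finrank ℝ (symmetric O) := by
  have h := finrank_inf_ker_add_finrank_map (turn O) (symmetric O)
  have h1 : (symmetric O).map (turn O) = angleChange O := by
    ext α
    constructor
    · rintro ⟨δ, hδ, rfl⟩; exact turn_mem hδ
    · exact fun hα => exists_turn_eq hα
  have h2 : symmetric O ⊓ LinearMap.ker (turn O) = Submodule.span ℝ {1} := by
    ext δ
    rw [Submodule.mem_span_singleton]
    constructor
    · rintro ⟨h1, h2⟩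
      obtain ⟨a, b, c, t, -⟩ := hO.exists_boundary
      refine ⟨δ ⟨(a, b, c), t⟩, ?_⟩
      ext s
      simp [eq_const_of_turn_eq_zero h1 h2 s ⟨(a, b, c), t⟩]
    · rintro ⟨r, rfl⟩
      refine ⟨fun t => rfl, ?_⟩
      rw [SetLike.mem_coe, LinearMap.mem_ker]; ext t; simp [turn]
  have hne : (1 : Corner O → ℝ) ≠ 0 := by
    obtain ⟨a, b, c, t, -⟩ := hO.exists_boundary
    exact fun h => one_ne_zero (congrFun h ⟨(a, b, c), t⟩)
  rw [h1, h2, finrank_span_singleton hne] at h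
  omega

/-- An antisymmetric function with vanishing triangle sums has vanishing sums at inner vertices, so
that this part of the defining conditions of `angleChange` is redundant here. -/
theorem angleChange_inf_ker_edgeSum : angleChange O ⊓ LinearMap.ker (edgeSum O) =
    antisymmetric O ⊓ LinearMap.ker (triangleSum O) := by
  ext α
  have hanti : edgeSum O α = 0 ↔ α ∈ antisymmetric O := by
    constructor
    · intro h t
      have := congrFun h t
      simp only [edgeSum, LinearMap.coe_mk, AddHom.coe_mk, Pi.zero_apply] at this
      linarith
    · intro h
      ext t
      have := h t
      simp only [edgeSum, LinearMap.coe_mk, AddHom.coe_mk, Pi.zero_apply]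
      linarith
  simp only [Submodule.mem_inf, LinearMap.mem_ker, hanti, triangleSum_eq_zero_iff]
  constructor
  · rintro ⟨h1, h2⟩; exact ⟨h2, h1.1⟩
  · rintro ⟨h1, h2⟩
    refine ⟨⟨h2, fun v hv => ?_⟩, h1⟩
    have h3 : ∀ t : Corner O, α t = -α t.nxt + α t.prev.nxt := by
      intro t
      have h4 : α t.prev.nxt = -α t.nxt.nxt := by
        rw [← h1]; rfl
      have := h2 t
      linarith
    rw [Finset.sum_congr rfl fun t _ => h3 t, Finset.sum_add_distrib,
      sum_prev hv (fun t => α t.nxt), Finset.sum_neg_distrib]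
    ring

/-- The total of the triangle sums of an antisymmetric function is zero. There is no other relation
between them, because the triangles are connected through inner edges. -/
theorem finrank_map_antisymmetric :
    Module.finrank ℝ ((antisymmetric O).map (triangleSum O)) + 1 =
      Fintype.card (Triangle O) := by
  set s : (Triangle O → ℝ) →ₗ[ℝ] ℝ :=
    { toFun := fun y => ∑ f, y f
      map_add' := fun _ _ => by simp [Finset.sum_add_distrib]
      map_smul' := fun _ _ => by simp [Finset.mul_sum] } with hs
  have h1 : (antisymmetric O).map (triangleSum O) = LinearMap.ker s := by
    ext b
    constructor
    · rintro ⟨α, hα, rfl⟩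
      have h2 := sum_mul_triangleSum (O := O) 1 α
      simp only [Pi.one_apply, one_mul] at h2
      have h3 := sum_twin α
      rw [Finset.sum_congr rfl fun t _ => hα t, Finset.sum_neg_distrib] at h3
      rw [LinearMap.mem_ker]
      simp only [hs, LinearMap.coe_mk, AddHom.coe_mk, h2]
      linarith
    · intro hb
      have hb : ∑ f, b f = 0 := hb
      set L : (Corner O → ℝ) →ₗ[ℝ] (Triangle O → ℝ) := triangleSum O ∘ₗ
        { toFun := fun α t => α t - α t.twin
          map_add' := fun _ _ => by ext; simp; ring
          map_smul' := fun _ _ => by ext; simp; ring } with hL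
      obtain ⟨β, rfl⟩ : b ∈ LinearMap.range L := by
        refine mem_range_of_forall_orthogonal L b fun y hy => ?_
        have h2 : ∀ t : Corner O, y t.tri = y t.twin.tri := by
          intro t
          have h3 := hy (Pi.single t 1)
          simp only [hL, LinearMap.coe_comp, Function.comp_apply, sum_mul_triangleSum,
            LinearMap.coe_mk, AddHom.coe_mk, mul_sub, Finset.sum_sub_distrib] at h3
          rw [← sum_twin (fun s : Corner O => y s.tri * (Pi.single t (1 : ℝ) : Corner O → ℝ) s.twin)]
            at h3
          simp only [twin_twin, Pi.single_apply, mul_ite, mul_one, mul_zero, Finset.sum_ite_eq',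
            Finset.mem_univ, if_true] at h3
          linarith
        obtain ⟨a, b', c, ht, -⟩ := hO.exists_boundary
        have h3 : ∀ f, y f = y (tri ⟨(a, b', c), ht⟩) := by
          rintro ⟨f, t, rfl⟩
          exact connected_induction (fun t => y t.tri = y (tri ⟨(a, b', c), ht⟩))
            (fun t h => by rwa [tri_nxt]) (fun t h => by rwa [← h2]) ⟨(a, b', c), ht⟩ t rfl
        rw [Finset.sum_congr rfl fun f _ => by rw [h3 f], ← Finset.mul_sum, hb, mul_zero]
      refine ⟨_, ?_, rfl⟩
      intro t
      simp only [LinearMap.coe_mk, AddHom.coe_mk, twin_twin]; ring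
  have h2 := s.finrank_range_add_finrank_ker
  obtain ⟨a, b, c, ht, -⟩ := hO.exists_boundary
  have h3 : LinearMap.range s = ⊤ := by
    rw [LinearMap.range_eq_top]
    intro r
    refine ⟨Pi.single (tri ⟨(a, b, c), ht⟩) r, ?_⟩
    simp [hs]
  rw [h3, finrank_top, Module.finrank_self, ← h1, Module.finrank_fintype_fun_eq_card] at h2
  omega

variable (O) in
/-- The functions of directed edges that change the sign with the direction, without a condition
on boundary edges. -/
noncomputable def cochain : Submodule ℝ (Corner O → ℝ) where
  carrier := {δ | ∀ t, ¬ t.IsBdry → δ t.twin = -δ t}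
  add_mem' := by intro α β h1 h2 t ht; simp [h1 t ht, h2 t ht]; ring
  zero_mem' := by simp
  smul_mem' := by intro r α h t ht; simp [h t ht]

theorem isBdry_twin {t : Corner O} : t.twin.IsBdry ↔ t.IsBdry := by
  rw [← twin_eq_self_iff, ← twin_eq_self_iff, twin_twin, eq_comm]

/-- Both spaces have one dimension for each undirected edge. -/
theorem finrank_cochain : Module.finrank ℝ (cochain O) = Module.finrank ℝ (symmetric O) := by
  classical
  -- a choice of a direction of each edge
  set ε : Corner O → ℝ := fun t => if Fintype.equivFin _ t < Fintype.equivFin _ t.twin then 1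
    else -1 with hε
  have hε1 : ∀ t, ε t * ε t = 1 := by intro t; simp only [hε]; split_ifs <;> norm_num
  have hεt : ∀ t : Corner O, ¬ t.IsBdry → ε t.twin = -ε t := by
    intro t ht
    have hne : Fintype.equivFin _ t ≠ Fintype.equivFin _ t.twin := fun h =>
      twin_ne ht ((Fintype.equivFin _).injective h).symm
    simp only [hε, twin_twin]
    rcases lt_or_gt_of_ne hne with h | h
    · rw [if_neg (not_lt.2 h.le), if_pos h]
    · rw [if_pos h, if_neg (not_lt.2 h.le), neg_neg]
  set L : (Corner O → ℝ) →ₗ[ℝ] (Corner O → ℝ) :=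
    { toFun := fun α t => ε t * α t
      map_add' := fun _ _ => by ext; simp; ring
      map_smul' := fun _ _ => by ext; simp; ring } with hL
  have hLL : ∀ α, L (L α) = α := by
    intro α; ext t; simp only [hL, LinearMap.coe_mk, AddHom.coe_mk, ← mul_assoc, hε1, one_mul]
  have hinj : Function.Injective L := fun α β h => by rw [← hLL α, h, hLL]
  have h1 : (symmetric O).map L = cochain O := by
    ext α
    constructor
    · rintro ⟨β, hβ, rfl⟩ t ht
      simp only [hL, LinearMap.coe_mk, AddHom.coe_mk, hβ t, hεt t ht]; ring
    · intro hα
      refine ⟨L α, fun t => ?_, hLL α⟩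
      by_cases ht : t.IsBdry
      · rw [twin_of_isBdry ht]
      · simp only [hL, LinearMap.coe_mk, AddHom.coe_mk, hα t ht, hεt t ht]; ring
  rw [← h1]
  exact ((symmetric O).equivMapOfInjective L hinj).finrank_eq.symm

/-- A disk has a boundary edge, whose value in a cochain is free: hence there is no relation between
the triangle sums. -/
theorem map_cochain : (cochain O).map (triangleSum O) = ⊤ := by
  classical
  rw [eq_top_iff]
  intro b _
  set L : (Corner O → ℝ) →ₗ[ℝ] (Triangle O → ℝ) := triangleSum O ∘ₗ
    { toFun := fun α t => if t.IsBdry then α t else α t - α t.twin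
      map_add' := fun _ _ => by ext; simp only [Pi.add_apply]; split_ifs <;> ring
      map_smul' := fun _ _ => by
        ext; simp only [Pi.smul_apply, smul_eq_mul, RingHom.id_apply]; split_ifs <;> ring } with hL
  obtain ⟨β, rfl⟩ : b ∈ LinearMap.range L := by
    refine mem_range_of_forall_orthogonal L b fun y hy => ?_
    have h2 : ∀ t : Corner O, (t.IsBdry → y t.tri = 0) ∧ (¬ t.IsBdry → y t.tri = y t.twin.tri) := by
      intro t
      have h3 := hy (Pi.single t 1)
      simp only [hL, LinearMap.coe_comp, Function.comp_apply, sum_mul_triangleSum,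
        LinearMap.coe_mk, AddHom.coe_mk] at h3
      constructor
      · intro ht
        rw [Finset.sum_eq_single t] at h3
        · simpa [ht] using h3
        · intro s _ hst
          have hst' : s.twin ≠ t := fun h => hst (by
            rw [← h, isBdry_twin] at ht; rw [← h, twin_of_isBdry ht])
          simp [hst, hst']
        · simp
      · intro ht
        have h4 : ∀ s : Corner O, y s.tri * (if s.IsBdry then (Pi.single t (1 : ℝ) : Corner O → ℝ) s
            else (Pi.single t (1 : ℝ) : Corner O → ℝ) s -
              (Pi.single t (1 : ℝ) : Corner O → ℝ) s.twin) =
            y s.tri * (Pi.single t (1 : ℝ) : Corner O → ℝ) s -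
            y s.tri * (Pi.single t (1 : ℝ) : Corner O → ℝ) s.twin := by
          intro s
          by_cases hs : s.IsBdry
          · have h5 : s ≠ t := by rintro rfl; exact ht hs
            rw [if_pos hs, twin_of_isBdry hs]
            simp [h5]
          · rw [if_neg hs, mul_sub]
        rw [Finset.sum_congr rfl fun s _ => h4 s, Finset.sum_sub_distrib,
          ← sum_twin (fun s : Corner O => y s.tri * (Pi.single t (1 : ℝ) : Corner O → ℝ) s.twin)]
          at h3
        simp only [twin_twin, Pi.single_apply, mul_ite, mul_one, mul_zero, Finset.sum_ite_eq',
          Finset.mem_univ, if_true] at h3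
        linarith
    obtain ⟨v, w, x, ht, hb⟩ := hO.exists_boundary
    have hb' : IsBdry (⟨(x, v, w), hO.rot (hO.rot ht)⟩ : Corner O) :=
      fun d hd => hb d (hO.rot hd)
    have h3 : ∀ f, y f = 0 := by
      rintro ⟨f, t, rfl⟩
      refine connected_induction (fun t => y t.tri = 0)
        (fun t h => by rwa [tri_nxt]) (fun t h => ?_) ⟨(x, v, w), hO.rot (hO.rot ht)⟩ t
        ((h2 _).1 hb')
      by_cases h4 : t.IsBdry
      · rwa [twin_of_isBdry h4]
      · rwa [← (h2 t).2 h4]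
    simp [h3]
  refine ⟨_, ?_, rfl⟩
  intro t ht
  simp only [LinearMap.coe_mk, AddHom.coe_mk, twin_twin, isBdry_twin, ht, if_false]; ring

/-- A closed function of directed edges is the difference of a function of vertices. -/
theorem exists_potential {α : Corner O → ℝ} (h3 : α ∈ cochain O)
    (h4 : ∀ t, α t + α t.nxt + α t.nxt.nxt = 0) :
    ∃ u : V → ℝ, ∀ t : Corner O, α t = u t.1.2.1 - u t.1.2.2 := by
  classical
  set κ : V → V → ℝ := fun a b => if h : ∃ x, O x a b then α ⟨(h.choose, a, b), h.choose_spec⟩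
    else if h : ∃ x, O x b a then -α ⟨(h.choose, b, a), h.choose_spec⟩ else 0 with hκ
  have h5 : ∀ x a b (h : O x a b), κ a b = α ⟨(x, a, b), h⟩ := by
    intro x a b h
    have hex : ∃ x, O x a b := ⟨x, h⟩
    simp only [hκ, dif_pos hex]
    have : hex.choose = x := hO.unique (hO.rot hex.choose_spec) (hO.rot h)
    simp only [this]
  have h6 : ∀ a b, κ b a = -κ a b := by
    intro a b
    by_cases ha : ∃ x, O x a b
    · obtain ⟨x, hx⟩ := ha
      rw [h5 x a b hx]
      by_cases hb : ∃ x, O x b a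
      · obtain ⟨y, hy⟩ := hb
        rw [h5 y b a hy, ← h3, twin_eq hx hy]
        intro h; exact h y hy
      · have : ∃ x, O x a b := ⟨x, hx⟩
        rw [← h5 x a b hx]
        simp only [hκ, dif_neg hb, dif_pos this]
    · by_cases hb : ∃ x, O x b a
      · simp only [hκ, dif_neg ha, dif_pos hb, neg_neg]
      · simp only [hκ, dif_neg ha, dif_neg hb, neg_zero]
  obtain ⟨u, hu⟩ := hO.exact κ h6 (fun a b c h => by
    rw [h5 c a b (hO.rot (hO.rot h)), h5 a b c h, h5 b c a (hO.rot h)]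
    have := h4 ⟨(a, b, c), h⟩
    simp only [nxt] at this
    linarith)
  refine ⟨u, ?_⟩
  rintro ⟨⟨a, b, c⟩, h⟩
  rw [← hu b c a (hO.rot h), h5 a b c h]

/-- Closed cochains are differences of functions of vertices, up to a constant. -/
theorem finrank_cochain_inf_ker :
    Module.finrank ℝ (cochain O ⊓ LinearMap.ker (triangleSum O) : Submodule ℝ (Corner O → ℝ)) + 1 =
      Fintype.card V := by
  classical
  set L : (V → ℝ) →ₗ[ℝ] (Corner O → ℝ) :=
    { toFun := fun u t => u t.1.2.1 - u t.1.2.2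
      map_add' := fun _ _ => by ext; simp; ring
      map_smul' := fun _ _ => by ext; simp; ring } with hL
  obtain ⟨v₀, -⟩ := hO.exists_boundary
  have h1 : LinearMap.ker L = Submodule.span ℝ {1} := by
    ext u
    rw [Submodule.mem_span_singleton, LinearMap.mem_ker]
    constructor
    · intro h
      refine ⟨u v₀, ?_⟩
      ext w
      have := hO.conn (fun v => u v = u v₀) (fun a b c h' => ?_) v₀ w rfl
      · simp [this]
      · have := congrFun h ⟨(c, a, b), hO.rot (hO.rot h')⟩
        simp only [hL, LinearMap.coe_mk, AddHom.coe_mk, Pi.zero_apply, sub_eq_zero] at this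
        rw [this]
    · rintro ⟨r, rfl⟩; ext t; simp [hL]
  have h2 : LinearMap.range L = cochain O ⊓ LinearMap.ker (triangleSum O) := by
    ext α
    constructor
    · rintro ⟨u, rfl⟩
      refine ⟨?_, ?_⟩
      · rintro ⟨⟨a, b, c⟩, h⟩ ht
        obtain ⟨d, hd, e⟩ := twin_fst_ne h ht
        rw [e]; simp [hL]
      · rw [SetLike.mem_coe, LinearMap.mem_ker, triangleSum_eq_zero_iff]
        intro t; simp [hL, nxt]
    · rintro ⟨h3, h4⟩
      rw [SetLike.mem_coe, LinearMap.mem_ker, triangleSum_eq_zero_iff] at h4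
      obtain ⟨u, hu⟩ := exists_potential h3 h4
      exact ⟨u, funext fun t => (hu t).symm⟩
  have h3 := L.finrank_range_add_finrank_ker
  have hne : (1 : V → ℝ) ≠ 0 := fun h => one_ne_zero (congrFun h v₀)
  rw [h1, h2, finrank_span_singleton hne, Module.finrank_fintype_fun_eq_card] at h3
  exact h3

/-- The dimension of the space of edge sums of angle changes. It combines Euler's formula (in
`finrank_cochain_inf_ker` and `map_cochain`) with the count of turns and of flows. -/
theorem finrank_map_edgeSum :
    Module.finrank ℝ ((angleChange O).map (edgeSum O)) + 4 = 2 * Fintype.card V := by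
  have h1 := finrank_inf_ker_add_finrank_map (edgeSum O) (angleChange O)
  have h2 := finrank_inf_ker_add_finrank_map (triangleSum O) (antisymmetric O)
  have h3 := finrank_inf_ker_add_finrank_map (triangleSum O) (cochain O)
  rw [angleChange_inf_ker_edgeSum] at h1
  rw [map_cochain, finrank_top, Module.finrank_fintype_fun_eq_card, finrank_cochain] at h3
  have h4 := finrank_map_antisymmetric (O := O)
  have h5 := finrank_angleChange (O := O)
  have h6 := finrank_symmetric_add_antisymmetric (O := O)
  have h7 := card_corner (O := O)
  have h8 := finrank_cochain_inf_ker (O := O)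
  omega

end Corner

/-! ### Splitting an angle in a given ratio of sines -/

/-- The angle `a` in `(0, s)` with `sin a = exp x * sin (s - a)`. -/
noncomputable def splitAngle (s x : ℝ) : ℝ :=
  Real.pi / 2 - Real.arctan ((Real.exp (-x) + Real.cos s) / Real.sin s)

theorem splitAngle_pos (s x : ℝ) : 0 < splitAngle s x := by
  have := Real.arctan_lt_pi_div_two ((Real.exp (-x) + Real.cos s) / Real.sin s)
  unfold splitAngle; linarith

theorem splitAngle_lt {s : ℝ} (hs : 0 < s) (hs' : s < Real.pi) (x : ℝ) : splitAngle s x < s := by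
  have hsin := Real.sin_pos_of_pos_of_lt_pi hs hs'
  have h1 : Real.arctan (Real.cos s / Real.sin s) = Real.pi / 2 - s := by
    rw [← Real.arctan_tan (x := Real.pi / 2 - s) (by linarith) (by linarith),
      Real.tan_eq_sin_div_cos, Real.sin_pi_div_two_sub, Real.cos_pi_div_two_sub]
  have h2 : Real.cos s / Real.sin s < (Real.exp (-x) + Real.cos s) / Real.sin s := by
    have := Real.exp_pos (-x)
    gcongr; linarith
  have := Real.arctan_strictMono h2
  unfold splitAngle; linarith

theorem sin_sub_splitAngle {s : ℝ} (hs : 0 < s) (hs' : s < Real.pi) (x : ℝ) :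
    Real.sin (s - splitAngle s x) = Real.exp (-x) * Real.sin (splitAngle s x) := by
  have hsin := Real.sin_pos_of_pos_of_lt_pi hs hs'
  set k := (Real.exp (-x) + Real.cos s) / Real.sin s with hk
  have h1 : Real.sin (splitAngle s x) = Real.cos (Real.arctan k) := Real.sin_pi_div_two_sub _
  have h2 : Real.cos (splitAngle s x) = Real.sin (Real.arctan k) := Real.cos_pi_div_two_sub _
  have h3 : Real.sin (Real.arctan k) = k * Real.cos (Real.arctan k) := by
    have := Real.tan_arctan k
    rw [Real.tan_eq_sin_div_cos, div_eq_iff (Real.cos_arctan_pos k).ne'] at this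
    exact this
  have h4 : k * Real.sin s = Real.exp (-x) + Real.cos s := by rw [hk]; field_simp
  rw [Real.sin_sub, h1, h2, h3]
  linear_combination Real.cos (Real.arctan k) * h4

theorem sin_mul_sin_sub (s a b : ℝ) : Real.sin b * Real.sin (s - a) -
    Real.sin a * Real.sin (s - b) = Real.sin s * Real.sin (b - a) := by
  simp only [Real.sin_sub]
  have h1 := Real.sin_sq_add_cos_sq s
  ring

theorem splitAngle_unique {s a x : ℝ} (hs' : s < Real.pi) (ha : 0 < a) (has : a < s)
    (h : Real.sin (s - a) = Real.exp (-x) * Real.sin a) : a = splitAngle s x := by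
  have hs : 0 < s := ha.trans has
  have h1 := sin_sub_splitAngle hs hs' x
  have h2 := sin_mul_sin_sub s a (splitAngle s x)
  have h3 := splitAngle_pos s x
  have h4 := splitAngle_lt hs hs' x
  rw [h, h1] at h2
  have h5 : Real.sin s * Real.sin (splitAngle s x - a) = 0 := by rw [← h2]; ring
  rcases mul_eq_zero.1 h5 with h6 | h6
  · exact absurd h6 (Real.sin_pos_of_pos_of_lt_pi hs hs').ne'
  · have := (Real.sin_eq_zero_iff_of_lt_of_lt (by linarith) (by linarith)).1 h6
    linarith

theorem splitAngle_neg {s : ℝ} (hs : 0 < s) (hs' : s < Real.pi) (x : ℝ) :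
    splitAngle s (-x) = s - splitAngle s x := by
  refine (splitAngle_unique hs' (by linarith [splitAngle_lt hs hs' x])
    (by linarith [splitAngle_pos s x]) ?_).symm
  rw [sub_sub_cancel, sin_sub_splitAngle hs hs', ← mul_assoc, ← Real.exp_add]
  simp

theorem splitAngle_strictMono {s : ℝ} (hs : 0 < s) (hs' : s < Real.pi) :
    StrictMono (splitAngle s) := by
  intro x y hxy
  have hsin := Real.sin_pos_of_pos_of_lt_pi hs hs'
  have : (Real.exp (-y) + Real.cos s) / Real.sin s < (Real.exp (-x) + Real.cos s) / Real.sin s := by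
    have : Real.exp (-y) < Real.exp (-x) := Real.exp_lt_exp.2 (by linarith)
    gcongr
  have := Real.arctan_strictMono this
  unfold splitAngle; linarith

theorem exists_splitAngle_eq {s a : ℝ} (hs' : s < Real.pi) (ha : 0 < a) (has : a < s) :
    ∃ x, splitAngle s x = a := by
  have h1 : 0 < Real.sin a := Real.sin_pos_of_pos_of_lt_pi ha (by linarith)
  have h2 : 0 < Real.sin (s - a) := Real.sin_pos_of_pos_of_lt_pi (by linarith) (by linarith)
  refine ⟨-Real.log (Real.sin (s - a) / Real.sin a), (splitAngle_unique hs' ha has ?_).symm⟩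
  rw [neg_neg, Real.exp_log (by positivity)]
  field_simp

theorem continuous_splitAngle (s : ℝ) : Continuous (splitAngle s) := by
  unfold splitAngle
  exact continuous_const.sub (Real.continuous_arctan.comp (by fun_prop))

/-- The primitive of `splitAngle s - a`. -/
noncomputable def splitEnergy (s a x : ℝ) : ℝ := ∫ u in (0 : ℝ)..x, (splitAngle s u - a)

theorem hasDerivAt_splitEnergy (s a x : ℝ) :
    HasDerivAt (splitEnergy s a) (splitAngle s x - a) x := by
  have hc : Continuous fun u => splitAngle s u - a := (continuous_splitAngle s).sub continuous_const
  exact intervalIntegral.integral_hasDerivAt_right (hc.intervalIntegrable _ _)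
    hc.stronglyMeasurable.stronglyMeasurableAtFilter hc.continuousAt

theorem strictConvexOn_splitEnergy {s : ℝ} (hs : 0 < s) (hs' : s < Real.pi) (a : ℝ) :
    StrictConvexOn ℝ univ (splitEnergy s a) := by
  refine StrictMono.strictConvexOn_univ_of_deriv ?_ ?_
  · exact continuous_iff_continuousAt.2 fun x => (hasDerivAt_splitEnergy s a x).continuousAt
  · have : deriv (splitEnergy s a) = fun x => splitAngle s x - a :=
      funext fun x => (hasDerivAt_splitEnergy s a x).deriv
    rw [this]
    intro x y h
    have := splitAngle_strictMono hs hs' h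
    simpa using this

theorem splitEnergy_tangent {s : ℝ} (hs : 0 < s) (hs' : s < Real.pi) (a x y : ℝ) :
    splitEnergy s a x + (splitAngle s x - a) * (y - x) ≤ splitEnergy s a y := by
  have hcv := (strictConvexOn_splitEnergy hs hs' a).convexOn
  have hd := hasDerivAt_splitEnergy s a x
  rcases lt_trichotomy x y with h | rfl | h
  · have h1 := hcv.le_slope_of_hasDerivAt (mem_univ _) (mem_univ _) h hd
    rw [slope_def_field, le_div_iff₀ (by linarith)] at h1
    linarith
  · simp
  · have h1 := hcv.slope_le_of_hasDerivAt (mem_univ _) (mem_univ _) h hd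
    rw [slope_def_field, div_le_iff₀ (by linarith)] at h1
    linarith

/-- Where the split angle is `(a + s) / 2` or `a / 2`, the tangents have slopes of both signs. -/
theorem splitEnergy_coercive {s a : ℝ} (hs' : s < Real.pi) (ha : 0 < a) (has : a < s) :
    ∃ c > 0, ∃ C, ∀ x, c * |x| - C ≤ splitEnergy s a x := by
  have hs := ha.trans has
  obtain ⟨y, hy⟩ := exists_splitAngle_eq (a := (a + s) / 2) hs' (by linarith) (by linarith)
  obtain ⟨z, hz⟩ := exists_splitAngle_eq (a := a / 2) hs' (by linarith) (by linarith)
  set c := min ((s - a) / 2) (a / 2) with hc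
  have hc1 : c ≤ (s - a) / 2 := min_le_left _ _
  have hc2 : c ≤ a / 2 := min_le_right _ _
  refine ⟨c, lt_min (by linarith) (by linarith),
    max (-(splitEnergy s a y - (s - a) / 2 * y)) (-(splitEnergy s a z + a / 2 * z)), fun x => ?_⟩
  have h1 := splitEnergy_tangent hs hs' a y x
  have h2 := splitEnergy_tangent hs hs' a z x
  rw [hy] at h1
  rw [hz] at h2
  have h3 := le_max_left (-(splitEnergy s a y - (s - a) / 2 * y)) (-(splitEnergy s a z + a / 2 * z))
  have h4 := le_max_right (-(splitEnergy s a y - (s - a) / 2 * y)) (-(splitEnergy s a z + a / 2 * z))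
  rcases abs_cases x with ⟨h, h'⟩ | ⟨h, h'⟩ <;> rw [h]
  · nlinarith
  · nlinarith

/-- Minimizers of a continuous family of strictly convex coercive functions exist and depend
continuously on the parameter. -/
theorem exists_continuous_minimizer {Ω X : Type*} [TopologicalSpace Ω] [NormedAddCommGroup X]
    [NormedSpace ℝ X] [FiniteDimensional ℝ X] (E : Ω → X → ℝ)
    (hE : Continuous (Function.uncurry E)) (hcv : ∀ ω, StrictConvexOn ℝ univ (E ω))
    (hco : ∀ ω, Tendsto (E ω) (cocompact X) atTop) :
    ∃ m : Ω → X, Continuous m ∧ ∀ ω x, E ω (m ω) ≤ E ω x := by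
  have hEω : ∀ ω, Continuous (E ω) := fun ω => hE.comp (Continuous.prodMk_right ω)
  choose m hm using fun ω => (hEω ω).exists_forall_le (hco ω)
  refine ⟨m, continuous_iff_continuousAt.2 fun ω₀ => ?_, hm⟩
  have : ProperSpace X := FiniteDimensional.proper_real X
  have hlt : ∀ x, x ≠ m ω₀ → E ω₀ (m ω₀) < E ω₀ x := by
    intro x hx
    refine lt_of_le_of_ne (hm ω₀ x) fun h => ?_
    have h1 := (hcv ω₀).2 (mem_univ x) (mem_univ (m ω₀)) hx
      (by norm_num : (0 : ℝ) < 1 / 2) (by norm_num : (0 : ℝ) < 1 / 2) (by norm_num)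
    have h2 := hm ω₀ ((1 / 2 : ℝ) • x + (1 / 2 : ℝ) • m ω₀)
    simp only [smul_eq_mul] at h1
    linarith
  rw [Metric.continuousAt_iff']
  intro ε hε
  -- on the sphere of radius `ε / 2`, the function exceeds its value at the centre
  have hS : IsCompact (Metric.sphere (m ω₀) (ε / 2)) := isCompact_sphere _ _
  have hev : ∀ᶠ ω in 𝓝 ω₀, ∀ x ∈ Metric.sphere (m ω₀) (ε / 2), E ω (m ω₀) < E ω x := by
    refine hS.eventually_forall_of_forall_eventually fun x hx => ?_
    have hxm : x ≠ m ω₀ := by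
      rintro rfl
      rw [Metric.mem_sphere, dist_self] at hx; linarith
    have h1 : ContinuousAt (fun z : Ω × X => E z.1 (m ω₀)) (ω₀, x) :=
      (hE.comp (by fun_prop : Continuous fun z : Ω × X => (z.1, m ω₀))).continuousAt
    have h2 : ContinuousAt (fun z : Ω × X => E z.1 z.2) (ω₀, x) := hE.continuousAt
    exact h1.eventually_lt h2 (hlt x hxm)
  -- a minimizer outside of the sphere would contradict convexity on the segment from the centre
  filter_upwards [hev] with ω hω
  by_contra hd
  rw [not_lt] at hd
  set d := dist (m ω) (m ω₀) with hdd
  have hdpos : 0 < d := by linarith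
  set θ := ε / 2 / d with hθ
  have hθ0 : 0 ≤ θ := by positivity
  have hθ1 : θ ≤ 1 := by rw [hθ, div_le_one hdpos]; linarith
  have hx : θ • m ω + (1 - θ) • m ω₀ ∈ Metric.sphere (m ω₀) (ε / 2) := by
    rw [Metric.mem_sphere, dist_eq_norm]
    have : θ • m ω + (1 - θ) • m ω₀ - m ω₀ = θ • (m ω - m ω₀) := by module
    rw [this, norm_smul, ← dist_eq_norm, ← hdd, Real.norm_of_nonneg hθ0, hθ]
    field_simp
  have h1 := hω _ hx
  have h2 := (hcv ω).convexOn.2 (mem_univ (m ω)) (mem_univ (m ω₀)) hθ0 (by linarith : 0 ≤ 1 - θ)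
    (by ring)
  have h3 := hm ω (m ω₀)
  simp only [smul_eq_mul] at h2
  nlinarith

/-! ### Geometric angles with prescribed edge sums -/

namespace Corner

variable {V : Type*} [Fintype V] [DecidableEq V] {O : V → V → V → Prop} [hO : OrientedDisk O]

variable (O) in
/-- Positive angles whose sum over the two corners opposite to an inner edge is less than `π`. -/
def DelaunayAngles : Set (Corner O → ℝ) :=
  {α | (∀ t, 0 < α t) ∧ ∀ t, ¬ IsBdry t → α t + α t.twin < Real.pi}

/-- The angles `α` are those of triangles with circumdiameters `exp (R t)` whose common edges have
the same length. The function `R` of corners is constant on each triangle. -/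
structure IsGeometric (α R : Corner O → ℝ) : Prop where
  pos : ∀ t, 0 < α t
  lt_pi : ∀ t, ¬ IsBdry t → α t + α t.twin < Real.pi
  nxt_eq : ∀ t, R t.nxt = R t
  length_eq : ∀ t, Real.exp (R t.twin) * Real.sin (α t.twin) = Real.exp (R t) * Real.sin (α t)

/-- A function that changes the sign with the side of an edge and has vanishing sums over the
triangles is orthogonal to the differences of functions of triangles. -/
theorem sum_mul_sub_twin {β R : Corner O → ℝ} (hβ : ∀ t, β t.twin = -β t)
    (hβ' : ∀ t, β t + β t.nxt + β t.nxt.nxt = 0) (hR : ∀ t, R t.nxt = R t) :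
    ∑ t, β t * (R t.twin - R t) = 0 := by
  have h1 : ∑ t, β t * R t.twin = -∑ t, β t * R t := by
    rw [← sum_twin (fun t => β t * R t), ← Finset.sum_neg_distrib]
    exact Finset.sum_congr rfl fun t _ => by rw [hβ]; ring
  have h2 : ∑ t, β t * R t = 0 := by
    have h3 : ∑ t, β t.nxt * R t = ∑ t, β t * R t := by
      rw [← sum_nxt (fun t => β t * R t)]
      exact Finset.sum_congr rfl fun t _ => by rw [hR]
    have h4 : ∑ t, β t.nxt.nxt * R t = ∑ t, β t * R t := by
      rw [← h3, ← sum_nxt (fun t => β t.nxt * R t)]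
      exact Finset.sum_congr rfl fun t _ => by rw [hR]
    have h5 : ∑ t, (β t + β t.nxt + β t.nxt.nxt) * R t = 0 :=
      Finset.sum_eq_zero fun t _ => by rw [hβ', zero_mul]
    simp only [add_mul, Finset.sum_add_distrib, h3, h4] at h5
    linarith
  simp only [mul_sub, Finset.sum_sub_distrib, h1, h2]; ring

/-- Rivin's uniqueness theorem: geometric angles are determined by their edge sums. -/
theorem IsGeometric.unique {α α' R R' : Corner O → ℝ} (h : IsGeometric α R)
    (h' : IsGeometric α' R') (hs : edgeSum O α = edgeSum O α')
    (hf : ∀ t, α t + α t.nxt + α t.nxt.nxt = α' t + α' t.nxt + α' t.nxt.nxt) : α = α' := by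
  have hs' : ∀ t, α t + α t.twin = α' t + α' t.twin := fun t => congrFun hs t
  have hb : ∀ t, IsBdry t → α t = α' t := fun t ht => by
    have := hs' t
    rw [twin_of_isBdry ht] at this; linarith
  have h0 := sum_mul_sub_twin (β := fun t => α t - α' t) (R := fun t => R t - R' t)
    (fun t => by have := hs' t; linarith) (fun t => by have := hf t; linarith)
    (fun t => by rw [h.nxt_eq, h'.nxt_eq])
  have hpos : ∀ t, α t ≠ α' t → 0 < (α t - α' t) * ((R t.twin - R' t.twin) - (R t - R' t)) := by
    intro t hne
    have ht : ¬ IsBdry t := fun ht => hne (hb t ht)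
    set s := α t + α t.twin with hsd
    have h1 := h.pos t; have h2 := h.pos t.twin
    have h3 := h'.pos t; have h4 := h'.pos t.twin
    have h5 := h.lt_pi t ht
    have key : ∀ a x, 0 < a → a < s → Real.sin (s - a) = Real.exp (-x) * Real.sin a →
        splitAngle s x = a := fun a x h6 h7 h8 => (splitAngle_unique h5 h6 h7 h8).symm
    have e : ∀ {β Q : Corner O → ℝ}, IsGeometric β Q → β t + β t.twin = s →
        splitAngle s (Q t.twin - Q t) = β t := by
      intro β Q hβ hsum
      have := hβ.pos t; have := hβ.pos t.twin
      refine key _ _ (hβ.pos t) (by linarith) ?_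
      have h6 := hβ.length_eq t
      rw [← hsum, add_sub_cancel_left, neg_sub, Real.exp_sub]
      field_simp
      linarith
    have e1 := e h rfl
    have e2 := e h' (hs' t).symm
    have hmono := splitAngle_strictMono (s := s) (by linarith) h5
    rcases lt_or_gt_of_ne hne with hlt | hlt
    · rw [← e1, ← e2] at hlt
      have h7 := hmono.lt_iff_lt.1 hlt
      rw [← e1, ← e2]
      nlinarith
    · rw [← e1, ← e2] at hlt
      have h7 := hmono.lt_iff_lt.1 hlt
      rw [← e1, ← e2]
      nlinarith
  ext t
  by_contra hne
  refine absurd h0 (ne_of_gt (Finset.sum_pos' (fun t _ => ?_) ⟨t, Finset.mem_univ _, hpos t hne⟩))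
  by_cases h6 : α t = α' t
  · simp [h6]
  · exact (hpos t h6).le

variable (O) in
/-- The map from functions of corners to functions of triangles given by the triangle sums. -/
def triangleFun : (Corner O → ℝ) →ₗ[ℝ] (Corner O → ℝ) where
  toFun r t := r t + r t.nxt + r t.nxt.nxt
  map_add' _ _ := by ext; simp; ring
  map_smul' _ _ := by ext; simp; ring

variable (O) in
/-- The jumps across the edges of the functions of triangles. -/
noncomputable def jump : (Corner O → ℝ) →ₗ[ℝ] (Corner O → ℝ) where
  toFun r t := triangleFun O r t.twin - triangleFun O r t
  map_add' _ _ := by ext; simp; ring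
  map_smul' _ _ := by ext; simp; ring

/-- The sum of the energies of the inner edges. -/
noncomputable def energy (α : Corner O → ℝ) (x : Corner O → ℝ) : ℝ :=
  ∑ t, (open Classical in if IsBdry t then 0 else splitEnergy (α t + α t.twin) (α t) (x t))

theorem continuous_energy : Continuous fun z : DelaunayAngles O × LinearMap.range (jump O) =>
    energy (z.1 : Corner O → ℝ) (z.2 : Corner O → ℝ) := by
  unfold energy
  refine continuous_finsetSum _ fun t _ => ?_
  split_ifs with ht
  · exact continuous_const
  have hc : Continuous (Function.uncurry fun (ω : DelaunayAngles O) (u : ℝ) =>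
      splitAngle (ω.1 t + ω.1 t.twin) u - ω.1 t) := by
    have h1 : Continuous fun z : DelaunayAngles O × ℝ => z.1.1 t :=
      (continuous_apply t).comp (continuous_subtype_val.comp continuous_fst)
    have h2 : Continuous fun z : DelaunayAngles O × ℝ => z.1.1 t.twin :=
      (continuous_apply t.twin).comp (continuous_subtype_val.comp continuous_fst)
    refine Continuous.sub ?_ h1
    unfold splitAngle
    refine continuous_const.sub (Real.continuous_arctan.comp (Continuous.div ?_ ?_ ?_))
    · exact (Real.continuous_exp.comp continuous_snd.neg).add (Real.continuous_cos.comp (h1.add h2))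
    · exact Real.continuous_sin.comp (h1.add h2)
    · intro z
      exact (Real.sin_pos_of_pos_of_lt_pi (add_pos (z.1.2.1 _) (z.1.2.1 _)) (z.1.2.2 t ht)).ne'
  have h3 := intervalIntegral.continuous_parametric_primitive_of_continuous
    (μ := MeasureTheory.volume) (a₀ := 0) hc
  exact h3.comp (f := fun z : DelaunayAngles O × LinearMap.range (jump O) =>
    (z.1, (z.2 : Corner O → ℝ) t))
    (continuous_fst.prodMk ((continuous_apply t).comp (continuous_subtype_val.comp continuous_snd)))

theorem jump_isBdry {x : Corner O → ℝ} (hx : x ∈ LinearMap.range (jump O)) {t : Corner O}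
    (ht : IsBdry t) : x t = 0 := by
  obtain ⟨r, rfl⟩ := hx
  simp [jump, twin_of_isBdry ht]

theorem strictConvexOn_energy {α : Corner O → ℝ} (hα : α ∈ DelaunayAngles O) :
    StrictConvexOn ℝ univ fun x : LinearMap.range (jump O) => energy α (x : Corner O → ℝ) := by
  refine ⟨convex_univ, ?_⟩
  rintro ⟨x, hx⟩ - ⟨y, hy⟩ - hne a b ha hb hab
  obtain ⟨t₀, ht₀⟩ : ∃ t, x t ≠ y t := by
    by_contra! h
    exact hne (Subtype.ext (funext h))
  have hcv : ∀ t, ¬ IsBdry t → StrictConvexOn ℝ univ (splitEnergy (α t + α t.twin) (α t)) :=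
    fun t ht => strictConvexOn_splitEnergy (add_pos (hα.1 _) (hα.1 _)) (hα.2 t ht) _
  simp only [energy, smul_eq_mul, Finset.mul_sum, ← Finset.sum_add_distrib]
  refine Finset.sum_lt_sum (fun t _ => ?_) ⟨t₀, Finset.mem_univ _, ?_⟩
  · split_ifs with ht
    · simp
    · exact (hcv t ht).convexOn.2 (mem_univ _) (mem_univ _) ha.le hb.le hab
  · have ht : ¬ IsBdry t₀ := fun ht => ht₀ (by rw [jump_isBdry hx ht, jump_isBdry hy ht])
    rw [if_neg ht, if_neg ht, if_neg ht]
    exact (hcv t₀ ht).2 (mem_univ _) (mem_univ _) ht₀ ha hb hab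

/-- The energy of each edge grows linearly in both directions, because the given angle lies strictly
between `0` and the edge sum. -/
theorem tendsto_energy {α : Corner O → ℝ} (hα : α ∈ DelaunayAngles O) :
    Tendsto (fun x : LinearMap.range (jump O) => energy α (x : Corner O → ℝ))
      (cocompact _) atTop := by
  have h1 : ∀ t : Corner O, ∃ c > 0, ∃ C, ¬ IsBdry t →
      ∀ x, c * |x| - C ≤ splitEnergy (α t + α t.twin) (α t) x := by
    intro t
    by_cases ht : IsBdry t
    · exact ⟨1, one_pos, 0, fun h => absurd ht h⟩
    · obtain ⟨c, hc, C, h⟩ := splitEnergy_coercive (hα.2 t ht) (hα.1 t)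
        (by linarith [hα.1 t.twin] : α t < α t + α t.twin)
      exact ⟨c, hc, C, fun _ => h⟩
  choose c hc C hC using h1
  obtain ⟨a, b, d, ht₀, -⟩ := hO.exists_boundary
  obtain ⟨t₁, -, hmin⟩ := Finset.exists_min_image Finset.univ c ⟨⟨(a, b, d), ht₀⟩, Finset.mem_univ _⟩
  have hbound : ∀ x : LinearMap.range (jump O),
      c t₁ * ‖x‖ - ∑ t, |C t| ≤ energy α (x : Corner O → ℝ) := by
    rintro ⟨x, hx⟩
    have h2 : ∀ t, c t₁ * |x t| - |C t| ≤
        (open Classical in if IsBdry t then 0 else splitEnergy (α t + α t.twin) (α t) (x t)) := by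
      intro t
      split_ifs with ht
      · rw [jump_isBdry hx ht]; simp
      · have := hC t ht (x t)
        have h3 := mul_le_mul_of_nonneg_right (hmin t (Finset.mem_univ _)) (abs_nonneg (x t))
        have := le_abs_self (C t)
        linarith
    have h3 : ‖x‖ ≤ ∑ t, |x t| := by
      refine (pi_norm_le_iff_of_nonneg (by positivity)).2 fun t => ?_
      rw [Real.norm_eq_abs]
      exact Finset.single_le_sum (f := fun t => |x t|) (fun _ _ => abs_nonneg _) (Finset.mem_univ t)
    calc c t₁ * ‖x‖ - ∑ t, |C t| ≤ c t₁ * (∑ t, |x t|) - ∑ t, |C t| := by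
          have := mul_le_mul_of_nonneg_left h3 (hc t₁).le
          linarith
      _ = ∑ t, (c t₁ * |x t| - |C t|) := by rw [Finset.mul_sum, Finset.sum_sub_distrib]
      _ ≤ _ := Finset.sum_le_sum fun t _ => h2 t
  refine tendsto_atTop_mono hbound ?_
  exact tendsto_atTop_add_const_right _ _ (Tendsto.const_mul_atTop (hc t₁) (tendsto_norm_cocompact_atTop))

open Classical in
/-- At a critical point `x` of the energy, the angles obtained by splitting the edge sums in the
ratios given by `x` have the same triangle sums. -/
theorem triangle_sum_of_critical {α : Corner O → ℝ} (hα : α ∈ DelaunayAngles O)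
    (x : LinearMap.range (jump O))
    (hx : ∀ y : LinearMap.range (jump O), energy α (x : Corner O → ℝ) ≤ energy α (y : Corner O → ℝ))
    (β : Corner O → ℝ)
    (hβ : ∀ t, β t = if IsBdry t then 0 else splitAngle (α t + α t.twin) (x.1 t) - α t) (t : Corner O) :
    β t + β t.nxt + β t.nxt.nxt = 0 := by
  have htw : ∀ t, β t.twin = -β t := by
    intro t
    by_cases ht : IsBdry t
    · rw [twin_of_isBdry ht, hβ, if_pos ht, neg_zero]
    · obtain ⟨r, hr⟩ := x.2
      have hxt : x.1 t.twin = -x.1 t := by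
        rw [← hr]; simp [jump, twin_twin]
      rw [hβ, hβ, if_neg ht, if_neg (fun h => ht (isBdry_twin.1 h)), twin_twin, hxt,
        add_comm (α t.twin), splitAngle_neg (add_pos (hα.1 _) (hα.1 _)) (hα.2 t ht)]
      ring
  have hcrit : ∀ y : Corner O → ℝ, y ∈ LinearMap.range (jump O) → ∑ t, β t * y t = 0 := by
    intro y hy
    have hd : HasDerivAt (fun τ : ℝ => energy α (x.1 + τ • y)) (∑ t, β t * y t) 0 := by
      unfold energy
      refine HasDerivAt.fun_sum fun t _ => ?_
      rw [hβ]
      split_ifs with ht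
      · simpa using hasDerivAt_const (0 : ℝ) (0 : ℝ)
      · have h1 : HasDerivAt (fun τ : ℝ => (x.1 + τ • y) t) (y t) 0 := by
          simpa using ((hasDerivAt_id (0 : ℝ)).mul_const (y t)).const_add (x.1 t)
        have h2 := hasDerivAt_splitEnergy (α t + α t.twin) (α t) ((x.1 + (0 : ℝ) • y) t)
        have h3 := h2.comp (0 : ℝ) h1
        simpa [Function.comp_def] using h3
    refine IsLocalMin.hasDerivAt_eq_zero (Eventually.of_forall fun τ => ?_) hd
    simpa using hx (x + τ • ⟨y, hy⟩)
  -- test against the jump of the indicator of the corner `t`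
  have h1 := hcrit _ ⟨Pi.single t 1, rfl⟩
  have h2 : ∀ r : Corner O → ℝ, ∑ s, β s * jump O r s =
      -2 * ∑ s, (β s + β s.nxt + β s.nxt.nxt) * r s := by
    intro r
    have h3 : ∑ s, β s * triangleFun O r s.twin = -∑ s, β s * triangleFun O r s := by
      rw [← sum_twin (fun s => β s * triangleFun O r s), ← Finset.sum_neg_distrib]
      exact Finset.sum_congr rfl fun s _ => by rw [htw]; ring
    have h4 : ∑ s, β s * triangleFun O r s = ∑ s, (β s + β s.nxt + β s.nxt.nxt) * r s := by
      simp only [triangleFun, LinearMap.coe_mk, AddHom.coe_mk, mul_add, add_mul,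
        Finset.sum_add_distrib]
      have h5 : ∑ s, β s * r s.nxt = ∑ s, β s.nxt.nxt * r s := by
        rw [← sum_nxt (fun s => β s.nxt.nxt * r s)]; rfl
      have h6 : ∑ s, β s * r s.nxt.nxt = ∑ s, β s.nxt * r s := by
        rw [← sum_nxt (fun s => β s.nxt * r s),
          ← sum_nxt (fun s : Corner O => β s.nxt.nxt * r s.nxt)]; rfl
      rw [h5, h6]; ring
    simp only [jump, LinearMap.coe_mk, AddHom.coe_mk, mul_sub, Finset.sum_sub_distrib, h3, h4]
    ring
  rw [h2, Finset.sum_eq_single t (fun s _ hs => by simp [hs]) (by simp)] at h1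
  simpa using h1

/-- Rivin's existence theorem: angles can be changed to geometric ones with the same edge sums and
angle sums, continuously. -/
theorem exists_isGeometric : ∃ α R : DelaunayAngles O → Corner O → ℝ, Continuous α ∧ Continuous R ∧
    ∀ ω, IsGeometric (α ω) (R ω) ∧ edgeSum O (α ω) = edgeSum O ω ∧
      α ω - ω ∈ angleChange O := by
  classical
  obtain ⟨m, hm, hmin⟩ := exists_continuous_minimizer
    (fun (ω : DelaunayAngles O) (x : LinearMap.range (jump O)) =>
      energy (ω : Corner O → ℝ) (x : Corner O → ℝ))
    continuous_energy (fun ω => strictConvexOn_energy ω.2) (fun ω => tendsto_energy ω.2)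
  -- a linear choice of the logarithmic radii with given jumps
  obtain ⟨σ, hσ⟩ := (jump O).rangeRestrict.exists_rightInverse_of_surjective
    (LinearMap.range_eq_top.2 (jump O).surjective_rangeRestrict)
  have hσ' : ∀ x : LinearMap.range (jump O), jump O (σ x) = x := fun x =>
    congrArg Subtype.val (LinearMap.congr_fun hσ x)
  set α : DelaunayAngles O → Corner O → ℝ := fun ω t =>
    if IsBdry t then ω.1 t else splitAngle (ω.1 t + ω.1 t.twin) ((m ω).1 t) with hα
  have hαsum : ∀ ω t, α ω t + α ω t.twin = ω.1 t + ω.1 t.twin := by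
    intro ω t
    by_cases ht : IsBdry t
    · simp [hα, twin_of_isBdry ht, ht]
    · obtain ⟨r, hr⟩ := (m ω).2
      have hxt : (m ω).1 t.twin = -(m ω).1 t := by
        rw [← hr]; simp [jump, twin_twin]
      simp only [hα, isBdry_twin, ht, if_false, twin_twin, hxt, add_comm (ω.1 t.twin)]
      rw [splitAngle_neg (add_pos (ω.2.1 _) (ω.2.1 _)) (ω.2.2 t ht)]
      ring
  refine ⟨α, fun ω => triangleFun O (σ (m ω)), ?_, ?_, fun ω => ⟨⟨?_, ?_, ?_, ?_⟩, ?_, ?_⟩⟩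
  · refine continuous_pi fun t => ?_
    by_cases ht : IsBdry t
    · simp only [hα, ht, if_true]
      exact (continuous_apply t).comp continuous_subtype_val
    · simp only [hα, ht, if_false, splitAngle]
      have h1 : Continuous fun ω : DelaunayAngles O => ω.1 t + ω.1 t.twin :=
        ((continuous_apply t).comp continuous_subtype_val).add
          ((continuous_apply t.twin).comp continuous_subtype_val)
      have h2 : Continuous fun ω => (m ω).1 t :=
        (continuous_apply t).comp (continuous_subtype_val.comp hm)
      refine continuous_const.sub (Real.continuous_arctan.comp (Continuous.div ?_ ?_ ?_))
      · exact (Real.continuous_exp.comp h2.neg).add (Real.continuous_cos.comp h1)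
      · exact Real.continuous_sin.comp h1
      · exact fun ω => (Real.sin_pos_of_pos_of_lt_pi (add_pos (ω.2.1 _) (ω.2.1 _)) (ω.2.2 t ht)).ne'
  · exact (LinearMap.continuous_of_finiteDimensional _).comp
      ((LinearMap.continuous_of_finiteDimensional _).comp hm)
  · intro t
    simp only [hα]
    split_ifs
    · exact ω.2.1 t
    · exact splitAngle_pos _ _
  · intro t ht
    rw [hαsum]; exact ω.2.2 t ht
  · intro t
    simp only [triangleFun, LinearMap.coe_mk, AddHom.coe_mk, nxt_nxt_nxt]; ring
  · intro t
    by_cases ht : IsBdry t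
    · rw [twin_of_isBdry ht]
    · have h1 := congrFun (hσ' (m ω)) t
      have h2 := sin_sub_splitAngle (add_pos (ω.2.1 t) (ω.2.1 t.twin)) (ω.2.2 t ht) ((m ω).1 t)
      have h3 : splitAngle (ω.1 t + ω.1 t.twin) ((m ω).1 t) = α ω t := by simp [hα, ht]
      rw [h3, ← hαsum, add_sub_cancel_left, ← h1] at h2
      rw [h2, ← mul_assoc, ← Real.exp_add]
      congr 2
      simp only [jump, LinearMap.coe_mk, AddHom.coe_mk]; ring
  · ext t; exact hαsum ω t
  · have h1 : α ω - ω.1 ∈ antisymmetric O ⊓ LinearMap.ker (triangleSum O) := by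
      refine ⟨fun t => ?_, ?_⟩
      · have := hαsum ω t
        simp only [Pi.sub_apply]; linarith
      · rw [SetLike.mem_coe, LinearMap.mem_ker, triangleSum_eq_zero_iff]
        refine triangle_sum_of_critical ω.2 (m ω) (hmin ω) _ fun t => ?_
        simp only [Pi.sub_apply, hα]
        split_ifs <;> ring
    rw [← angleChange_inf_ker_edgeSum] at h1
    exact h1.1

end Corner

/-! ### Positively oriented triangles in the complex plane -/

theorem arg_pos_of_im_pos {z : ℂ} (h : 0 < z.im) : 0 < z.arg := by
  refine lt_of_le_of_ne (Complex.arg_nonneg_iff.2 h.le) fun h0 => ?_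
  exact h.ne' (Complex.arg_eq_zero_iff.1 h0.symm).2

theorem arg_lt_pi_of_im_pos {z : ℂ} (h : 0 < z.im) : z.arg < Real.pi :=
  Complex.arg_lt_pi_iff.2 (.inr h.ne')

namespace Corner

variable {V : Type*} [Fintype V] [DecidableEq V] {O : V → V → V → Prop} [hO : OrientedDisk O]

/-- The edge opposite to the corner `t`, as a vector. -/
def side (p : V → ℂ) (t : Corner O) : ℂ := p t.1.2.2 - p t.1.2.1

/-- The ratio of the two edges at the corner `t`. -/
noncomputable def ratio (p : V → ℂ) (t : Corner O) : ℂ :=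
  (p t.1.2.2 - p t.1.1) / (p t.1.2.1 - p t.1.1)

/-- The angle at the corner `t`, if the triangle is positively oriented. -/
noncomputable def ang (p : V → ℂ) (t : Corner O) : ℝ := (ratio p t).arg

variable (O) in
/-- All triangles are positively oriented by `p`. -/
def IsPositive (p : V → ℂ) : Prop := ∀ t : Corner O, 0 < (ratio p t).im

theorem ratio_eq (p : V → ℂ) (t : Corner O) : ratio p t = -side p t.nxt / side p t.nxt.nxt := by
  simp [ratio, side, nxt]

theorem side_ne_zero {p : V → ℂ} (hp : IsPositive O p) (t : Corner O) : side p t ≠ 0 := by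
  intro h
  have := hp t.nxt
  rw [ratio_eq] at this
  simp [h] at this

theorem side_add (p : V → ℂ) (t : Corner O) : side p t + side p t.nxt + side p t.nxt.nxt = 0 := by
  simp [side, nxt]

theorem side_twin (p : V → ℂ) {t : Corner O} (ht : ¬ IsBdry t) : side p t.twin = -side p t := by
  obtain ⟨⟨a, b, c⟩, h⟩ := t
  obtain ⟨d, hd, e⟩ := twin_fst_ne h ht
  rw [e]; simp [side]

theorem ang_pos {p : V → ℂ} (hp : IsPositive O p) (t : Corner O) : 0 < ang p t :=
  arg_pos_of_im_pos (hp t)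

theorem ang_lt_pi {p : V → ℂ} (hp : IsPositive O p) (t : Corner O) : ang p t < Real.pi :=
  arg_lt_pi_of_im_pos (hp t)

theorem ang_sum {p : V → ℂ} (hp : IsPositive O p) (t : Corner O) :
    ang p t + ang p t.nxt + ang p t.nxt.nxt = Real.pi := by
  have h1 := side_ne_zero hp t
  have h2 := side_ne_zero hp t.nxt
  have h3 := side_ne_zero hp t.nxt.nxt
  have hprod : ratio p t * ratio p t.nxt * ratio p t.nxt.nxt = -1 := by
    simp only [ratio_eq, nxt_nxt_nxt]
    field_simp
  have hr : ∀ s, ratio p s ≠ 0 := fun s h => by have := hp s; simp [h] at this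
  have hang : ((ang p t + ang p t.nxt + ang p t.nxt.nxt : ℝ) : Real.Angle) = (Real.pi : ℝ) := by
    rw [← Complex.arg_neg_one, ← hprod, Complex.arg_mul_coe_angle (mul_ne_zero (hr _) (hr _)) (hr _),
      Complex.arg_mul_coe_angle (hr _) (hr _)]
    rfl
  obtain ⟨k, hk⟩ := Real.Angle.angle_eq_iff_two_pi_dvd_sub.1 hang
  have hpi := Real.pi_pos
  have b1 := ang_pos hp t; have b2 := ang_pos hp t.nxt; have b3 := ang_pos hp t.nxt.nxt
  have b4 := ang_lt_pi hp t; have b5 := ang_lt_pi hp t.nxt; have b6 := ang_lt_pi hp t.nxt.nxt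
  have hk0 : k = 0 := by
    have h5 : (k : ℝ) < 1 := by nlinarith
    have h6 : (-1 : ℝ) < k := by nlinarith
    have h5' : k < 1 := by exact_mod_cast h5
    have h6' : -1 < k := by exact_mod_cast h6
    omega
  rw [hk0] at hk
  simp at hk
  linarith

/-- The logarithm of the diameter of the circumcircle. -/
noncomputable def logDiam (p : V → ℂ) (t : Corner O) : ℝ :=
  Real.log (‖side p t‖ * ‖ratio p t‖ / (ratio p t).im)

theorem exp_logDiam_mul_sin {p : V → ℂ} (hp : IsPositive O p) (t : Corner O) :
    Real.exp (logDiam p t) * Real.sin (ang p t) = ‖side p t‖ := by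
  have h1 := norm_pos_iff.2 (side_ne_zero hp t)
  have h2 := hp t
  have h3 : 0 < ‖ratio p t‖ := norm_pos_iff.2 fun h => by simp [h] at h2
  rw [logDiam, Real.exp_log (by positivity), ang, Complex.sin_arg]
  field_simp

theorem logDiam_nxt {p : V → ℂ} (hp : IsPositive O p) (t : Corner O) :
    logDiam p t.nxt = logDiam p t := by
  have h1 := side_ne_zero hp t
  have h2 := side_ne_zero hp t.nxt
  have h3 := side_ne_zero hp t.nxt.nxt
  have e := side_add p t
  have him : ∀ z w : ℂ, w ≠ 0 → (-z / w).im = -(z * (starRingEnd ℂ) w).im / ‖w‖ ^ 2 := by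
    intro z w hw
    rw [Complex.div_im, Complex.normSq_eq_norm_sq]
    simp
    ring
  have h4 := hp t
  have h5 := hp t.nxt
  rw [logDiam, logDiam]
  congr 1
  simp only [ratio_eq, nxt_nxt_nxt, him _ _ h1, him _ _ h3, norm_div, norm_neg] at h4 h5 ⊢
  have e3 : side p t.nxt.nxt = -(side p t + side p t.nxt) := by linear_combination e
  have e4 : (side p t.nxt.nxt * (starRingEnd ℂ) (side p t)).im =
      (side p t.nxt * (starRingEnd ℂ) (side p t.nxt.nxt)).im := by
    rw [e3]; simp; ring
  rw [e4] at h5 ⊢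
  have n1 := norm_pos_iff.2 h1; have n2 := norm_pos_iff.2 h2; have n3 := norm_pos_iff.2 h3
  have hne : (side p t.nxt * (starRingEnd ℂ) (side p t.nxt.nxt)).im ≠ 0 := by
    intro h; rw [h] at h4; simp at h4
  field_simp

/-- The law of sines: the edge opposite to a corner is the circumdiameter times the sine of the
angle. -/
theorem isGeometric_ang {p : V → ℂ} (hp : IsPositive O p)
    (hd : ∀ t : Corner O, ¬ IsBdry t → ang p t + ang p t.twin < Real.pi) :
    IsGeometric (ang p : Corner O → ℝ) (logDiam p) where
  pos := ang_pos hp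
  lt_pi := hd
  nxt_eq := logDiam_nxt hp
  length_eq t := by
    rw [exp_logDiam_mul_sin hp, exp_logDiam_mul_sin hp]
    by_cases ht : IsBdry t
    · rw [twin_of_isBdry ht]
    · rw [side_twin p ht, norm_neg]

theorem ratio_eq_sin {p : V → ℂ} (hp : IsPositive O p) (t : Corner O) :
    ratio p t = (Real.sin (ang p t.nxt) / Real.sin (ang p t.nxt.nxt) : ℝ) *
      Complex.exp (ang p t * Complex.I) := by
  have h3 := Complex.norm_mul_exp_arg_mul_I (ratio p t)
  have hs : 0 < Real.sin (ang p t.nxt.nxt) :=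
    Real.sin_pos_of_pos_of_lt_pi (ang_pos hp _) (ang_lt_pi hp _)
  rw [← ang] at h3
  rw [← h3]
  congr 2
  rw [ratio_eq, norm_div, norm_neg, ← exp_logDiam_mul_sin hp t.nxt,
    ← exp_logDiam_mul_sin hp t.nxt.nxt, logDiam_nxt hp t.nxt]
  have := Real.exp_pos (logDiam p t.nxt)
  field_simp

/-- Triangulations with the same angles are similar. -/
theorem exists_similarity {p p' : V → ℂ} (hp : IsPositive O p) (hp' : IsPositive O p')
    (h : (ang p : Corner O → ℝ) = ang p') :
    ∃ q : ℂ, q ≠ 0 ∧ ∀ a b, p' a - p' b = q * (p a - p b) := by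
  obtain ⟨a, b, c, ht₀, -⟩ := hO.exists_boundary
  set t₀ : Corner O := ⟨(a, b, c), ht₀⟩
  set q := side p' t₀ / side p t₀ with hq
  have hq0 : q ≠ 0 := div_ne_zero (side_ne_zero hp' _) (side_ne_zero hp _)
  have hall : ∀ t : Corner O, side p' t = q * side p t := by
    intro t
    refine connected_induction (fun t => side p' t = q * side p t) (fun t h1 => ?_) (fun t h1 => ?_)
      t₀ t ?_
    · have h2 := ratio_eq_sin hp t.nxt
      have h3 := ratio_eq_sin hp' t.nxt
      rw [h, ← h3, ratio_eq, ratio_eq, nxt_nxt_nxt, h1] at h2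
      have n1 := side_ne_zero hp t
      have h4 := side_add p t
      have h5 := side_add p' t
      rw [h1] at h5
      field_simp at h2
      linear_combination -h2 - q * h4 + h5
    · by_cases ht : IsBdry t
      · rw [twin_of_isBdry ht, h1]
      · rw [side_twin _ ht, side_twin _ ht, h1]; ring
    · rw [hq, div_mul_cancel₀ _ (side_ne_zero hp _)]
  have hconn : ∀ a b, p' b - q * p b = p' a - q * p a := by
    intro a b
    refine hO.conn (fun b => p' b - q * p b = p' a - q * p a) (fun x y z h => ?_) a b rfl
    have := hall ⟨(z, x, y), hO.rot (hO.rot h)⟩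
    simp only [side] at this
    have e : p' y - q * p y = p' x - q * p x := by linear_combination this
    rw [e]
  exact ⟨q, hq0, fun a b => by linear_combination -hconn a b⟩

theorem continuousAt_ratio {p : V → ℂ} (hp : IsPositive O p) (t : Corner O) :
    ContinuousAt (fun p : V → ℂ => ratio p t) p := by
  have h := side_ne_zero hp t.nxt.nxt
  unfold ratio
  refine ContinuousAt.div (by fun_prop) (by fun_prop) h

theorem continuousAt_ang {p : V → ℂ} (hp : IsPositive O p) (t : Corner O) :
    ContinuousAt (fun p : V → ℂ => ang p t) p :=
  (Complex.continuousAt_arg (x := ratio p t) (.inr (hp t).ne')).comp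
    (f := fun p : V → ℂ => ratio p t) (continuousAt_ratio hp t)

/-! ### Developing geometric angles -/

/-- The edge vectors obtained from those of `p` by turning the edges by `δ` and giving them the
lengths determined by geometric angles `α`. -/
noncomputable def newSide (p : V → ℂ) (α R δ : Corner O → ℝ) (t : Corner O) : ℂ :=
  (Real.exp (R t) * Real.sin (α t) : ℝ) * ((side p t / ‖side p t‖) * Complex.exp (δ t * Complex.I))

/-- The new edge vectors enclose the angles `α`, because the turns `δ` change the angles of `p` to
`α`. -/
theorem newSide_nxt {p : V → ℂ} (hp : IsPositive O p) {α R δ : Corner O → ℝ}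
    (hR : ∀ t, R t.nxt = R t) (hα : ∀ t, Real.sin (α t) ≠ 0)
    (hδ : ∀ t, δ t.nxt - δ t.nxt.nxt = α t - ang p t) (t : Corner O) :
    newSide p α R δ t.nxt = -newSide p α R δ t.nxt.nxt *
      (Real.sin (α t.nxt) / Real.sin (α t.nxt.nxt) : ℝ) * Complex.exp (α t * Complex.I) := by
  have h1 := Complex.norm_mul_exp_arg_mul_I (ratio p t)
  rw [← ang, ratio_eq] at h1
  have n1 := norm_pos_iff.2 (side_ne_zero hp t.nxt)
  have n2 := norm_pos_iff.2 (side_ne_zero hp t.nxt.nxt)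
  have n3 : (‖side p t.nxt‖ : ℂ) ≠ 0 := by exact_mod_cast n1.ne'
  have n4 : (‖side p t.nxt.nxt‖ : ℂ) ≠ 0 := by exact_mod_cast n2.ne'
  have n5 := side_ne_zero hp t.nxt.nxt
  have h2 : side p t.nxt / ‖side p t.nxt‖ = -(side p t.nxt.nxt / ‖side p t.nxt.nxt‖) *
      Complex.exp (ang p t * Complex.I) := by
    rw [norm_div, norm_neg] at h1
    push_cast at h1
    field_simp at h1 ⊢
    linear_combination h1
  have h3 : Complex.exp (δ t.nxt * Complex.I) = Complex.exp (δ t.nxt.nxt * Complex.I) *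
      Complex.exp (α t * Complex.I) * Complex.exp (-(ang p t * Complex.I)) := by
    rw [← Complex.exp_add, ← Complex.exp_add]
    congr 1
    have : (δ t.nxt : ℂ) = δ t.nxt.nxt + α t - ang p t := by
      have := hδ t
      rw [← Complex.ofReal_add, ← Complex.ofReal_sub]
      congr 1; linarith
    rw [this]; ring
  have h4 : Complex.exp (ang p t * Complex.I) * Complex.exp (-(ang p t * Complex.I)) = 1 := by
    rw [← Complex.exp_add, add_neg_cancel, Complex.exp_zero]
  have hs : (Real.sin (α t.nxt.nxt) : ℂ) ≠ 0 := by exact_mod_cast hα _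
  simp only [newSide]
  rw [h2, h3, hR t.nxt]
  push_cast
  push_cast at hs
  field_simp
  linear_combination (-(Complex.sin (α t.nxt))) * h4

theorem newSide_add {p : V → ℂ} (hp : IsPositive O p) {α R δ : Corner O → ℝ}
    (hR : ∀ t, R t.nxt = R t) (hα : ∀ t, Real.sin (α t) ≠ 0)
    (hδ : ∀ t, δ t.nxt - δ t.nxt.nxt = α t - ang p t)
    (hsum : ∀ t, α t + α t.nxt + α t.nxt.nxt = Real.pi) (t : Corner O) :
    newSide p α R δ t + newSide p α R δ t.nxt + newSide p α R δ t.nxt.nxt = 0 := by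
  have h1 := newSide_nxt hp hR hα hδ t
  have h2 := newSide_nxt hp hR hα hδ t.nxt
  rw [nxt_nxt_nxt] at h2
  have h4 : Complex.exp (α t.nxt * Complex.I) * Complex.exp (-(α t.nxt * Complex.I)) = 1 := by
    rw [← Complex.exp_add, add_neg_cancel, Complex.exp_zero]
  have n1 : (Real.sin (α t) : ℂ) ≠ 0 := by exact_mod_cast hα _
  have n2 : (Real.sin (α t.nxt.nxt) : ℂ) ≠ 0 := by exact_mod_cast hα _
  have h3 : Real.sin (α t.nxt.nxt) = Real.sin (α t + α t.nxt) := by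
    rw [← Real.sin_pi_sub, ← hsum t]; congr 1; ring
  have h3' : (Real.sin (α t.nxt.nxt) : ℂ) = Real.sin (α t) * Real.cos (α t.nxt) +
      Real.cos (α t) * Real.sin (α t.nxt) := by
    rw [h3, Real.sin_add]; push_cast; ring
  have e1 : Complex.exp (α t * Complex.I) = Real.cos (α t) + Real.sin (α t) * Complex.I := by
    rw [Complex.exp_mul_I]; push_cast; ring
  have e2 : Complex.exp (-(α t.nxt * Complex.I)) =
      Real.cos (α t.nxt) - Real.sin (α t.nxt) * Complex.I := by
    rw [← neg_mul, Complex.exp_mul_I, Complex.cos_neg, Complex.sin_neg]; push_cast; ring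
  set z := newSide p α R δ t
  set w := newSide p α R δ t.nxt.nxt
  have h5 : z = -w * (Real.sin (α t) / Real.sin (α t.nxt.nxt) : ℝ) *
      Complex.exp (-(α t.nxt * Complex.I)) := by
    rw [h2]
    push_cast
    push_cast at n1 n2
    field_simp
    linear_combination (-z) * h4
  rw [h1, h5, e1, e2]
  push_cast at h3' n2 ⊢
  field_simp
  linear_combination w * h3'

theorem newSide_twin (p : V → ℂ) {α R δ : Corner O → ℝ} (h : IsGeometric α R)
    (hδ : δ ∈ symmetric O) {t : Corner O} (ht : ¬ IsBdry t) :
    newSide p α R δ t.twin = -newSide p α R δ t := by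
  simp only [newSide, hδ t, h.length_eq t, side_twin p ht, norm_neg]
  ring

/-- Closed vector-valued functions of directed edges come from functions of vertices. -/
theorem exists_side_eq {z : Corner O → ℂ} (h1 : ∀ t, ¬ IsBdry t → z t.twin = -z t)
    (h2 : ∀ t, z t + z t.nxt + z t.nxt.nxt = 0) : ∃ P : V → ℂ, ∀ t : Corner O, side P t = z t := by
  obtain ⟨u, hu⟩ := exists_potential (α := fun t => (z t).re)
    (fun t ht => by simp [h1 t ht]) (fun t => by simpa using congrArg Complex.re (h2 t))
  obtain ⟨v, hv⟩ := exists_potential (α := fun t => (z t).im)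
    (fun t ht => by simp [h1 t ht]) (fun t => by simpa using congrArg Complex.im (h2 t))
  refine ⟨fun a => ⟨-u a, -v a⟩, fun t => ?_⟩
  have := hu t; have := hv t
  apply Complex.ext <;> simp [side] <;> linarith

/-- A continuous family of geometric angles, with the same angle sums as a triangulation `p₀`, is
realized by a continuous family of maps of the vertices to the plane. -/
theorem exists_develop {Ω : Type*} [TopologicalSpace Ω] {p₀ : V → ℂ} (hp₀ : IsPositive O p₀)
    {α R : Ω → Corner O → ℝ} (hα : Continuous α) (hR : Continuous R)
    (hg : ∀ ω, IsGeometric (α ω) (R ω)) (hm : ∀ ω, α ω - ang p₀ ∈ angleChange O) {i j : V}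
    (hij : ∃ t : Corner O, (t.1.2.1 = i ∧ t.1.2.2 = j) ∨ (t.1.2.1 = j ∧ t.1.2.2 = i)) :
    ∃ p : Ω → V → ℂ, Continuous p ∧ ∀ ω, p ω i = 0 ∧ p ω j = 1 ∧ IsPositive O (p ω) ∧
      (ang (p ω) : Corner O → ℝ) = α ω := by
  -- linear choices of the turns of the edges, and of the positions of the vertices
  set T : symmetric O →ₗ[ℝ] angleChange O := ((turn O).domRestrict (symmetric O)).codRestrict _
    (fun δ => turn_mem δ.2) with hT
  obtain ⟨σ, hσ⟩ := T.exists_rightInverse_of_surjective (LinearMap.range_eq_top.2 (by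
    rintro ⟨a, ha⟩
    obtain ⟨δ, hδ, h⟩ := exists_turn_eq ha
    exact ⟨⟨δ, hδ⟩, Subtype.ext h⟩))
  set S : (V → ℂ) →ₗ[ℝ] (Corner O → ℂ) :=
    { toFun := fun P t => side P t
      map_add' := fun _ _ => by ext; simp [side]; ring
      map_smul' := fun _ _ => by ext; simp [side]; ring } with hS
  obtain ⟨τ, hτ⟩ := S.rangeRestrict.exists_rightInverse_of_surjective
    (LinearMap.range_eq_top.2 S.surjective_rangeRestrict)
  set δ : Ω → Corner O → ℝ := fun ω => (σ ⟨_, hm ω⟩ : symmetric O) with hδ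
  have hδc : Continuous δ := by
    refine continuous_subtype_val.comp ((LinearMap.continuous_of_finiteDimensional σ).comp ?_)
    exact (hα.sub continuous_const).subtype_mk _
  have hδs : ∀ ω, δ ω ∈ symmetric O := fun ω => (σ ⟨_, hm ω⟩).2
  have hδt : ∀ ω t, δ ω t.nxt - δ ω t.nxt.nxt = α ω t - ang p₀ t := by
    intro ω t
    have h1 := LinearMap.congr_fun hσ ⟨_, hm ω⟩
    exact congrFun (congrArg Subtype.val h1) t
  have hsum : ∀ ω t, α ω t + α ω t.nxt + α ω t.nxt.nxt = Real.pi := by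
    intro ω t
    have h1 := (hm ω).1 t
    have h2 := ang_sum hp₀ t
    simp only [Pi.sub_apply] at h1
    linarith
  have hltpi : ∀ ω t, α ω t < Real.pi := by
    intro ω t
    have := hsum ω t
    linarith [(hg ω).pos t.nxt, (hg ω).pos t.nxt.nxt]
  have hsin : ∀ ω t, 0 < Real.sin (α ω t) := fun ω t =>
    Real.sin_pos_of_pos_of_lt_pi ((hg ω).pos t) (hltpi ω t)
  set z : Ω → Corner O → ℂ := fun ω => newSide p₀ (α ω) (R ω) (δ ω) with hz
  have hzc : Continuous z := by
    refine continuous_pi fun t => ?_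
    simp only [hz, newSide]
    have h1 := (continuous_apply t).comp hα
    have h2 := (continuous_apply t).comp hR
    have h3 := (continuous_apply t).comp hδc
    refine (Complex.continuous_ofReal.comp ((Real.continuous_exp.comp h2).mul
      (Real.continuous_sin.comp h1))).mul (continuous_const.mul (Complex.continuous_exp.comp ?_))
    exact (Complex.continuous_ofReal.comp h3).mul continuous_const
  have hzr : ∀ ω, z ω ∈ LinearMap.range S := by
    intro ω
    obtain ⟨P, hP⟩ := exists_side_eq (z := z ω) (fun t ht => newSide_twin p₀ (hg ω) (hδs ω) ht)
      (newSide_add hp₀ (hg ω).nxt_eq (fun t => (hsin ω t).ne') (hδt ω) (hsum ω))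
    exact ⟨P, funext hP⟩
  set P : Ω → V → ℂ := fun ω => τ ⟨z ω, hzr ω⟩ with hP
  have hPc : Continuous P := (LinearMap.continuous_of_finiteDimensional τ).comp (hzc.subtype_mk _)
  have hPz : ∀ ω t, side (P ω) t = z ω t := fun ω t =>
    congrFun (congrArg Subtype.val (LinearMap.congr_fun hτ ⟨z ω, hzr ω⟩)) t
  have hz0 : ∀ ω t, z ω t ≠ 0 := by
    intro ω t
    refine mul_ne_zero ?_ (mul_ne_zero (div_ne_zero (side_ne_zero hp₀ t) ?_) (Complex.exp_ne_zero _))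
    · exact_mod_cast (mul_pos (Real.exp_pos _) (hsin ω t)).ne'
    · exact_mod_cast (norm_pos_iff.2 (side_ne_zero hp₀ t)).ne'
  have hPij : ∀ ω, P ω j - P ω i ≠ 0 := by
    intro ω
    obtain ⟨t, ⟨rfl, rfl⟩ | ⟨rfl, rfl⟩⟩ := hij
    · rw [← side, hPz]; exact hz0 ω t
    · rw [← neg_sub, ← side, hPz]; exact neg_ne_zero.2 (hz0 ω t)
  have hratio : ∀ ω t, ratio (fun v => (P ω v - P ω i) / (P ω j - P ω i)) t =
      (Real.sin (α ω t.nxt) / Real.sin (α ω t.nxt.nxt) : ℝ) *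
        (Complex.cos (α ω t) + Complex.sin (α ω t) * Complex.I) := by
    intro ω t
    have h1 := newSide_nxt hp₀ (hg ω).nxt_eq (fun t => (hsin ω t).ne') (hδt ω) t
    have h2 : ratio (fun v => (P ω v - P ω i) / (P ω j - P ω i)) t = ratio (P ω) t := by
      simp only [ratio, ← sub_div, sub_sub_sub_cancel_right]
      rw [div_div_div_cancel_right₀ (hPij ω)]
    have h3 := hz0 ω t.nxt.nxt
    rw [h2, ratio_eq, hPz, hPz, ← Complex.exp_mul_I]
    simp only [hz] at h3 ⊢
    rw [h1]
    field_simp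
  have hquot : ∀ (ω : Ω) (t : Corner O), 0 < Real.sin (α ω t.nxt) / Real.sin (α ω t.nxt.nxt) := fun ω t =>
    div_pos (hsin _ _) (hsin _ _)
  refine ⟨fun ω v => (P ω v - P ω i) / (P ω j - P ω i), ?_, fun ω => ⟨?_, ?_, ?_, ?_⟩⟩
  · refine continuous_pi fun v => Continuous.div ?_ ?_ hPij
    · exact ((continuous_apply v).comp hPc).sub ((continuous_apply i).comp hPc)
    · exact ((continuous_apply j).comp hPc).sub ((continuous_apply i).comp hPc)
  · simp
  · exact div_self (hPij ω)
  · intro t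
    rw [hratio, ← Complex.ofReal_cos, ← Complex.ofReal_sin, Complex.im_ofReal_mul]
    simpa [Complex.sin_ofReal_re] using mul_pos (hquot ω t) (hsin ω t)
  · ext t
    rw [ang, hratio]
    exact Complex.arg_mul_cos_add_sin_mul_I (hquot ω t)
      ⟨by linarith [(hg ω).pos t, Real.pi_pos], (hltpi ω t).le⟩

end Corner

/-! ### Topology of the disk -/

theorem isConnected_ball_diff_center (x : Plane) {r : ℝ} (hr : 0 < r) :
    IsConnected (Metric.ball x r \ {x}) := by
  have hrank : 1 < Module.rank ℝ Plane := by
    rw [← Module.finrank_eq_rank, finrank_euclideanSpace_fin]; norm_num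
  have h1 : IsConnected (Metric.sphere (0 : Plane) 1 ×ˢ Ioo 0 r) :=
    (isConnected_sphere hrank 0 zero_le_one).prod (isConnected_Ioo hr)
  have h2 : Continuous fun z : Plane × ℝ => x + z.2 • z.1 := by fun_prop
  convert h1.image _ h2.continuousOn using 1
  ext y
  constructor
  · rintro ⟨hy, hyx⟩
    have hne : y - x ≠ 0 := sub_ne_zero.2 hyx
    have hn := norm_pos_iff.2 hne
    refine ⟨(‖y - x‖⁻¹ • (y - x), ‖y - x‖), ⟨?_, hn, by rwa [← dist_eq_norm]⟩, ?_⟩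
    · simp [norm_smul, hn.ne']
    · simp only [smul_smul, mul_inv_cancel₀ hn.ne', one_smul]; abel
  · rintro ⟨⟨u, s⟩, ⟨hu, hs0, hsr⟩, rfl⟩
    simp only [mem_sphere_iff_norm, sub_zero] at hu
    refine ⟨?_, ?_⟩
    · simp only [Metric.mem_ball, dist_eq_norm, add_sub_cancel_left, norm_smul, hu, mul_one,
        Real.norm_of_nonneg hs0.le]
      exact hsr
    · intro h
      simp only [mem_singleton_iff, add_eq_left, smul_eq_zero] at h
      rcases h with h | h
      · exact hs0.ne' h
      · simp [h] at hu

/-- Punctured neighbourhoods in a disk are connected. -/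
theorem exists_connected_punctured_closedBall (x : Metric.closedBall (0 : Plane) 1)
    {U : Set (Metric.closedBall (0 : Plane) 1)} (hU : U ∈ 𝓝 x) :
    ∃ N ∈ 𝓝 x, N ⊆ U ∧ IsConnected (N \ {x}) := by
  obtain ⟨ε, hε, hεU⟩ := Metric.mem_nhds_iff.1 hU
  have hx : ‖(x : Plane)‖ ≤ 1 := mem_closedBall_zero_iff.1 x.2
  have key : ∀ C : Set Plane, C ⊆ Metric.closedBall 0 1 → IsConnected C →
      IsConnected (((↑) : Metric.closedBall (0 : Plane) 1 → Plane) ⁻¹' C) := by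
    intro C hC hconn
    exact hconn.preimage_of_isClosedMap Subtype.val_injective
      Metric.isClosed_closedBall.isClosedEmbedding_subtypeVal.isClosedMap
      (by rwa [Subtype.range_coe])
  rcases lt_or_eq_of_le hx with h | h
  · -- an interior point
    set r := min ε (1 - ‖(x : Plane)‖) with hr
    have hr0 : 0 < r := lt_min hε (by linarith)
    refine ⟨Metric.ball x r, Metric.ball_mem_nhds x hr0,
      (Metric.ball_subset_ball (min_le_left _ _)).trans hεU, ?_⟩
    have h1 := key (Metric.ball (x : Plane) r \ {(x : Plane)}) ?_ (isConnected_ball_diff_center _ hr0)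
    · convert h1 using 1
      ext y; simp [Subtype.ext_iff, Subtype.dist_eq]
    · rintro y ⟨hy, -⟩
      rw [Metric.mem_ball, dist_eq_norm] at hy
      have h2 : r ≤ 1 - ‖(x : Plane)‖ := min_le_right _ _
      have h3 : ‖y‖ ≤ ‖y - x‖ + ‖(x : Plane)‖ := by
        simpa using norm_add_le (y - x) (x : Plane)
      simpa using by linarith
  · -- a boundary point is an extreme point, so the rest of the disk is convex
    refine ⟨Metric.ball x ε, Metric.ball_mem_nhds x hε, hεU, ?_⟩
    have hcv : Convex ℝ (Metric.ball (x : Plane) ε ∩ (Metric.closedBall 0 1 \ {(x : Plane)})) := by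
      refine (convex_ball _ _).inter ?_
      intro y hy z hz a b ha hb hab
      refine ⟨(convex_closedBall (0 : Plane) 1) hy.1 hz.1 ha hb hab, fun he => ?_⟩
      rcases eq_or_ne y z with rfl | hyz
      · rw [mem_singleton_iff, ← add_smul, hab, one_smul] at he
        exact hy.2 he
      rcases eq_or_lt_of_le ha with rfl | ha
      · obtain rfl : b = 1 := by linarith
        exact hz.2 (by simpa using he)
      rcases eq_or_lt_of_le hb with rfl | hb
      · obtain rfl : a = 1 := by linarith
        exact hy.2 (by simpa using he)
      have h1 := strictConvex_closedBall ℝ (0 : Plane) 1 hy.1 hz.1 hyz ha hb hab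
      rw [interior_closedBall _ one_ne_zero, mem_singleton_iff.1 he] at h1
      simp [h] at h1
    have hne : (Metric.ball (x : Plane) ε ∩ (Metric.closedBall 0 1 \ {(x : Plane)})).Nonempty := by
      set θ := min (ε / 2) 1 with hθ
      have hθ0 : 0 < θ := lt_min (by linarith) one_pos
      have hθ1 : θ ≤ 1 := min_le_right _ _
      have hθ2 : θ ≤ ε / 2 := min_le_left _ _
      refine ⟨(1 - θ) • (x : Plane), ?_, ?_, ?_⟩
      · rw [Metric.mem_ball, dist_eq_norm]
        have : (1 - θ) • (x : Plane) - x = -(θ • (x : Plane)) := by module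
        rw [this, norm_neg, norm_smul, h, mul_one, Real.norm_of_nonneg hθ0.le]
        linarith
      · simp only [mem_closedBall_zero_iff, norm_smul, h, mul_one, Real.norm_eq_abs]
        rw [abs_le]; constructor <;> linarith
      · intro he
        have := congrArg norm (mem_singleton_iff.1 he)
        rw [norm_smul, h, mul_one, Real.norm_of_nonneg (by linarith)] at this
        linarith
    have h1 := key _ (fun y hy => hy.2.1) (⟨hne, hcv.isPreconnected⟩ : IsConnected _)
    convert h1 using 1
    ext ⟨y, hy⟩
    simp [Subtype.ext_iff, Subtype.dist_eq]

section

variable {V : Type*} [Fintype V] {T : AbstractSimplicialComplex V}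

/-- A punctured neighbourhood of a point of a disk is not the union of two disjoint open sets which
both accumulate at the point. -/
theorem IsDisk.not_separated (hT : IsDisk T) (x : realization T) {U A B : Set (realization T)}
    (hU : U ∈ 𝓝 x) (hA : IsOpen A) (hB : IsOpen B) (hAB : ∀ y, y ∈ A → y ∉ B)
    (hUAB : ∀ y ∈ U, y ≠ x → y ∈ A ∨ y ∈ B) (hxA : ∃ᶠ y in 𝓝[≠] x, y ∈ A)
    (hxB : ∃ᶠ y in 𝓝[≠] x, y ∈ B) : False := by
  obtain ⟨h⟩ := hT
  obtain ⟨N, hN, hNU, hconn⟩ := exists_connected_punctured_closedBall (h x)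
    (U := h.symm ⁻¹' U) (h.symm.continuous.continuousAt.preimage_mem_nhds (by simpa using hU))
  have hN' : h ⁻¹' N ∈ 𝓝 x := h.continuous.continuousAt.preimage_mem_nhds hN
  have hconn' : IsPreconnected (h ⁻¹' N \ {x}) := by
    have := (h.symm.isPreconnected_image).2 hconn.isPreconnected
    convert this using 1
    ext y
    rw [h.symm.image_eq_preimage_symm]
    simp
  have hacc : ∀ C : Set (realization T), (∃ᶠ y in 𝓝[≠] x, y ∈ C) →
      ((h ⁻¹' N \ {x}) ∩ C).Nonempty := by
    intro C hC
    rw [frequently_nhdsWithin_iff] at hC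
    obtain ⟨y, ⟨hyC, hyx⟩, hyN⟩ := (hC.and_eventually hN').exists
    exact ⟨y, ⟨hyN, hyx⟩, hyC⟩
  obtain ⟨y, -, hyA, hyB⟩ := hconn' A B hA hB
    (fun y hy => hUAB y (by simpa using hNU hy.1) hy.2) (hacc A hxA) (hacc B hxB)
  exact hAB y hyA hyB

theorem IsDisk.neBot (hT : IsDisk T) (x : realization T) : (𝓝[≠] x).NeBot := by
  obtain ⟨h⟩ := hT
  rw [← mem_closure_iff_nhdsWithin_neBot, mem_closure_iff_nhds]
  intro U hU
  obtain ⟨N, hN, hNU, hconn⟩ := exists_connected_punctured_closedBall (h x)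
    (U := h.symm ⁻¹' U) (h.symm.continuous.continuousAt.preimage_mem_nhds (by simpa using hU))
  obtain ⟨y, hy, hyx⟩ := hconn.nonempty
  refine ⟨h.symm y, hNU hy, ?_⟩
  intro he
  exact hyx (by simp [← mem_singleton_iff.1 he])

theorem IsDisk.preconnectedSpace (hT : IsDisk T) : PreconnectedSpace (realization T) := by
  obtain ⟨h⟩ := hT
  have : PreconnectedSpace (Metric.closedBall (0 : Plane) 1) :=
    isPreconnected_iff_preconnectedSpace.1 Metric.isPreconnected_closedBall
  exact h.symm.surjective.denseRange.preconnectedSpace h.symm.continuous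

/-- Maps from a disk to the circle lift to the line. -/
theorem IsDisk.exists_lift (hT : IsDisk T) (F : C(realization T, AddCircle (1 : ℝ))) :
    ∃ G : C(realization T, ℝ), ∀ x, (G x : AddCircle (1 : ℝ)) = F x := by
  obtain ⟨h⟩ := hT
  have hcov : IsCoveringMap ((↑) : ℝ → AddCircle (1 : ℝ)) := AddCircle.isCoveringMap_coe 1
  set D := Metric.closedBall (0 : Plane) 1
  -- the contraction of the disk to its centre
  have hmem : ∀ (t : unitInterval) (y : D), (t : ℝ) • (y : Plane) ∈ D := by
    intro t y
    have hy : ‖(y : Plane)‖ ≤ 1 := mem_closedBall_zero_iff.1 y.2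
    simp only [D, mem_closedBall_zero_iff, norm_smul, Real.norm_of_nonneg t.2.1]
    exact mul_le_one₀ t.2.2 (norm_nonneg _) hy
  set H : C(unitInterval × D, AddCircle (1 : ℝ)) :=
    ⟨fun z => F (h.symm ⟨(z.1 : ℝ) • (z.2 : Plane), hmem z.1 z.2⟩), by
      refine F.continuous.comp (h.symm.continuous.comp (Continuous.subtype_mk ?_ _))
      exact (continuous_subtype_val.comp continuous_fst).smul
        (continuous_subtype_val.comp continuous_snd)⟩ with hH
  obtain ⟨e₀, he₀⟩ := QuotientAddGroup.mk_surjective (F (h.symm ⟨0, by simp [D]⟩))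
  have H_0 : ∀ y, H (0, y) = ((ContinuousMap.const D e₀ y : ℝ) : AddCircle (1 : ℝ)) := by
    intro y
    simp only [hH, ContinuousMap.coe_mk, ContinuousMap.const_apply]
    refine Eq.trans ?_ he₀.symm
    congr 3
    simp
  refine ⟨⟨fun x => hcov.liftHomotopy H _ H_0 (1, h x), by fun_prop⟩, fun x => ?_⟩
  have := congrFun (hcov.liftHomotopy_lifts (f := ContinuousMap.const D e₀) (H_0 := H_0)) (1, h x)
  simp only [Function.comp_apply] at this
  refine this.trans ?_
  simp [hH]

end

/-! ### Combinatorics of triangulated disks -/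

section

variable {V : Type*} [Fintype V] [DecidableEq V] {T : AbstractSimplicialComplex V}

theorem faces_subset {s t : Finset V} (hs : s ∈ T.faces) (hts : t ⊆ s) (ht : t.Nonempty) :
    t ∈ T.faces :=
  (T.isRelLowerSet_faces hs).2 hts ht

theorem mem_realization {x : V → ℝ} (hx : x ∈ stdSimplex ℝ V) {s : Finset V} (hs : s ∈ T.faces)
    (hxs : ∀ v, x v ≠ 0 → v ∈ s) : x ∈ realization T := by
  have hne : (Finset.univ.filter fun v => x v ≠ 0).Nonempty := by
    by_contra h
    rw [Finset.not_nonempty_iff_eq_empty, Finset.filter_eq_empty_iff] at h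
    have : ∑ v, x v = 0 := Finset.sum_eq_zero fun v hv => not_not.1 (h hv)
    rw [hx.2] at this
    exact one_ne_zero this
  exact ⟨hx, _, faces_subset hs (fun v hv => hxs v (by simpa using hv)) hne, fun v => by simp⟩

theorem mem_realization_nonneg {x : V → ℝ} (hx : x ∈ realization T) (v : V) : 0 ≤ x v := hx.1.1 v

theorem mem_faces_of_pos {x : V → ℝ} (hx : x ∈ realization T) {t : Finset V} (ht : t.Nonempty)
    (h : ∀ v ∈ t, 0 < x v) : t ∈ T.faces := by
  obtain ⟨s, hs, hxs⟩ := hx.2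
  exact faces_subset hs (fun v hv => (hxs v).1 (h v hv).ne') ht

theorem exists_pos_of_mem {x : V → ℝ} (hx : x ∈ realization T) : ∃ v, 0 < x v := by
  by_contra! h
  have := Finset.sum_nonpos fun v (_ : v ∈ Finset.univ) => h v
  rw [hx.1.2] at this
  linarith

theorem isOpen_coord_pos (v : V) : IsOpen {y : realization T | 0 < y.1 v} :=
  isOpen_lt continuous_const ((continuous_apply v).comp continuous_subtype_val)

/-- A set which contains the half-open segment from `x` to another point of a face accumulates
at `x`. -/
theorem frequently_of_segment {x z : realization T} {s : Finset V} (hs : s ∈ T.faces)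
    (hx : ∀ v, x.1 v ≠ 0 → v ∈ s) (hz : ∀ v, z.1 v ≠ 0 → v ∈ s) (hne : x ≠ z)
    {A : Set (realization T)}
    (hA : ∀ t ∈ Ioc (0 : ℝ) 1, ∀ y : realization T, y.1 = (1 - t) • x.1 + t • z.1 → y ∈ A) :
    ∃ᶠ y in 𝓝[≠] x, y ∈ A := by
  rw [frequently_nhdsWithin_iff]
  refine (mem_closure_iff_frequently (s := {y | y ∈ A ∧ y ∈ ({x}ᶜ : Set (realization T))})).1 ?_
  rw [Metric.mem_closure_iff]
  intro ε hε
  have hn : 0 < ‖z.1 - x.1‖ := norm_pos_iff.2 (sub_ne_zero.2 fun h => hne (Subtype.ext h.symm))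
  set t := min 1 (ε / (2 * ‖z.1 - x.1‖)) with ht
  have ht0 : 0 < t := lt_min one_pos (by positivity)
  have ht1 : t ≤ 1 := min_le_left _ _
  have ht2 : t * ‖z.1 - x.1‖ ≤ ε / 2 := by
    calc t * ‖z.1 - x.1‖ ≤ ε / (2 * ‖z.1 - x.1‖) * ‖z.1 - x.1‖ := by gcongr; exact min_le_right _ _
      _ = ε / 2 := by field_simp
  have hmem : (1 - t) • x.1 + t • z.1 ∈ realization T := by
    refine mem_realization (convex_stdSimplex ℝ V x.2.1 z.2.1 (by linarith) ht0.le (by ring)) hs ?_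
    intro v hv
    by_contra hvs
    have h1 : x.1 v = 0 := by_contra fun h => hvs (hx v h)
    have h2 : z.1 v = 0 := by_contra fun h => hvs (hz v h)
    simp [h1, h2] at hv
  have hsub : ((1 - t) • x.1 + t • z.1) - x.1 = t • (z.1 - x.1) := by module
  refine ⟨⟨_, hmem⟩, ⟨hA t ⟨ht0, ht1⟩ _ rfl, ?_⟩, ?_⟩
  · intro h
    have h1 := congrArg Subtype.val (mem_singleton_iff.1 h)
    simp only at h1
    rw [h1, sub_self, eq_comm, smul_eq_zero] at hsub
    rcases hsub with h2 | h2
    · exact ht0.ne' h2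
    · rw [h2, norm_zero] at hn; exact hn.ne rfl
  · rw [dist_comm, Subtype.dist_eq, dist_eq_norm, hsub, norm_smul, Real.norm_of_nonneg ht0.le]
    linarith

theorem eq_vertexPt_of_forall {v : V} {y : realization T} (h : ∀ w, w ≠ v → y.1 w = 0) :
    y = vertexPt T v := by
  have h1 := y.2.1.2
  rw [Finset.sum_eq_single v (fun w _ hw => h w hw) (by simp)] at h1
  ext w
  by_cases hw : w = v
  · subst hw; simp [vertexPt, h1]
  · simp [vertexPt, h w hw, hw]

/-- Otherwise `v` would be an isolated point of the disk. -/
theorem IsDisk.exists_edge (hT : IsDisk T) (v : V) : ∃ w, w ≠ v ∧ {v, w} ∈ T.faces := by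
  by_contra! h
  have hU : {y : realization T | 0 < y.1 v} ∈ 𝓝 (vertexPt T v) :=
    (isOpen_coord_pos v).mem_nhds (by simp [vertexPt])
  have := hT.neBot (vertexPt T v)
  obtain ⟨y, hyU, hyne⟩ := (Filter.eventually_iff.2 (mem_nhdsWithin_of_mem_nhds hU) |>.and
    (self_mem_nhdsWithin : {vertexPt T v}ᶜ ∈ 𝓝[≠] (vertexPt T v))).exists
  refine hyne (eq_vertexPt_of_forall fun w hw => ?_)
  by_contra hw0
  refine h w hw (mem_faces_of_pos y.2 (by simp) ?_)
  intro u hu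
  simp only [Finset.mem_insert, Finset.mem_singleton] at hu
  rcases hu with rfl | rfl
  · exact hyU
  · exact lt_of_le_of_ne (mem_realization_nonneg y.2 _) (Ne.symm hw0)

/-- Otherwise the midpoint of the edge would separate its neighbourhoods. -/
theorem IsDisk.exists_triangle (hT : IsDisk T) {v w : V} (hvw : v ≠ w) (he : {v, w} ∈ T.faces) :
    ∃ u, u ≠ v ∧ u ≠ w ∧ {v, w, u} ∈ T.faces := by
  by_contra! h
  have hm : (1 / 2 : ℝ) • (vertexPt T v).1 + (1 / 2 : ℝ) • (vertexPt T w).1 ∈ realization T := by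
    refine mem_realization (convex_stdSimplex ℝ V (vertexPt T v).2.1 (vertexPt T w).2.1
      (by norm_num) (by norm_num) (by norm_num)) he fun u hu => ?_
    by_contra hu'
    simp only [Finset.mem_insert, Finset.mem_singleton, not_or] at hu'
    simp [vertexPt, hu'.1, hu'.2] at hu
  set x : realization T := ⟨_, hm⟩ with hx
  have hxv : x.1 v = 1 / 2 := by simp [hx, vertexPt, hvw]
  have hxw : x.1 w = 1 / 2 := by simp [hx, vertexPt, hvw.symm]
  have hx0 : ∀ u, u ≠ v → u ≠ w → x.1 u = 0 := fun u h1 h2 => by simp [hx, vertexPt, h1, h2]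
  have hc : ∀ u, Continuous fun y : realization T => y.1 u := fun u =>
    (continuous_apply u).comp continuous_subtype_val
  have hxs : ∀ u, x.1 u ≠ 0 → u ∈ ({v, w} : Finset V) := by
    intro u hu
    by_contra hu'
    simp only [Finset.mem_insert, Finset.mem_singleton, not_or] at hu'
    exact hu (hx0 u hu'.1 hu'.2)
  have hvs : ∀ z, z = v ∨ z = w → ∀ u, (vertexPt T z).1 u ≠ 0 → u ∈ ({v, w} : Finset V) := by
    rintro z hz u hu
    have : u = z := by by_contra h; simp [vertexPt, h] at hu
    subst this; simpa using hz
  refine hT.not_separated x (U := {y | 0 < y.1 v} ∩ {y | 0 < y.1 w})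
    (A := {y | y.1 w < y.1 v}) (B := {y | y.1 v < y.1 w})
    (((isOpen_coord_pos v).inter (isOpen_coord_pos w)).mem_nhds ⟨by simp [hxv], by simp [hxw]⟩)
    (isOpen_lt (hc w) (hc v)) (isOpen_lt (hc v) (hc w))
    (fun y (h1 : y.1 w < y.1 v) (h2 : y.1 v < y.1 w) => lt_asymm h1 h2) ?_ ?_ ?_
  · rintro y ⟨hyv, hyw⟩ hyx
    have hy0 : ∀ u, u ≠ v → u ≠ w → y.1 u = 0 := by
      intro u h1 h2
      by_contra h3
      refine h u h1 h2 (mem_faces_of_pos y.2 (by simp) fun z hz => ?_)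
      simp only [Finset.mem_insert, Finset.mem_singleton] at hz
      rcases hz with rfl | rfl | rfl
      · exact hyv
      · exact hyw
      · exact lt_of_le_of_ne (mem_realization_nonneg y.2 _) (Ne.symm h3)
    have hsum : y.1 v + y.1 w = 1 := by
      rw [← y.2.1.2, ← Finset.sum_pair hvw]
      refine Finset.sum_subset (Finset.subset_univ _) fun u _ hu => ?_
      simp only [Finset.mem_insert, Finset.mem_singleton, not_or] at hu
      exact hy0 u hu.1 hu.2
    rcases lt_trichotomy (y.1 w) (y.1 v) with h1 | h1 | h1
    · exact .inl h1
    · refine absurd (Subtype.ext (funext fun u => ?_)) hyx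
      by_cases hu : u = v
      · rw [hu, hxv]; linarith
      by_cases hu' : u = w
      · rw [hu', hxw]; linarith
      rw [hy0 u hu hu', hx0 u hu hu']
    · exact .inr h1
  · refine frequently_of_segment (z := vertexPt T v) he hxs (hvs v (.inl rfl)) ?_ ?_
    · intro h1; have := congrArg (fun y : realization T => y.1 v) h1
      norm_num [hxv, vertexPt] at this
    · rintro t ht y hy
      simp only [mem_ofPred_eq, hy, Pi.add_apply, Pi.smul_apply, hxv, hxw, smul_eq_mul, vertexPt,
        Pi.single_eq_same, Pi.single_eq_of_ne hvw.symm]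
      linarith [ht.1]
  · refine frequently_of_segment (z := vertexPt T w) he hxs (hvs w (.inr rfl)) ?_ ?_
    · intro h1; have := congrArg (fun y : realization T => y.1 w) h1
      norm_num [hxw, vertexPt] at this
    · rintro t ht y hy
      simp only [mem_ofPred_eq, hy, Pi.add_apply, Pi.smul_apply, hxv, hxw, smul_eq_mul, vertexPt,
        Pi.single_eq_same, Pi.single_eq_of_ne hvw]
      linarith [ht.1]

/-- The link of a vertex is connected, since the vertex does not separate its neighbourhoods. -/
theorem IsDisk.link_connected (hT : IsDisk T) (v : V) (A : V → Prop)
    (hA : ∀ b c, b ≠ v → c ≠ v → {v, b, c} ∈ T.faces → A b → A c) {b c : V} (hb : b ≠ v) (hc : c ≠ v)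
    (hvb : {v, b} ∈ T.faces) (hvc : {v, c} ∈ T.faces) (hAb : A b) : A c := by
  by_contra hAc
  have key : ∀ P : V → Prop, IsOpen {y : realization T | 0 < y.1 v ∧ ∃ w, (w ≠ v ∧ P w) ∧ 0 < y.1 w} := by
    intro P
    have : {y : realization T | 0 < y.1 v ∧ ∃ w, (w ≠ v ∧ P w) ∧ 0 < y.1 w} =
        {y | 0 < y.1 v} ∩ ⋃ w ∈ {w | w ≠ v ∧ P w}, {y | 0 < y.1 w} := by
      ext y; simp
    rw [this]
    exact (isOpen_coord_pos v).inter (isOpen_biUnion fun w _ => isOpen_coord_pos w)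
  have hfreq : ∀ P : V → Prop, ∀ w, w ≠ v → P w → {v, w} ∈ T.faces → ∃ᶠ y in 𝓝[≠] (vertexPt T v),
      y ∈ {y : realization T | 0 < y.1 v ∧ ∃ w, (w ≠ v ∧ P w) ∧ 0 < y.1 w} := by
    intro P w hw hP he
    have hsing : ∀ z u, (vertexPt T z).1 u ≠ 0 → u = z := by
      intro z u hu; by_contra h; simp [vertexPt, h] at hu
    have hz : ∀ u, ((1 / 2 : ℝ) • (vertexPt T v).1 + (1 / 2 : ℝ) • (vertexPt T w).1) u ≠ 0 →
        u ∈ ({v, w} : Finset V) := by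
      intro u hu
      by_contra hu'
      simp only [Finset.mem_insert, Finset.mem_singleton, not_or] at hu'
      simp [vertexPt, hu'.1, hu'.2] at hu
    have hm := mem_realization (convex_stdSimplex ℝ V (vertexPt T v).2.1 (vertexPt T w).2.1
      (by norm_num : (0 : ℝ) ≤ 1 / 2) (by norm_num : (0 : ℝ) ≤ 1 / 2) (by norm_num)) he hz
    refine frequently_of_segment (z := ⟨_, hm⟩) he
      (fun u hu => by simp [hsing _ _ hu]) hz ?_ ?_
    · intro h1; have := congrArg (fun y : realization T => y.1 w) h1
      norm_num [vertexPt, hw] at this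
    · intro t ht y hy
      refine ⟨?_, w, ⟨hw, hP⟩, ?_⟩ <;> rw [hy] <;> simp [vertexPt, hw, hw.symm] <;> linarith [ht.1, ht.2]
  refine hT.not_separated (vertexPt T v) (U := {y | 0 < y.1 v}) ((isOpen_coord_pos v).mem_nhds
    (by simp [vertexPt])) (key A) (key fun w => ¬ A w) ?_ ?_ (hfreq A b hb hAb hvb)
    (hfreq (fun w => ¬ A w) c hc hAc hvc)
  · rintro y ⟨hyv, w, ⟨hw, hAw⟩, hyw⟩ ⟨-, u, ⟨hu, hAu⟩, hyu⟩
    refine hAu (hA w u hw hu (mem_faces_of_pos y.2 (by simp) fun z hz => ?_) hAw)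
    simp only [Finset.mem_insert, Finset.mem_singleton] at hz
    rcases hz with rfl | rfl | rfl <;> assumption
  · intro y hyv hyne
    obtain ⟨w, hw, hyw⟩ : ∃ w, w ≠ v ∧ y.1 w ≠ 0 := by
      by_contra! h
      exact hyne (eq_vertexPt_of_forall h)
    have hyw' : 0 < y.1 w := lt_of_le_of_ne (mem_realization_nonneg y.2 _) (Ne.symm hyw)
    by_cases h : A w
    · exact .inl ⟨hyv, w, ⟨hw, h⟩, hyw'⟩
    · exact .inr ⟨hyv, w, ⟨hw, h⟩, hyw'⟩

/-- The edges connect all vertices, since the disk is connected. -/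
theorem IsDisk.connected (hT : IsDisk T) (A : V → Prop)
    (hA : ∀ b c, {b, c} ∈ T.faces → A b → A c) {b c : V} (hAb : A b) : A c := by
  by_contra hAc
  have key : ∀ P : V → Prop, IsOpen {y : realization T | ∃ w, P w ∧ 0 < y.1 w} := by
    intro P
    have : {y : realization T | ∃ w, P w ∧ 0 < y.1 w} = ⋃ w ∈ {w | P w}, {y | 0 < y.1 w} := by
      ext y; simp
    rw [this]
    exact isOpen_biUnion fun w _ => isOpen_coord_pos w
  have := hT.preconnectedSpace
  obtain ⟨y, -, ⟨w, hw, hyw⟩, u, hu, hyu⟩ := (isPreconnected_univ (α := realization T)) _ _ (key A)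
    (key fun w => ¬ A w)
    (by
      rintro y -
      obtain ⟨w, hw⟩ := exists_pos_of_mem y.2
      by_cases h : A w
      · exact .inl ⟨w, h, hw⟩
      · exact .inr ⟨w, h, hw⟩)
    ⟨vertexPt T b, mem_univ _, b, hAb, by simp [vertexPt]⟩
    ⟨vertexPt T c, mem_univ _, c, hAc, by simp [vertexPt]⟩
  refine hu (hA w u (mem_faces_of_pos y.2 (by simp) fun z hz => ?_) hw)
  simp only [Finset.mem_insert, Finset.mem_singleton] at hz
  rcases hz with rfl | rfl <;> assumption

/-- Closed integral cochains on a triangulated disk are exact: modulo integers, they define a map to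
the circle, which lifts to the line. -/
theorem IsDisk.exact_int (hT : IsDisk T) (n : V → V → ℤ) (hn : ∀ a b, n b a = -n a b)
    (hcl : ∀ a b c, {a, b, c} ∈ T.faces → n a b + n b c + n c a = 0) :
    ∃ u : V → ℤ, ∀ a b, {a, b} ∈ T.faces → n a b = u a - u b := by
  -- on the star of `v`, the linear function with the values `n v w` at the vertices `w`
  set g : V → realization T → ℝ := fun v x => ∑ w, x.1 w * n v w with hg
  have hgc : ∀ v, Continuous (g v) := fun v => by
    refine continuous_finsetSum _ fun w _ => ?_
    exact ((continuous_apply w).comp continuous_subtype_val).mul continuous_const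
  have hgg : ∀ (u v : V) (x : realization T), 0 < x.1 u → 0 < x.1 v → g v x = g u x + n v u := by
    intro u v x hu hv
    have h1 : ∀ w, x.1 w * n v w = x.1 w * n u w + x.1 w * n v u := by
      intro w
      by_cases hw : x.1 w = 0
      · simp [hw]
      have hface : {u, w, v} ∈ T.faces := by
        refine mem_faces_of_pos x.2 (by simp) fun z hz => ?_
        simp only [Finset.mem_insert, Finset.mem_singleton] at hz
        rcases hz with rfl | rfl | rfl
        · exact hu
        · exact lt_of_le_of_ne (mem_realization_nonneg x.2 _) (Ne.symm hw)
        · exact hv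
      have h2 := hcl u w v hface
      have h3 : n v w = n u w + n v u := by
        have := hn v w
        linarith
      rw [h3]; push_cast; ring
    simp only [hg]
    rw [Finset.sum_congr rfl fun w _ => h1 w, Finset.sum_add_distrib, ← Finset.sum_mul, x.2.1.2,
      one_mul]
  choose v hv using fun x : realization T => exists_pos_of_mem x.2
  set F : realization T → AddCircle (1 : ℝ) := fun x => (g (v x) x : AddCircle (1 : ℝ)) with hF
  have hFg : ∀ w (x : realization T), 0 < x.1 w → F x = (g w x : AddCircle (1 : ℝ)) := by
    intro w x hw
    simp only [hF, hgg w (v x) x hw (hv x), AddCircle.coe_add]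
    have h4 : ((n (v x) w : ℝ) : AddCircle (1 : ℝ)) = 0 :=
      (AddCircle.coe_eq_zero_iff (1 : ℝ)).2 ⟨n (v x) w, by simp⟩
    rw [h4, add_zero]
  have hFc : Continuous F := by
    refine continuous_iff_continuousAt.2 fun x => ?_
    have h1 : F =ᶠ[𝓝 x] fun y => (g (v x) y : AddCircle (1 : ℝ)) := by
      filter_upwards [(isOpen_coord_pos (v x)).mem_nhds (hv x)] with y hy
      exact hFg _ y hy
    exact ((AddCircle.continuous_mk' 1).comp (hgc (v x))).continuousAt.congr h1.symm
  obtain ⟨G, hG⟩ := hT.exists_lift ⟨F, hFc⟩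
  have hint : ∀ (w : V) (x : realization T), 0 < x.1 w → ∃ k : ℤ, G x - g w x = k := by
    intro w x hw
    have h1 := hG x
    simp only [ContinuousMap.coe_mk, hFg w x hw] at h1
    rw [← sub_eq_zero, ← AddCircle.coe_sub, AddCircle.coe_eq_zero_iff] at h1
    obtain ⟨k, hk⟩ := h1
    exact ⟨k, by rw [← hk]; simp⟩
  have hgv : ∀ w u, g w (vertexPt T u) = n w u := by
    intro w u
    simp only [hg]
    rw [Finset.sum_eq_single u]
    · simp [vertexPt]
    · intro z _ hz; simp [vertexPt, hz]
    · simp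
  have hn0 : ∀ a, n a a = 0 := fun a => by have := hn a a; omega
  have hGv : ∀ a, ∃ k : ℤ, G (vertexPt T a) = k := by
    intro a
    obtain ⟨k, hk⟩ := hint a (vertexPt T a) (by simp [vertexPt])
    rw [hgv, hn0] at hk
    exact ⟨k, by simpa using hk⟩
  choose m hm using hGv
  refine ⟨fun a => -m a, fun a b hab => ?_⟩
  -- along the edge, the difference of `G` and of the linear function is an integer
  have hmem : ∀ t : unitInterval, (1 - t.1) • (vertexPt T a).1 + t.1 • (vertexPt T b).1 ∈
      realization T := by
    intro t
    refine mem_realization (convex_stdSimplex ℝ V (vertexPt T a).2.1 (vertexPt T b).2.1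
      (by linarith [t.2.2]) t.2.1 (by ring)) hab fun u hu => ?_
    by_contra hu'
    simp only [Finset.mem_insert, Finset.mem_singleton, not_or] at hu'
    simp [vertexPt, hu'.1, hu'.2] at hu
  set γ : unitInterval → realization T := fun t => ⟨_, hmem t⟩ with hγ
  have hγc : Continuous γ := by
    refine Continuous.subtype_mk ?_ _
    fun_prop
  have hgγ : ∀ t, g a (γ t) = t.1 * n a b := by
    intro t
    simp only [hg, hγ, Pi.add_apply, Pi.smul_apply, smul_eq_mul, add_mul, Finset.sum_add_distrib,
      mul_assoc, ← Finset.mul_sum]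
    have h1 := hgv a a
    have h2 := hgv a b
    simp only [hg] at h1 h2
    rw [h1, h2, hn0]; simp
  have hγ1 : γ 1 = vertexPt T b := Subtype.ext (by simp [hγ])
  have hγ0 : γ 0 = vertexPt T a := Subtype.ext (by simp [hγ])
  have hZ : ∀ t, G (γ t) - g a (γ t) ∈ range ((↑) : ℤ → ℝ) := by
    intro t
    by_cases ht : t = 1
    · rw [ht, hgγ, hγ1, hm]; exact ⟨m b - n a b, by push_cast; simp⟩
    · obtain ⟨k, hk⟩ := hint a (γ t) (by
        have : t.1 < 1 := lt_of_le_of_ne t.2.2 fun h => ht (Subtype.ext h)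
        have h2 := mem_realization_nonneg (vertexPt T b).2 a
        simp only [hγ, Pi.add_apply, Pi.smul_apply, smul_eq_mul]
        have h3 : (vertexPt T a).1 a = 1 := by simp [vertexPt]
        rw [h3]
        nlinarith [t.2.1])
      exact ⟨k, hk.symm⟩
  have hdisc : IsDiscrete (range ((↑) : ℤ → ℝ)) := isDiscrete_iff_discreteTopology.2
    (Int.isClosedEmbedding_coe_real.isEmbedding.toHomeomorph.symm.isEmbedding.discreteTopology)
  have hconst : G (γ 0) - g a (γ 0) = G (γ 1) - g a (γ 1) :=
    (isPreconnected_univ (α := unitInterval)).constant_of_mapsTo hdisc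
      (f := fun t => G (γ t) - g a (γ t))
      ((G.continuous.comp hγc).sub ((hgc a).comp hγc)).continuousOn
      (fun t _ => hZ t) (mem_univ 0) (mem_univ 1)
  rw [hgγ, hgγ, hγ0, hγ1, hm, hm] at hconst
  have h5 : (n a b : ℝ) = m b - m a := by simp at hconst; linarith
  have h6 : n a b = m b - m a := by exact_mod_cast h5
  linarith

/-- Closed real cochains on a triangulated disk are exact. The values of a cochain generate a free
group of finite rank, so that it is a combination of integral cochains. -/
theorem IsDisk.exact (hT : IsDisk T) (κ : V → V → ℝ) (hκ : ∀ a b, κ b a = -κ a b)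
    (hcl : ∀ a b c, {a, b, c} ∈ T.faces → κ a b + κ b c + κ c a = 0) :
    ∃ u : V → ℝ, ∀ a b, {a, b} ∈ T.faces → κ a b = u a - u b := by
  set M : Submodule ℤ ℝ := Submodule.span ℤ (range fun z : V × V => κ z.1 z.2) with hM
  have hfin : Module.Finite ℤ M := Module.Finite.span_of_finite ℤ (finite_range _)
  have hfree : Module.Free ℤ M := inferInstance
  set B := Module.finBasis ℤ M
  have hmem : ∀ a b, κ a b ∈ M := fun a b => Submodule.subset_span ⟨(a, b), rfl⟩
  set κ' : V → V → M := fun a b => ⟨κ a b, hmem a b⟩ with hκ'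
  have h1 : ∀ k, ∃ u : V → ℤ, ∀ a b, {a, b} ∈ T.faces → B.repr (κ' a b) k = u a - u b := by
    intro k
    refine hT.exact_int (fun a b => B.repr (κ' a b) k) (fun a b => ?_) fun a b c h => ?_
    · have : κ' b a = -κ' a b := Subtype.ext (hκ a b)
      simp [this]
    · have : κ' a b + κ' b c + κ' c a = 0 := Subtype.ext (hcl a b c h)
      have h2 := congrArg (fun z => B.repr z k) this
      simpa using h2
  choose u hu using h1
  refine ⟨fun a => ∑ k, (u k a : ℝ) * (B k : ℝ), fun a b hab => ?_⟩
  have h2 := congrArg (Subtype.val : M → ℝ) (B.sum_repr (κ' a b))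
  rw [← Finset.sum_sub_distrib]
  refine h2.symm.trans ?_
  rw [Submodule.coe_sum]
  refine Finset.sum_congr rfl fun k _ => ?_
  rw [hu k a b hab]
  simp only [Submodule.coe_smul, zsmul_eq_mul]
  push_cast; ring

end

/-! ### Orientation of an embedded triangulated disk -/

section

variable {V : Type*} [Fintype V] [DecidableEq V]

/-- The piecewise linear map with the vertex images `p`, in barycentric coordinates. -/
noncomputable abbrev plMap (p : V → ℂ) : (V → ℝ) →ₗ[ℝ] ℂ := Fintype.linearCombination ℝ p

theorem plMap_single (p : V → ℂ) (v : V) (r : ℝ) : plMap p (Pi.single v r) = r • p v :=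
  Fintype.linearCombination_apply_single ℝ p v r

theorem continuous_plMap (p : V → ℂ) : Continuous (plMap p) :=
  LinearMap.continuous_of_finiteDimensional _

/-- The determinant of the vectors `z` and `w`. -/
def cross (z w : ℂ) : ℝ := z.re * w.im - z.im * w.re

theorem im_div_pos_iff {z w : ℂ} : 0 < (w / z).im ↔ 0 < cross z w := by
  by_cases hz : z = 0
  · simp [hz, cross]
  have h : 0 < Complex.normSq z := Complex.normSq_pos.2 hz
  have : (w / z).im = cross z w / Complex.normSq z := by
    rw [Complex.div_im, cross]; field_simp
  rw [this, div_pos_iff_of_pos_right h]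

theorem exists_smul_eq_of_cross_eq_zero {z w : ℂ} (hz : z ≠ 0) (h : cross z w = 0) :
    ∃ r : ℝ, w = r • z := by
  refine ⟨(w / z).re, ?_⟩
  have him : (w / z).im = 0 := by
    rw [Complex.div_im, ← sub_div, cross] at *
    rw [show w.im * z.re - w.re * z.im = 0 by linarith, zero_div]
  have : (((w / z).re : ℝ) : ℂ) = w / z := Complex.ext (by simp) (by simp [him])
  rw [Complex.real_smul, this, div_mul_cancel₀ _ hz]

theorem cross_swap (z w : ℂ) : cross w z = -cross z w := by simp [cross]; ring

/-- Cramer's rule. -/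
theorem cross_mul_eq (b c z : ℂ) :
    (cross b c : ℂ) * z = (cross z c : ℂ) * b + (cross b z : ℂ) * c := by
  apply Complex.ext <;> simp [cross] <;> ring

theorem exists_smul_add_smul_eq {b c : ℂ} (h : cross b c ≠ 0) (z : ℂ) :
    z = (cross z c / cross b c) • b + (cross b z / cross b c) • c := by
  have h1 := cross_mul_eq b c z
  have h2 : (cross b c : ℂ) ≠ 0 := by exact_mod_cast h
  simp only [Complex.real_smul]
  push_cast
  field_simp
  linear_combination h1

theorem eq_zero_of_cross_ne_zero {b c : ℂ} (h : cross b c ≠ 0) {s t : ℝ}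
    (he : s • b + t • c = 0) : s = 0 ∧ t = 0 := by
  have h1 := congrArg (fun z => cross z c) he
  have h2 := congrArg (fun z => cross b z) he
  simp only [cross, Complex.add_re, Complex.add_im, Complex.real_smul, Complex.re_ofReal_mul,
    Complex.im_ofReal_mul, Complex.zero_re, Complex.zero_im] at h1 h2
  constructor
  · refine (mul_eq_zero.1 (?_ : s * cross b c = 0)).resolve_right h
    simp only [cross]; linarith
  · refine (mul_eq_zero.1 (?_ : t * cross b c = 0)).resolve_right h
    simp only [cross]; linarith

variable (T : AbstractSimplicialComplex V) (p : V → ℂ)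

/-- The triangles of `T` in the order in which `p` maps them to positively oriented triangles. -/
def OrientedTriangle (a b c : V) : Prop :=
  {a, b, c} ∈ T.faces ∧ 0 < cross (p b - p a) (p c - p a)

variable {T p}

theorem OrientedTriangle.rot {a b c : V} (h : OrientedTriangle T p a b c) :
    OrientedTriangle T p b c a := by
  refine ⟨?_, ?_⟩
  · have : ({b, c, a} : Finset V) = {a, b, c} := by ext; simp; tauto
    rw [this]; exact h.1
  · have := h.2
    simp only [cross, Complex.sub_re, Complex.sub_im] at this ⊢
    linarith

theorem OrientedTriangle.ne {a b c : V} (h : OrientedTriangle T p a b c) : a ≠ b := by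
  rintro rfl; simpa [cross] using h.2

theorem OrientedTriangle.asymm {a b c : V} (h : OrientedTriangle T p a b c) :
    ¬ OrientedTriangle T p b a c := by
  intro h'
  have h1 := h.2
  have h2 := h'.2
  simp only [cross, Complex.sub_re, Complex.sub_im] at h1 h2
  linarith

variable (hp : InjOn (plMap p) (realization T))

include hp in
/-- An injective piecewise linear map is injective on the tangent directions at any point. -/
theorem eq_of_plMap_eq {m d d' : V → ℝ} {s s' : Finset V} (hs : s ∈ T.faces) (hs' : s' ∈ T.faces)
    (hm : m ∈ stdSimplex ℝ V) (hms : ∀ v, m v ≠ 0 → v ∈ s) (hms' : ∀ v, m v ≠ 0 → v ∈ s')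
    (hds : ∀ v, d v ≠ 0 → v ∈ s) (hds' : ∀ v, d' v ≠ 0 → v ∈ s')
    (h1 : ∑ v, d v = 0) (h1' : ∑ v, d' v = 0) (h2 : ∀ v, m v = 0 → 0 ≤ d v)
    (h2' : ∀ v, m v = 0 → 0 ≤ d' v) (he : plMap p d = plMap p d') : d = d' := by
  have key : ∀ d : V → ℝ, (∀ v, m v = 0 → 0 ≤ d v) →
      ∀ᶠ ε in 𝓝[>] (0 : ℝ), ∀ v, 0 ≤ (m + ε • d) v := by
    intro d h2
    refine eventually_all.2 fun v => ?_
    by_cases hv : m v = 0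
    · filter_upwards [self_mem_nhdsWithin] with ε hε
      simpa [hv] using mul_nonneg (le_of_lt hε) (h2 v hv)
    · have hv' : 0 < m v := lt_of_le_of_ne (hm.1 v) (Ne.symm hv)
      have hc : Tendsto (fun ε : ℝ => (m + ε • d) v) (𝓝[>] 0) (𝓝 (m v)) := by
        have : ContinuousAt (fun ε : ℝ => (m + ε • d) v) 0 := by
          simp only [Pi.add_apply, Pi.smul_apply, smul_eq_mul]; fun_prop
        have h3 := this.tendsto.mono_left (nhdsWithin_le_nhds (s := Ioi 0))
        simpa using h3
      filter_upwards [hc.eventually (lt_mem_nhds hv')] with ε hε using hε.le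
  obtain ⟨ε, ⟨h3, h3'⟩, hε⟩ := (((key d h2).and (key d' h2')).and self_mem_nhdsWithin).exists
  have hmem : ∀ (d : V → ℝ) (s : Finset V), s ∈ T.faces → (∀ v, m v ≠ 0 → v ∈ s) →
      (∀ v, d v ≠ 0 → v ∈ s) → ∑ v, d v = 0 → (∀ v, 0 ≤ (m + ε • d) v) →
      m + ε • d ∈ realization T := by
    intro d s hs hm1 hd1 hd2 h3
    refine mem_realization ⟨h3, ?_⟩ hs fun v hv => ?_
    · simp [Finset.sum_add_distrib, ← Finset.mul_sum, hd2, hm.2]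
    · by_contra hvs
      have e1 : m v = 0 := by_contra fun h => hvs (hm1 v h)
      have e2 : d v = 0 := by_contra fun h => hvs (hd1 v h)
      simp [e1, e2] at hv
  have := hp (hmem d s hs hms hds h1 h3) (hmem d' s' hs' hms' hds' h1' h3')
    (by simp only [map_add, map_smul, he])
  exact smul_right_injective _ (ne_of_gt hε) (add_left_cancel this)

include hp in
theorem eq_zero_of_plMap_eq_zero {d : V → ℝ} {s : Finset V} (hs : s ∈ T.faces)
    (hds : ∀ v, d v ≠ 0 → v ∈ s) (h1 : ∑ v, d v = 0) (he : plMap p d = 0) : d = 0 := by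
  have hne : s.Nonempty := (T.isRelLowerSet_faces hs).1
  have hc : (0 : ℝ) < s.card := by exact_mod_cast hne.card_pos
  refine eq_of_plMap_eq hp (m := fun v => if v ∈ s then (s.card : ℝ)⁻¹ else 0) hs hs ⟨?_, ?_⟩
    ?_ ?_ hds (by simp) h1 (by simp) ?_ (by simp) (by simpa using he)
  · intro v; dsimp only; split_ifs <;> positivity
  · simp [hc.ne']
  · intro v hv; by_contra h; simp [h] at hv
  · intro v hv; by_contra h; simp [h] at hv
  · intro v hv
    have hvs : v ∉ s := by
      intro h; simp only [h, if_true] at hv; exact (inv_pos.2 hc).ne' hv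
    have : d v = 0 := by_contra fun h => hvs (hds v h)
    exact this.ge

include hp in
/-- There are no simplices of dimension three: four points of the plane are affinely dependent. -/
theorem card_le_three_of_injOn {s : Finset V} (hs : s ∈ T.faces) : s.card ≤ 3 := by
  by_contra! h
  set L : (s → ℝ) →ₗ[ℝ] ℝ × ℂ := (Fintype.linearCombination ℝ fun _ : s => (1 : ℝ)).prod
    (Fintype.linearCombination ℝ fun v : s => p v) with hL
  have hr : Module.finrank ℝ (ℝ × ℂ) < Module.finrank ℝ (s → ℝ) := by
    simp [Complex.finrank_real_complex]; omega
  obtain ⟨c, hc, hc0⟩ := (Submodule.ne_bot_iff _).1 (LinearMap.ker_ne_bot_of_finrank_lt hr : L.ker ≠ ⊥)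
  rw [LinearMap.mem_ker] at hc
  have h1 := congrArg Prod.fst hc
  have h2 := congrArg Prod.snd hc
  simp only [hL, LinearMap.prod_apply, Function.prod_apply, Fintype.linearCombination_apply,
    Prod.fst_zero, Prod.snd_zero, smul_eq_mul, mul_one] at h1 h2
  set d : V → ℝ := fun v => if h : v ∈ s then c ⟨v, h⟩ else 0 with hd
  have hext : ∀ {M : Type} [AddCommMonoid M] (f : V → ℝ → M), (∀ v, f v 0 = 0) →
      ∑ v, f v (d v) = ∑ v : s, f v (c v) := by
    intro M _ f hf
    rw [← Finset.sum_subset (Finset.subset_univ s) (fun v _ hv => by simp [hd, hv, hf]),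
      ← Finset.sum_coe_sort]
    exact Finset.sum_congr rfl fun v _ => by simp [hd]
  have := eq_zero_of_plMap_eq_zero hp (d := d) hs
    (fun v hv => by by_contra h; simp [hd, h] at hv)
    ((hext (fun _ r => r) (by simp)).trans h1)
    ((hext (fun v r => r • p v) (by simp)).trans h2)
  refine hc0 (funext fun v => ?_)
  have h3 := congrFun this v
  simpa [hd] using h3

include hp in
theorem cross_ne_zero_of_injOn {a b c : V} (hab : a ≠ b) (hac : a ≠ c) (hbc : b ≠ c)
    (h : {a, b, c} ∈ T.faces) : cross (p b - p a) (p c - p a) ≠ 0 := by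
  intro h0
  have hD : ∀ s t : ℝ, s • (p b - p a) + t • (p c - p a) = 0 → s = 0 ∧ t = 0 := by
    intro s t he
    have := eq_zero_of_plMap_eq_zero hp (d := Pi.single b s + Pi.single c t + Pi.single a (-s - t)) h
      (fun v hv => by
        by_contra hv'
        simp only [Finset.mem_insert, Finset.mem_singleton, not_or] at hv'
        simp [hv'.1, hv'.2.1, hv'.2.2] at hv)
      (by simp [Finset.sum_add_distrib])
      (by
        simp only [map_add, plMap_single]
        rw [← he]; module)
    have h1 := congrFun this b
    have h2 := congrFun this c
    simp [hab.symm, hac.symm, hbc, hbc.symm] at h1 h2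
    exact ⟨h1, h2⟩
  by_cases hb : p b - p a = 0
  · have := (hD 1 0 (by simp [hb])).1
    norm_num at this
  obtain ⟨r, hr⟩ := exists_smul_eq_of_cross_eq_zero hb h0
  have := (hD (-r) 1 (by rw [hr]; module)).2
  norm_num at this

end

section

variable {V : Type*} [Fintype V] [DecidableEq V] {T : AbstractSimplicialComplex V} {p : V → ℂ}

theorem sin_arg_sub_arg {z w : ℂ} (hz : z ≠ 0) (hw : w ≠ 0) :
    ‖z‖ * ‖w‖ * Real.sin (w.arg - z.arg) = cross z w := by
  have h1 := norm_pos_iff.2 hz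
  have h2 := norm_pos_iff.2 hw
  rw [Real.sin_sub, Complex.sin_arg, Complex.sin_arg, Complex.cos_arg hz, Complex.cos_arg hw, cross]
  field_simp

theorem arg_lt_arg_of_cross_pos {z w : ℂ} (hz : 0 ≤ z.re) (hw : 0 ≤ w.re) (h : 0 < cross z w) :
    z.arg < w.arg := by
  have hz0 : z ≠ 0 := by rintro rfl; simp [cross] at h
  have hw0 : w ≠ 0 := by rintro rfl; simp [cross] at h
  by_contra! hle
  have h1 := sin_arg_sub_arg hz0 hw0
  have h2 := abs_le.1 (Complex.abs_arg_le_pi_div_two_iff.2 hz)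
  have h3 := abs_le.1 (Complex.abs_arg_le_pi_div_two_iff.2 hw)
  have h4 : Real.sin (w.arg - z.arg) ≤ 0 :=
    Real.sin_nonpos_of_nonpos_of_neg_pi_le (by linarith) (by linarith [h3.1, h2.2])
  have := norm_pos_iff.2 hz0
  have := norm_pos_iff.2 hw0
  rw [← h1] at h
  exact absurd h (not_lt.2 (mul_nonpos_of_nonneg_of_nonpos (by positivity) h4))

variable (hp : InjOn (plMap p) (realization T))

theorem OrientedTriangle.ne' {a b c : V} (h : OrientedTriangle T p a b c) : a ≠ c ∧ b ≠ c :=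
  ⟨h.rot.rot.ne.symm, h.rot.ne⟩

include hp in
/-- Two triangles on the same side of a common edge would overlap near its midpoint. -/
theorem OrientedTriangle.unique {a b c d : V} (h : OrientedTriangle T p a b c)
    (h' : OrientedTriangle T p a b d) : c = d := by
  by_contra hcd
  have hab := h.ne
  -- near the midpoint of the common edge, both triangles lie on the same side of it
  set w := cross (p b - p a) (p c - p a) / cross (p b - p a) (p d - p a) with hw
  set β := cross (p c - p a) (p d - p a) / cross (p b - p a) (p d - p a) with hβ
  have hw0 : 0 < w := div_pos h.2 h'.2
  have he : p c - p a = β • (p b - p a) + w • (p d - p a) := exists_smul_add_smul_eq h'.2.ne' _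
  have hsum : ∀ x y : V, ∀ r s : ℝ, ∑ v, (Pi.single x r + Pi.single y s : V → ℝ) v = r + s := by
    intro x y r s; simp [Finset.sum_add_distrib]
  obtain ⟨hac, hbc⟩ := h.ne'
  obtain ⟨had, hbd⟩ := h'.ne'
  have := eq_of_plMap_eq hp (m := Pi.single a (1 / 2) + Pi.single b (1 / 2))
    (d := Pi.single c 1 + Pi.single a (-1))
    (d' := Pi.single d w + Pi.single b β + Pi.single a (-w - β)) h.1 h'.1
    ⟨fun v => ?_, ?_⟩ ?_ ?_ ?_ ?_ ?_ ?_ ?_ ?_ ?_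
  · have h1 := congrFun this c
    simp [hac.symm, hbc.symm, hcd] at h1
  · have : ∀ x : V, (0 : ℝ) ≤ (Pi.single x (1 / 2) : V → ℝ) v := fun x => by
      rw [Pi.single_apply]; split_ifs <;> norm_num
    exact add_nonneg (this a) (this b)
  · rw [hsum]; norm_num
  · intro v hv
    by_contra hv'
    simp only [Finset.mem_insert, Finset.mem_singleton, not_or] at hv'
    simp [hv'.1, hv'.2.1] at hv
  · intro v hv
    by_contra hv'
    simp only [Finset.mem_insert, Finset.mem_singleton, not_or] at hv'
    simp [hv'.1, hv'.2.1] at hv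
  · intro v hv
    by_contra hv'
    simp only [Finset.mem_insert, Finset.mem_singleton, not_or] at hv'
    simp [hv'.1, hv'.2.2] at hv
  · intro v hv
    by_contra hv'
    simp only [Finset.mem_insert, Finset.mem_singleton, not_or] at hv'
    simp [hv'.1, hv'.2.1, hv'.2.2] at hv
  · rw [hsum]; norm_num
  · simp [Finset.sum_add_distrib]
  · intro v hv
    have hva : v ≠ a := by rintro rfl; simp [hab] at hv
    simp only [Pi.add_apply, Pi.single_apply, hva, if_false, add_zero]
    split_ifs <;> norm_num
  · intro v hv
    have hva : v ≠ a := by rintro rfl; simp [hab] at hv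
    have hvb : v ≠ b := by rintro rfl; simp [hab.symm] at hv
    simp only [Pi.add_apply, Pi.single_apply, hva, hvb, if_false, add_zero]
    split_ifs
    · exact hw0.le
    · exact le_rfl
  · simp only [map_add, plMap_single]
    calc (1 : ℝ) • p c + (-1 : ℝ) • p a = p c - p a := by module
      _ = _ := he
      _ = _ := by module

include hp in
/-- The open angles of the triangles at a vertex are disjoint. -/
theorem OrientedTriangle.eq_of_mem_cone {v b c b' c' : V} (h : OrientedTriangle T p v b c)
    (h' : OrientedTriangle T p v b' c') {s t s' t' : ℝ} (hs : 0 < s) (ht : 0 < t) (hs' : 0 < s')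
    (ht' : 0 < t') (he : s • (p b - p v) + t • (p c - p v) = s' • (p b' - p v) + t' • (p c' - p v)) :
    b = b' ∧ c = c' := by
  obtain ⟨hvc, hbc⟩ := h.ne'
  obtain ⟨hvc', hbc'⟩ := h'.ne'
  have hvb := h.ne
  have hvb' := h'.ne
  have hs1 : ∀ x y : V, v ≠ x → v ≠ y → ∀ r s : ℝ, 0 < r → 0 < s → ∀ u, (Pi.single v 1 : V → ℝ) u = 0 →
      0 ≤ (Pi.single x r + Pi.single y s + Pi.single v (-r - s) : V → ℝ) u := by
    intro x y _ _ r s hr hs u hu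
    have huv : u ≠ v := by rintro rfl; simp at hu
    simp only [Pi.add_apply, Pi.single_apply, huv, if_false, add_zero]
    split_ifs <;> linarith
  have hs2 : ∀ x y : V, ∀ r s : ℝ, ∀ u,
      (Pi.single x r + Pi.single y s + Pi.single v (-r - s) : V → ℝ) u ≠ 0 →
      u ∈ ({v, x, y} : Finset V) := by
    intro x y r s u hu
    by_contra hu'
    simp only [Finset.mem_insert, Finset.mem_singleton, not_or] at hu'
    simp [hu'.1, hu'.2.1, hu'.2.2] at hu
  have hs3 : ∀ x y : V, ∀ r s : ℝ,
      ∑ u, (Pi.single x r + Pi.single y s + Pi.single v (-r - s) : V → ℝ) u = 0 := by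
    intro x y r s; simp [Finset.sum_add_distrib]
  have hs4 : ∀ x y : V, ∀ u, (Pi.single v 1 : V → ℝ) u ≠ 0 → u ∈ ({v, x, y} : Finset V) := by
    intro x y u hu
    by_contra hu'
    simp only [Finset.mem_insert, Finset.mem_singleton, not_or] at hu'
    simp [hu'.1] at hu
  have := eq_of_plMap_eq hp (m := Pi.single v 1)
    (d := Pi.single b s + Pi.single c t + Pi.single v (-s - t))
    (d' := Pi.single b' s' + Pi.single c' t' + Pi.single v (-s' - t')) h.1 h'.1
    (single_mem_stdSimplex ℝ v) (hs4 _ _) (hs4 _ _) (hs2 _ _ _ _) (hs2 _ _ _ _) (hs3 _ _ _ _)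
    (hs3 _ _ _ _) (hs1 b c hvb hvc s t hs ht) (hs1 b' c' hvb' hvc' s' t' hs' ht') (by
      simp only [map_add, plMap_single]
      calc _ = s • (p b - p v) + t • (p c - p v) := by module
        _ = _ := he
        _ = _ := by module)
  have hb := congrFun this b
  have hc := congrFun this c
  simp only [Pi.add_apply, Pi.single_apply, hvb.symm, hbc, if_false, add_zero, if_true] at hb
  simp only [Pi.add_apply, Pi.single_apply, hvc.symm, hbc.symm, if_false, add_zero, zero_add,
    if_true] at hc
  by_cases hbb : b = b'
  · refine ⟨hbb, ?_⟩
    by_contra hcc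
    have : c ≠ b' := hbb ▸ hbc.symm
    simp [hcc, this] at hc
    exact ht.ne' hc
  · by_cases hbc2 : b = c'
    · have hcb : c = b' := by
        by_contra hcb
        have : c ≠ c' := hbc2 ▸ hbc.symm
        simp [hcb, this] at hc
        exact ht.ne' hc
      subst hbc2 hcb
      exact absurd h'.rot.rot h.asymm
    · simp [hbb, hbc2] at hb
      exact absurd hb hs.ne'

variable (T p) in
/-- The edges at a rightmost vertex point into a half plane, so that the last of them in positive
direction is a boundary edge. -/
theorem exists_boundary_edge [Nonempty V] (h : ∀ v, ∃ b c, OrientedTriangle T p v b c) :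
    ∃ a b c, OrientedTriangle T p a b c ∧ ∀ d, ¬ OrientedTriangle T p b a d := by
  classical
  by_contra! hcon
  obtain ⟨v, -, hv⟩ := Finset.exists_max_image Finset.univ (fun v => (p v).re) Finset.univ_nonempty
  obtain ⟨b₀, c₀, h₀⟩ := h v
  obtain ⟨b, hb, hmax⟩ := Finset.exists_max_image
    (Finset.univ.filter fun b => ∃ c, OrientedTriangle T p v b c) (fun b => (-(p b - p v)).arg)
    ⟨b₀, by simpa using ⟨c₀, h₀⟩⟩
  obtain ⟨c, hbc⟩ := (Finset.mem_filter.1 hb).2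
  obtain ⟨d, hd⟩ := hcon c v b hbc.rot.rot
  have h1 := hmax c (by simpa using ⟨d, hd⟩)
  have hre : ∀ w, 0 ≤ (-(p w - p v)).re := fun w => by
    have := hv w (Finset.mem_univ _); simp; linarith
  refine absurd (arg_lt_arg_of_cross_pos (hre b) (hre c) ?_) (not_lt.2 h1)
  have := hbc.2
  simp only [cross, Complex.neg_re, Complex.neg_im] at this ⊢
  linarith

include hp in
theorem orientedTriangle_or {a b c : V} (hab : a ≠ b) (hac : a ≠ c) (hbc : b ≠ c)
    (h : {a, b, c} ∈ T.faces) : OrientedTriangle T p a b c ∨ OrientedTriangle T p a c b := by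
  rcases lt_or_gt_of_ne (cross_ne_zero_of_injOn hp hab hac hbc h) with h1 | h1
  · refine .inr ⟨?_, ?_⟩
    · have : ({a, c, b} : Finset V) = {a, b, c} := by ext; simp; tauto
      rwa [this]
    · rw [cross_swap]; linarith
  · exact .inl ⟨h, h1⟩

include hp in
/-- The positively oriented triangles of an embedded triangulated disk form an oriented disk. -/
theorem IsDisk.orientedDisk (hT : IsDisk T) : OrientedDisk (OrientedTriangle T p) := by
  have htri : ∀ v, ∃ b c, OrientedTriangle T p v b c := by
    intro v
    obtain ⟨w, hw, he⟩ := hT.exists_edge v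
    obtain ⟨u, huv, huw, hf⟩ := hT.exists_triangle hw.symm he
    rcases orientedTriangle_or hp hw.symm huv.symm huw.symm hf with h | h
    · exact ⟨_, _, h⟩
    · exact ⟨_, _, h⟩
  exact {
    rot := fun h => h.rot
    ne := fun h => h.ne
    unique := fun h h' => h.unique hp h'
    asymm := fun h => h.asymm
    link := by
      intro a A hA b c b' c' h h' hAb
      refine hT.link_connected a A ?_ h.ne.symm h'.ne.symm
        (faces_subset h.1 (by intro; simp; tauto) (by simp))
        (faces_subset h'.1 (by intro; simp; tauto) (by simp)) hAb
      intro x y hx hy hf hAx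
      by_cases hxy : x = y
      · exact hxy ▸ hAx
      rcases orientedTriangle_or hp hx.symm hy.symm hxy hf with h | h
      · exact (hA _ _ h).1 hAx
      · exact (hA _ _ h).2 hAx
    conn := by
      intro A hA a b hAa
      refine hT.connected A ?_ hAa
      intro x y hf hAx
      by_cases hxy : x = y
      · exact hxy ▸ hAx
      obtain ⟨u, hux, huy, hf⟩ := hT.exists_triangle hxy hf
      rcases orientedTriangle_or hp hxy hux.symm huy.symm hf with h | h
      · exact (hA _ _ _ h).1 hAx
      · exact (hA _ _ _ h.rot.rot).2 hAx
    exists_triangle := htri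
    exists_boundary := by
      obtain ⟨h⟩ := hT
      obtain ⟨v, -⟩ := exists_pos_of_mem (h.symm ⟨0, by simp⟩).2
      have : Nonempty V := ⟨v⟩
      exact exists_boundary_edge T p htri
    exact := by
      intro κ hκ hcl
      have h0 : ∀ a, κ a a = 0 := fun a => by linarith [hκ a a]
      obtain ⟨u, hu⟩ := hT.exact κ hκ (by
        intro a b c hf
        by_cases hab : a = b
        · subst hab; linarith [h0 a, hκ a c]
        by_cases hac : a = c
        · subst hac; linarith [h0 a, hκ a b]
        by_cases hbc : b = c
        · subst hbc; linarith [h0 b, hκ a b]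
        rcases orientedTriangle_or hp hab hac hbc hf with h | h
        · exact hcl _ _ _ h
        · linarith [hcl _ _ _ h, hκ a b, hκ b c, hκ c a])
      exact ⟨u, fun a b c h => hu a b (faces_subset h.1 (by intro; simp; tauto) (by simp))⟩ }

include hp in
/-- Every simplex is contained in a positively oriented triangle. -/
theorem IsDisk.exists_subset_triangle (hT : IsDisk T) {s : Finset V} (hs : s ∈ T.faces) :
    ∃ a b c, OrientedTriangle T p a b c ∧ s ⊆ {a, b, c} := by
  have key : ∀ a b c, a ≠ b → a ≠ c → b ≠ c → {a, b, c} ∈ T.faces →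
      ∃ x y z, OrientedTriangle T p x y z ∧ ({a, b, c} : Finset V) ⊆ {x, y, z} := by
    intro a b c hab hac hbc hf
    rcases orientedTriangle_or hp hab hac hbc hf with h | h
    · exact ⟨_, _, _, h, subset_rfl⟩
    · exact ⟨_, _, _, h, by intro; simp; tauto⟩
  have key2 : ∀ a b, a ≠ b → {a, b} ∈ T.faces →
      ∃ x y z, OrientedTriangle T p x y z ∧ ({a, b} : Finset V) ⊆ {x, y, z} := by
    intro a b hab hf
    obtain ⟨u, hua, hub, hf⟩ := hT.exists_triangle hab hf
    obtain ⟨x, y, z, h, hs⟩ := key a b u hab hua.symm hub.symm hf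
    exact ⟨x, y, z, h, subset_trans (by intro; simp; tauto) hs⟩
  have h3 := card_le_three_of_injOn hp hs
  have h0 : s.Nonempty := (T.isRelLowerSet_faces hs).1
  have h1 := h0.card_pos
  obtain h | h | h : s.card = 1 ∨ s.card = 2 ∨ s.card = 3 := by omega
  · obtain ⟨a, rfl⟩ := Finset.card_eq_one.1 h
    obtain ⟨w, hw, he⟩ := hT.exists_edge a
    obtain ⟨x, y, z, h, hs⟩ := key2 a w hw.symm he
    exact ⟨x, y, z, h, subset_trans (by simp) hs⟩
  · obtain ⟨a, b, hab, rfl⟩ := Finset.card_eq_two.1 h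
    exact key2 a b hab hs
  · obtain ⟨a, b, c, hab, hac, hbc, rfl⟩ := Finset.card_eq_three.1 h
    exact key a b c hab hac hbc hs

end

/-! ### Angles at the vertices -/

/-- The angle of a positive rotation is the difference of the arguments, up to a full turn if the
rotation passes the negative real axis. -/
theorem arg_div_eq {z w : ℂ} (h : 0 < cross z w) :
    (w / z).arg = w.arg - z.arg + if w.arg < z.arg then 2 * Real.pi else 0 := by
  have hz0 : z ≠ 0 := by rintro rfl; simp [cross] at h
  have hw0 : w ≠ 0 := by rintro rfl; simp [cross] at h
  have h1 : (((w / z).arg : ℝ) : Real.Angle) = ((w.arg - z.arg : ℝ) : Real.Angle) := by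
    rw [Complex.arg_div_coe_angle hw0 hz0, Real.Angle.coe_sub]
  obtain ⟨k, hk⟩ := Real.Angle.angle_eq_iff_two_pi_dvd_sub.1 h1
  have h2 := arg_pos_of_im_pos (im_div_pos_iff.2 h)
  have h3 := arg_lt_pi_of_im_pos (im_div_pos_iff.2 h)
  have hpi := Real.pi_pos
  have b1 := Complex.neg_pi_lt_arg z; have b2 := Complex.arg_le_pi z
  have b3 := Complex.neg_pi_lt_arg w; have b4 := Complex.arg_le_pi w
  split_ifs with hlt
  · have h5 : (k : ℝ) < 2 := by nlinarith
    have h6 : (0 : ℝ) < k := by nlinarith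
    have h5' : k < 2 := by exact_mod_cast h5
    have h6' : 0 < k := by exact_mod_cast h6
    have : k = 1 := by omega
    rw [this] at hk; push_cast at hk; linarith
  · have h5 : (k : ℝ) < 1 := by nlinarith
    have h6 : (-1 : ℝ) < k := by nlinarith
    have h5' : k < 1 := by exact_mod_cast h5
    have h6' : -1 < k := by exact_mod_cast h6
    have : k = 0 := by omega
    rw [this] at hk; push_cast at hk; linarith

/-- If the positive rotation from `z` to `w` crosses the negative real axis, `z` lies above it
and `w` below it. -/
theorem arg_bounds_of_lt {z w : ℂ} (h : 0 < cross z w) (hlt : w.arg < z.arg) :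
    0 < z.arg ∧ w.arg < 0 := by
  have h1 := arg_div_eq h
  rw [if_pos hlt] at h1
  have h3 := arg_lt_pi_of_im_pos (im_div_pos_iff.2 h)
  have hpi := Real.pi_pos
  have b2 := Complex.arg_le_pi z
  have b3 := Complex.neg_pi_lt_arg w
  constructor <;> linarith

theorem arg_ne_of_cross_pos {z w : ℂ} (h : 0 < cross z w) : w.arg ≠ z.arg := by
  intro e
  have h1 := arg_div_eq h
  have h2 := arg_pos_of_im_pos (im_div_pos_iff.2 h)
  rw [if_neg (by rw [e]; exact lt_irrefl _), e] at h1
  linarith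

theorem cross_mul_mul (q z w : ℂ) : cross (q * z) (q * w) = Complex.normSq q * cross z w := by
  simp [cross, Complex.normSq_apply]; ring

namespace Corner

variable {V : Type*} [Fintype V] [DecidableEq V] {O : V → V → V → Prop} [hO : OrientedDisk O]

theorem IsPositive.cross_pos {p : V → ℂ} (hp : IsPositive O p) (t : Corner O) :
    0 < cross (p t.1.2.1 - p t.1.1) (p t.1.2.2 - p t.1.1) := im_div_pos_iff.1 (hp t)

/-- Around an inner vertex, the direction passes the negative real axis, after any rotation. -/
theorem exists_arg_lt {p : V → ℂ} (hp : IsPositive O p) {v : V} (hv : Inner O v) {q : ℂ}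
    (hq : q ≠ 0) : ∃ b c, O v b c ∧ (q * (p c - p v)).arg < (q * (p b - p v)).arg := by
  classical
  obtain ⟨b₀, c₀, h₀⟩ := hO.exists_triangle v
  obtain ⟨b, hb, hmax⟩ := Finset.exists_max_image
    (Finset.univ.filter fun b => ∃ c, O v b c) (fun b => (q * (p b - p v)).arg)
    ⟨b₀, by simpa using ⟨c₀, h₀⟩⟩
  obtain ⟨c, hbc⟩ := (Finset.mem_filter.1 hb).2
  obtain ⟨d, hd⟩ := (hv b c hbc).1
  refine ⟨b, c, hbc, lt_of_le_of_ne (hmax c (by simpa using ⟨d, hd⟩)) ?_⟩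
  refine arg_ne_of_cross_pos ?_
  rw [cross_mul_mul]
  exact mul_pos (Complex.normSq_pos.2 hq) (hp.cross_pos ⟨(v, b, c), hbc⟩)

/-- The triangles around an inner vertex cover all directions. -/
theorem exists_mem_cone {p : V → ℂ} (hp : IsPositive O p) {v : V} (hv : Inner O v) (z : ℂ) :
    ∃ b c, O v b c ∧ ∃ s ≥ (0 : ℝ), ∃ u ≥ (0 : ℝ), z = s • (p b - p v) + u • (p c - p v) := by
  by_cases hz : z = 0
  · obtain ⟨b, c, h⟩ := hO.exists_triangle v
    exact ⟨b, c, h, 0, le_rfl, 0, le_rfl, by simp [hz]⟩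
  have hq : -z⁻¹ ≠ 0 := by simpa using hz
  obtain ⟨b, c, h, hlt⟩ := exists_arg_lt hp hv hq
  have hc : 0 < cross (-z⁻¹ * (p b - p v)) (-z⁻¹ * (p c - p v)) := by
    rw [cross_mul_mul]
    exact mul_pos (Complex.normSq_pos.2 hq) (hp.cross_pos ⟨(v, b, c), h⟩)
  obtain ⟨h1, h2⟩ := arg_bounds_of_lt hc hlt
  refine ⟨b, c, h, cross (-1) (-z⁻¹ * (p c - p v)) / cross (-z⁻¹ * (p b - p v)) (-z⁻¹ * (p c - p v)),
    div_nonneg ?_ hc.le, cross (-z⁻¹ * (p b - p v)) (-1) /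
      cross (-z⁻¹ * (p b - p v)) (-z⁻¹ * (p c - p v)), div_nonneg ?_ hc.le, ?_⟩
  · have := (Complex.arg_neg_iff.1 h2).le
    simp only [cross, Complex.neg_re, Complex.one_re, Complex.neg_im, Complex.one_im] at this ⊢
    linarith
  · have := Complex.arg_nonneg_iff.1 h1.le
    simp only [cross, Complex.neg_re, Complex.one_re, Complex.neg_im, Complex.one_im] at this ⊢
    linarith
  · have h3 := exists_smul_add_smul_eq hc.ne' (-1)
    generalize cross (-1) (-z⁻¹ * (p c - p v)) / cross (-z⁻¹ * (p b - p v)) (-z⁻¹ * (p c - p v)) = s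
      at h3 ⊢
    generalize cross (-z⁻¹ * (p b - p v)) (-1) / cross (-z⁻¹ * (p b - p v)) (-z⁻¹ * (p c - p v)) = u
      at h3 ⊢
    simp only [Complex.real_smul] at h3 ⊢
    field_simp at h3
    linear_combination -h3

/-- The angles at an inner vertex add up to `2π`, if the triangles at this vertex do not overlap:
exactly one of them contains the directions just below the negative real axis. -/
theorem sum_ang_eq {p : V → ℂ} (hp : IsPositive O p) {v : V} (hv : Inner O v)
    (hdisj : ∀ b c b' c', O v b c → O v b' c' → ∀ s t s' t' : ℝ, 0 < s → 0 < t → 0 < s' → 0 < t' →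
      s • (p b - p v) + t • (p c - p v) = s' • (p b' - p v) + t' • (p c' - p v) → b = b' ∧ c = c') :
    ∑ t : Corner O with t.1.1 = v, ang p t = 2 * Real.pi := by
  classical
  obtain ⟨b, c, h, hlt⟩ := exists_arg_lt hp hv one_ne_zero
  simp only [one_mul] at hlt
  have hev : ∀ b' c', O v b' c' → (p c' - p v).arg < (p b' - p v).arg →
      ∀ᶠ η in 𝓝[>] (0 : ℝ), ∃ s > (0 : ℝ), ∃ t > (0 : ℝ),
        (⟨-1, -η⟩ : ℂ) = s • (p b' - p v) + t • (p c' - p v) := by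
    intro b' c' h' hlt'
    have hc := hp.cross_pos ⟨(v, b', c'), h'⟩
    simp only at hc
    obtain ⟨h1, h2⟩ := arg_bounds_of_lt hc hlt'
    have him : (p c' - p v).im < 0 := Complex.arg_neg_iff.1 h2
    have e1 : ∀ᶠ η in 𝓝[>] (0 : ℝ), 0 < cross ⟨-1, -η⟩ (p c' - p v) := by
      have : ContinuousAt (fun η : ℝ => cross ⟨-1, -η⟩ (p c' - p v)) 0 := by
        simp only [cross]; fun_prop
      refine (this.tendsto.mono_left nhdsWithin_le_nhds).eventually (lt_mem_nhds ?_)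
      simp only [cross]; linarith
    have e2 : ∀ᶠ η in 𝓝[>] (0 : ℝ), 0 < cross (p b' - p v) ⟨-1, -η⟩ := by
      by_cases him0 : (p b' - p v).im = 0
      · have hre : (p b' - p v).re < 0 := by
          by_contra! hge
          exact h1.ne' (Complex.arg_eq_zero_iff.2 ⟨hge, him0⟩)
        filter_upwards [self_mem_nhdsWithin] with η hη
        have hη' : 0 < η := hη
        simp only [cross, him0]; nlinarith
      · have him1 : 0 < (p b' - p v).im :=
          lt_of_le_of_ne (Complex.arg_nonneg_iff.1 h1.le) (Ne.symm him0)
        have : ContinuousAt (fun η : ℝ => cross (p b' - p v) ⟨-1, -η⟩) 0 := by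
          simp only [cross]; fun_prop
        refine (this.tendsto.mono_left nhdsWithin_le_nhds).eventually (lt_mem_nhds ?_)
        simp only [cross]; linarith
    filter_upwards [e1, e2] with η h3 h4
    exact ⟨_, div_pos h3 hc, _, div_pos h4 hc, exists_smul_add_smul_eq hc.ne' _⟩
  have huniq : ∀ b' c', O v b' c' → (p c' - p v).arg < (p b' - p v).arg → b = b' ∧ c = c' := by
    intro b' c' h' hlt'
    obtain ⟨η, ⟨s, hs, t, ht, e⟩, s', hs', t', ht', e'⟩ := ((hev b c h hlt).and
      (hev b' c' h' hlt')).exists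
    exact hdisj b c b' c' h h' s t s' t' hs ht hs' ht' (e.symm.trans e')
  have h1 : ∀ t : Corner O, t.1.1 = v → ang p t = (p t.1.2.2 - p v).arg -
      (p t.prev.1.2.2 - p v).arg +
      if t = ⟨(v, b, c), h⟩ then 2 * Real.pi else 0 := by
    rintro ⟨⟨a, x, y⟩, ht⟩ rfl
    obtain ⟨d, hd⟩ := (hv x y ht).2
    rw [prev_eq ht hd, ang, ratio, arg_div_eq (hp.cross_pos ⟨(a, x, y), ht⟩)]
    congr 1
    refine if_congr ?_ rfl rfl
    constructor
    · intro hxy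
      obtain ⟨rfl, rfl⟩ := huniq x y ht hxy
      rfl
    · intro e
      simp only [Subtype.mk.injEq, Prod.mk.injEq, true_and] at e
      obtain ⟨rfl, rfl⟩ := e
      exact hlt
  rw [Finset.sum_congr rfl fun t ht => h1 t (Finset.mem_filter.1 ht).2, Finset.sum_add_distrib,
    Finset.sum_sub_distrib, sum_prev hv (fun t => (p t.1.2.2 - p v).arg), sub_self, zero_add]
  rw [Finset.sum_ite_eq' , if_pos (by simp)]

end Corner

/-- A nonnegative combination of two unit vectors at an angle less than `π` has a direction between
them. -/
theorem exists_polar_of_combination {m M : ℝ} (hmM : m ≤ M) (hM : M - m < Real.pi) {s u : ℝ}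
    (hs : 0 ≤ s) (hu : 0 ≤ u) : ∃ r ≥ (0 : ℝ), ∃ τ ∈ Icc m M,
      (s : ℂ) * Complex.exp (m * Complex.I) + u * Complex.exp (M * Complex.I) =
        r * Complex.exp (τ * Complex.I) := by
  set L := M - m with hL
  have hL0 : 0 ≤ L := by linarith
  set ζ : ℂ := s + u * Complex.exp (L * Complex.I) with hζ
  have hre : ζ.re = s + u * Real.cos L := by simp [hζ, Complex.exp_ofReal_mul_I_re]
  have him : ζ.im = u * Real.sin L := by simp [hζ, Complex.exp_ofReal_mul_I_im]
  have hsin : 0 ≤ Real.sin L := Real.sin_nonneg_of_nonneg_of_le_pi hL0 hM.le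
  have h0 : 0 ≤ ζ.arg := Complex.arg_nonneg_iff.2 (him ▸ mul_nonneg hu hsin)
  have h1 : ζ.arg ≤ L := by
    by_contra! hlt
    have hζ0 : ζ ≠ 0 := by intro h; rw [h, Complex.arg_zero] at hlt; linarith
    have hn := norm_pos_iff.2 hζ0
    rcases hL0.eq_or_lt with h | h
    · rw [← h, Real.sin_zero, mul_zero] at him
      rw [← h, Real.cos_zero, mul_one] at hre
      have : ζ.arg = 0 := Complex.arg_eq_zero_iff.2 ⟨by rw [hre]; positivity, him⟩
      linarith
    · have h2 : 0 < Real.sin (ζ.arg - L) :=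
        Real.sin_pos_of_pos_of_lt_pi (by linarith) (by linarith [Complex.arg_le_pi ζ])
      have h3 : ‖ζ‖ * Real.sin (ζ.arg - L) = -(s * Real.sin L) := by
        rw [Real.sin_sub, Complex.sin_arg, Complex.cos_arg hζ0]
        field_simp
        rw [hre, him]; ring
      have h4 := mul_pos hn h2
      have h5 := mul_nonneg hs hsin
      linarith
  refine ⟨‖ζ‖, norm_nonneg _, m + ζ.arg, ⟨by linarith, by linarith⟩, ?_⟩
  have h2 := Complex.norm_mul_exp_arg_mul_I ζ
  have h3 : Complex.exp (M * Complex.I) =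
      Complex.exp (m * Complex.I) * Complex.exp (L * Complex.I) := by
    rw [← Complex.exp_add]; congr 1; rw [hL]; push_cast; ring
  have h4 : Complex.exp ((m + ζ.arg : ℝ) * Complex.I) =
      Complex.exp (m * Complex.I) * Complex.exp (ζ.arg * Complex.I) := by
    rw [← Complex.exp_add]; congr 1; push_cast; ring
  rw [h3, h4]
  linear_combination Complex.exp (m * Complex.I) * (hζ - h2)

/-- A direction between two unit vectors is a nonnegative combination of them. -/
theorem exists_combination_of_polar {m M τ : ℝ} (hmM : m < M) (hM : M - m < Real.pi)
    (hτ : τ ∈ Icc m M) : ∃ s ≥ (0 : ℝ), ∃ u ≥ (0 : ℝ),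
      Complex.exp (τ * Complex.I) =
        (s : ℂ) * Complex.exp (m * Complex.I) + u * Complex.exp (M * Complex.I) := by
  have h0 : 0 < Real.sin (M - m) := Real.sin_pos_of_pos_of_lt_pi (by linarith) hM
  have h1 : 0 ≤ Real.sin (M - τ) :=
    Real.sin_nonneg_of_nonneg_of_le_pi (by linarith [hτ.2]) (by linarith [hτ.1])
  have h2 : 0 ≤ Real.sin (τ - m) :=
    Real.sin_nonneg_of_nonneg_of_le_pi (by linarith [hτ.1]) (by linarith [hτ.2])
  refine ⟨_, div_nonneg h1 h0.le, _, div_nonneg h2 h0.le, ?_⟩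
  have h3 : (Real.sin (M - m) : ℂ) ≠ 0 := by exact_mod_cast h0.ne'
  have h4 : (Real.sin (M - m) : ℂ) * Complex.exp (τ * Complex.I) =
      Real.sin (M - τ) * Complex.exp (m * Complex.I) +
        Real.sin (τ - m) * Complex.exp (M * Complex.I) := by
    simp only [Complex.exp_mul_I]
    push_cast
    simp only [Complex.sin_sub]
    ring
  push_cast at h3 h4 ⊢
  generalize Complex.exp (τ * Complex.I) = e at h4 ⊢
  generalize Complex.exp (m * Complex.I) = e₁ at h4 ⊢
  generalize Complex.exp (M * Complex.I) = e₂ at h4 ⊢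
  field_simp
  linear_combination h4

namespace Corner

variable {V : Type*} [Fintype V] [DecidableEq V] {O : V → V → V → Prop} [hO : OrientedDisk O]

variable (O) in
/-- The directions of the triangles at the vertex `v`. -/
def cone (p : V → ℂ) (v : V) : Set ℂ := {z | ∃ b c, O v b c ∧ ∃ s ≥ (0 : ℝ), ∃ u ≥ (0 : ℝ),
  z = s • (p b - p v) + u • (p c - p v)}

theorem convex_cone_of_inner {p : V → ℂ} (hp : IsPositive O p) {v : V} (hv : Inner O v) :
    Convex ℝ (cone O p v) := by
  have : cone O p v = univ := eq_univ_of_forall fun z => exists_mem_cone hp hv z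
  rw [this]; exact convex_univ

/-- If the angles at a boundary vertex add up to less than `π`, the triangles at this vertex fill
a convex sector. The edges have directions with differences given by the angles, so that the
intervals of directions of the triangles fill an interval. -/
theorem convex_cone_of_sum_lt {p : V → ℂ} (hp : IsPositive O p) {v : V} (hv : ¬ Inner O v)
    (hsum : ∑ t : Corner O with t.1.1 = v, ang p t < Real.pi) : Convex ℝ (cone O p v) := by
  classical
  obtain ⟨ω, hω⟩ := exists_direction (O := O) (α := fun t => if t.1.1 = v then ang p t else 0) (by
    intro w hw
    refine Finset.sum_eq_zero fun t ht => if_neg ?_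
    rintro rfl
    exact hv ((Finset.mem_filter.1 ht).2 ▸ hw))
  set θ : V → ℝ := fun w => ω (v, w) with hθ
  have hang : ∀ b c (h : O v b c), θ c - θ b = ang p ⟨(v, b, c), h⟩ := by
    intro b c h; simpa using hω v b c h
  have hlt : ∀ b c, O v b c → θ b < θ c := fun b c h => by
    linarith [hang b c h, ang_pos hp ⟨(v, b, c), h⟩]
  -- the difference between the actual direction of an edge and the direction `θ`, which is the same
  -- for all edges at `v`
  set g : V → ℂ := fun w => (p w - p v) / ‖p w - p v‖ * Complex.exp (-(θ w * Complex.I)) with hg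
  have hne : ∀ b c, O v b c → p b - p v ≠ 0 ∧ p c - p v ≠ 0 := by
    intro b c h
    have := hp.cross_pos ⟨(v, b, c), h⟩
    simp only at this
    constructor <;> intro h0 <;> simp [h0, cross] at this
  have hstep : ∀ b c, O v b c → g b = g c := by
    intro b c h
    obtain ⟨hb, hc⟩ := hne b c h
    have h1 := Complex.norm_mul_exp_arg_mul_I (ratio p ⟨(v, b, c), h⟩)
    rw [← ang, ← hang b c h, ratio, norm_div] at h1
    have n1 : (‖p b - p v‖ : ℂ) ≠ 0 := by exact_mod_cast norm_ne_zero_iff.2 hb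
    have n2 : (‖p c - p v‖ : ℂ) ≠ 0 := by exact_mod_cast norm_ne_zero_iff.2 hc
    have h2 : Complex.exp ((θ c - θ b : ℝ) * Complex.I) * Complex.exp (-(θ c * Complex.I)) =
        Complex.exp (-(θ b * Complex.I)) := by
      rw [← Complex.exp_add]; congr 1; push_cast; ring
    simp only [hg]
    rw [← h2]
    push_cast at h1 ⊢
    generalize Complex.exp ((θ c - θ b) * Complex.I) = e at h1 ⊢
    generalize Complex.exp (-(θ c * Complex.I)) = e'
    field_simp at h1 ⊢
    linear_combination e' * h1
  obtain ⟨b₀, c₀, h₀⟩ := hO.exists_triangle v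
  have hgb : ∀ b c, O v b c → g b = g b₀ := fun b c h =>
    link_induction v (fun t => g t.1.2.1 = g b₀)
      (fun b c d h h' => by simp only [hstep b c h]) h₀ h rfl
  set q := g b₀ with hq
  have hdir : ∀ w, p w - p v ≠ 0 → g w = q →
      p w - p v = ‖p w - p v‖ * (q * Complex.exp (θ w * Complex.I)) := by
    intro w hw hgw
    have n1 : (‖p w - p v‖ : ℂ) ≠ 0 := by exact_mod_cast norm_ne_zero_iff.2 hw
    have h2 : Complex.exp (-(θ w * Complex.I)) * Complex.exp (θ w * Complex.I) = 1 := by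
      rw [← Complex.exp_add, neg_add_cancel, Complex.exp_zero]
    rw [← hgw]
    simp only [hg]
    generalize Complex.exp (θ w * Complex.I) = e at h2 ⊢
    generalize Complex.exp (-(θ w * Complex.I)) = e' at h2 ⊢
    field_simp
    linear_combination -h2
  set U : Set ℝ := {τ | ∃ b c, O v b c ∧ τ ∈ Icc (θ b) (θ c)} with hU
  have hang_lt : ∀ b c, O v b c → θ c - θ b < Real.pi := fun b c h =>
    hang b c h ▸ ang_lt_pi hp _
  have hcone : ∀ z, z ∈ cone O p v ↔ ∃ r ≥ (0 : ℝ), ∃ τ ∈ U,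
      z = q * (r * Complex.exp (τ * Complex.I)) := by
    intro z
    constructor
    · rintro ⟨b, c, h, s, hs, u, hu, rfl⟩
      obtain ⟨r, hr, τ, hτ, e⟩ := exists_polar_of_combination (hlt b c h).le (hang_lt b c h)
        (mul_nonneg hs (norm_nonneg (p b - p v))) (mul_nonneg hu (norm_nonneg (p c - p v)))
      refine ⟨r, hr, τ, ⟨b, c, h, hτ⟩, ?_⟩
      have e1 := hdir b (hne b c h).1 (hgb b c h)
      have e2 := hdir c (hne b c h).2 ((hstep b c h).symm.trans (hgb b c h))
      push_cast at e
      simp only [Complex.real_smul]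
      linear_combination (s : ℂ) * e1 + (u : ℂ) * e2 + q * e
    · rintro ⟨r, hr, τ, ⟨b, c, h, hτ⟩, rfl⟩
      obtain ⟨s, hs, u, hu, e⟩ := exists_combination_of_polar (hlt b c h) (hang_lt b c h) hτ
      have e1 := hdir b (hne b c h).1 (hgb b c h)
      have e2 := hdir c (hne b c h).2 ((hstep b c h).symm.trans (hgb b c h))
      have n1 : (‖p b - p v‖ : ℂ) ≠ 0 := by exact_mod_cast norm_ne_zero_iff.2 (hne b c h).1
      have n2 : (‖p c - p v‖ : ℂ) ≠ 0 := by exact_mod_cast norm_ne_zero_iff.2 (hne b c h).2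
      refine ⟨b, c, h, r * s / ‖p b - p v‖, by positivity, r * u / ‖p c - p v‖, by positivity, ?_⟩
      simp only [Complex.real_smul]
      push_cast
      rw [e]
      generalize Complex.exp (θ b * Complex.I) = e' at e1 ⊢
      generalize Complex.exp (θ c * Complex.I) = e'' at e2 ⊢
      generalize (‖p b - p v‖ : ℂ) = N at n1 e1 ⊢
      generalize (‖p c - p v‖ : ℂ) = N' at n2 e2 ⊢
      rw [e1, e2]
      field_simp
  have hUconn : ∀ τ ∈ U, ∀ τ' ∈ U, Icc τ τ' ⊆ U := by
    rintro τ ⟨b, c, h, hτ⟩ τ' ⟨b', c', h', hτ'⟩ x hx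
    by_contra hxU
    have hx' : ∀ b c, O v b c → θ b < x → θ c < x := by
      intro b c h hb
      by_contra! hc
      exact hxU ⟨b, c, h, hb.le, hc⟩
    have hA : θ b < x := lt_of_le_of_ne (hτ.1.trans hx.1) fun e =>
      hxU ⟨b, c, h, e.le, e ▸ (hlt b c h).le⟩
    have hA' := link_induction v (fun t => θ t.1.2.1 < x) (fun b c d h h' =>
      ⟨hx' b c h, fun hc => (hlt b c h).trans hc⟩) h h' hA
    have := hx' b' c' h' hA'
    linarith [hx.2, hτ'.2]
  have hUdiam : ∀ τ ∈ U, ∀ τ' ∈ U, τ' - τ < Real.pi := by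
    intro τ hτ τ' hτ'
    by_cases hle : τ ≤ τ'
    swap
    · linarith [Real.pi_pos]
    have hsub : Icc τ τ' ⊆ ⋃ t ∈ Finset.univ.filter (fun t : Corner O => t.1.1 = v),
        Icc (θ t.1.2.1) (θ t.1.2.2) := by
      intro x hx
      obtain ⟨b, c, h, hxb⟩ := hUconn τ hτ τ' hτ' hx
      exact mem_biUnion (x := (⟨(v, b, c), h⟩ : Corner O)) (by simp) hxb
    have h1 := (MeasureTheory.measure_mono (μ := MeasureTheory.volume) hsub).trans
      (MeasureTheory.measure_biUnion_finset_le _ _)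
    have h2 : ∀ t ∈ Finset.univ.filter (fun t : Corner O => t.1.1 = v),
        MeasureTheory.volume (Icc (θ t.1.2.1) (θ t.1.2.2)) = ENNReal.ofReal (ang p t) := by
      rintro ⟨⟨a, b, c⟩, h⟩ ht
      obtain rfl : a = v := by simpa using ht
      rw [Real.volume_Icc, hang b c h]
    rw [Finset.sum_congr rfl h2, Real.volume_Icc,
      ← ENNReal.ofReal_sum_of_nonneg fun t _ => (ang_pos hp t).le] at h1
    have h3 := (ENNReal.ofReal_le_ofReal_iff
      (Finset.sum_nonneg fun t _ => (ang_pos hp t).le)).1 h1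
    linarith
  -- two points of the sector and the segment between them
  have key : ∀ τ ∈ U, ∀ τ' ∈ U, τ ≤ τ' → ∀ x ≥ (0 : ℝ), ∀ y ≥ (0 : ℝ),
      q * (x * Complex.exp (τ * Complex.I)) + q * (y * Complex.exp (τ' * Complex.I)) ∈
        cone O p v := by
    intro τ hτ τ' hτ' hle x hx y hy
    obtain ⟨r, hr, σ, hσ, e⟩ := exists_polar_of_combination hle (hUdiam τ hτ τ' hτ') hx hy
    exact (hcone _).2 ⟨r, hr, σ, hUconn τ hτ τ' hτ' hσ, by rw [← e]; ring⟩
  intro z hz z' hz' x y hx hy _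
  obtain ⟨r, hr, τ, hτ, rfl⟩ := (hcone z).1 hz
  obtain ⟨r', hr', τ', hτ', rfl⟩ := (hcone z').1 hz'
  have e1 : x • (q * (r * Complex.exp (τ * Complex.I))) =
      q * ((x * r : ℝ) * Complex.exp (τ * Complex.I)) := by
    rw [Complex.real_smul]; push_cast; ring
  have e2 : y • (q * (r' * Complex.exp (τ' * Complex.I))) =
      q * ((y * r' : ℝ) * Complex.exp (τ' * Complex.I)) := by
    rw [Complex.real_smul]; push_cast; ring
  rw [e1, e2]
  rcases le_total τ τ' with hle | hle
  · exact key τ hτ τ' hτ' hle _ (mul_nonneg hx hr) _ (mul_nonneg hy hr')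
  · rw [add_comm]
    exact key τ' hτ' τ hτ hle _ (mul_nonneg hy hr') _ (mul_nonneg hx hr)

end Corner

/-! ### Embeddedness along a path -/

namespace Corner

variable {V : Type*} [Fintype V] [DecidableEq V] {O : V → V → V → Prop} [hO : OrientedDisk O]

variable (O) in
/-- The union of the triangles, in barycentric coordinates. -/
def body : Set (V → ℝ) := {x | x ∈ stdSimplex ℝ V ∧ ∃ t : Corner O, ∀ v, x v ≠ 0 → v ∈ t.face}

theorem face_of_mem {t : Corner O} {v : V} (h : v ∈ t.face) :
    ∃ b c, ∃ _ : O v b c, t.face = {v, b, c} := by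
  obtain ⟨⟨a, b, c⟩, ht⟩ := t
  simp only [face, Finset.mem_insert, Finset.mem_singleton] at h ⊢
  rcases h with rfl | rfl | rfl
  · exact ⟨_, _, ht, rfl⟩
  · exact ⟨_, _, hO.rot ht, by ext; simp; tauto⟩
  · exact ⟨_, _, hO.rot (hO.rot ht), by ext; simp; tauto⟩

theorem isCompact_body_inter {A : Set (V → ℝ)} (hA : IsClosed A) : IsCompact (body O ∩ A) := by
  refine (isCompact_stdSimplex ℝ V).of_isClosed_subset (IsClosed.inter ?_ hA) fun x hx => hx.1.1
  have : body O = stdSimplex ℝ V ∩ ⋃ t : Corner O, ⋂ v : V, ⋂ _ : v ∉ t.face, {x | x v = 0} := by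
    ext x
    simp only [body, mem_ofPred_eq, mem_inter_iff, mem_iUnion, mem_iInter]
    refine and_congr_right fun _ => exists_congr fun t => forall_congr' fun v => ?_
    rw [not_imp_comm]
  rw [this]
  refine (isCompact_stdSimplex ℝ V).isClosed.inter (isClosed_iUnion_of_finite fun t => ?_)
  exact isClosed_iInter fun v => isClosed_iInter fun _ =>
    isClosed_eq (continuous_apply v) continuous_const

theorem isCompact_body : IsCompact (body O) := by
  simpa using isCompact_body_inter (O := O) isClosed_univ

theorem sum_eq_of_support {v b c : V} (h : O v b c) {M : Type*} [AddCommMonoid M] {f : V → M}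
    (hf : ∀ w, w ∉ ({v, b, c} : Finset V) → f w = 0) : ∑ w, f w = f v + f b + f c := by
  have h1 := hO.ne h
  have h2 := hO.ne (hO.rot h)
  have h3 := (hO.ne (hO.rot (hO.rot h))).symm
  rw [← Finset.sum_subset (Finset.subset_univ ({v, b, c} : Finset V)) fun w _ hw => hf w hw,
    Finset.sum_insert (by simp [h1, h3]), Finset.sum_insert (by simp [h2]), Finset.sum_singleton,
    add_assoc]

theorem plMap_eq_of_support (p : V → ℂ) {v b c : V} (h : O v b c) {x : V → ℝ} {r : ℝ}
    (hx : ∀ w, x w ≠ 0 → w ∈ ({v, b, c} : Finset V)) (hr : ∑ w, x w = r) :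
    plMap p x = r • p v + (x b • (p b - p v) + x c • (p c - p v)) := by
  have h0 : ∀ w, w ∉ ({v, b, c} : Finset V) → x w = 0 := fun w hw => by_contra fun h => hw (hx w h)
  rw [sum_eq_of_support h h0] at hr
  rw [Fintype.linearCombination_apply, sum_eq_of_support h (fun w hw => by simp [h0 w hw]), ← hr]
  module

/-- If the angles of the triangles at each vertex form a convex set, an embedded disk is convex:
near a point of the open star of a vertex, it agrees with the angle at this vertex. -/
theorem convex_image {p : V → ℂ} (hinj : InjOn (plMap p) (body O))
    (hconn : IsPreconnected (body O)) (hcone : ∀ v, Convex ℝ (cone O p v)) :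
    Convex ℝ (plMap p '' body O) := by
  have hc := continuous_plMap p
  refine convex_of_locallyConvex (isCompact_body.image hc).isClosed
    (hconn.image _ hc.continuousOn) ?_
  rintro _ ⟨ξ, hξ, rfl⟩
  obtain ⟨v, hv⟩ : ∃ v, 0 < ξ v := by
    by_contra! h
    have := Finset.sum_nonpos fun v (_ : v ∈ Finset.univ) => h v
    rw [hξ.1.2] at this
    linarith
  obtain ⟨t, ht⟩ := hξ.2
  have hvt := ht v hv.ne'
  -- the segment from the vertex to the point stays away from the link of the vertex
  set A : Set ℂ := (fun l : ℝ => plMap p ((1 - l) • Pi.single v 1 + l • ξ)) '' Icc 0 1 with hA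
  set B : Set ℂ := plMap p '' (body O ∩ {x | x v = 0}) with hB
  have hAc : IsCompact A := isCompact_Icc.image (hc.comp (by fun_prop))
  have hBc : IsClosed B := ((isCompact_body_inter
    (isClosed_eq (continuous_apply v) continuous_const)).image hc).isClosed
  have hAB : Disjoint A B := by
    rw [Set.disjoint_left]
    rintro _ ⟨l, hl, rfl⟩ ⟨η, ⟨hη, hηv⟩, he⟩
    have hmem : (1 - l) • Pi.single v 1 + l • ξ ∈ body O := by
      refine ⟨convex_stdSimplex ℝ V (single_mem_stdSimplex ℝ v) hξ.1 (by linarith [hl.2]) hl.1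
        (by ring), t, fun w hw => ?_⟩
      by_cases hwv : w = v
      · exact hwv ▸ hvt
      · refine ht w fun h => hw ?_
        simp [hwv, h]
    have h1 := congrFun (hinj hη hmem he) v
    rw [hηv] at h1
    simp at h1
    rcases hl.1.eq_or_lt with h | h
    · rw [← h] at h1; norm_num at h1
    · have := mul_pos h hv
      linarith [hl.2]
  obtain ⟨δ, hδ, hdist⟩ := Metric.exists_pos_forall_lt_edist hAc hBc hAB
  have hdist' : ∀ z ∈ A, ∀ w ∈ B, (δ : ℝ) < dist z w := by
    intro z hz w hw
    have := hdist z hz w hw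
    rw [edist_nndist] at this
    exact_mod_cast this
  refine ⟨δ, hδ, ?_⟩
  have hK : plMap p '' body O ∩ Metric.ball (plMap p ξ) δ =
      {y | y - p v ∈ cone O p v} ∩ Metric.ball (plMap p ξ) δ := by
    ext y
    refine and_congr_left fun hy => ?_
    rw [Metric.mem_ball] at hy
    constructor
    · rintro ⟨η, hη, rfl⟩
      have hηv : η v ≠ 0 := by
        intro h
        have := hdist' (plMap p ξ) ⟨1, by simp, by simp⟩ _ ⟨η, ⟨hη, h⟩, rfl⟩
        rw [dist_comm] at this
        linarith
      obtain ⟨τ, hτ⟩ := hη.2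
      obtain ⟨b, c, h, hface⟩ := face_of_mem (hτ v hηv)
      refine ⟨b, c, h, η b, hη.1.1 b, η c, hη.1.1 c, ?_⟩
      rw [plMap_eq_of_support p h (fun w hw => hface ▸ hτ w hw) hη.1.2]
      module
    · rintro ⟨b, c, h, s, hs, u, hu, he⟩
      have h1 := hO.ne h
      have h2 := hO.ne (hO.rot h)
      have h3 := (hO.ne (hO.rot (hO.rot h))).symm
      have hmem : ∀ r s u : ℝ, 0 ≤ r → 0 ≤ s → 0 ≤ u → r + s + u = 1 →
          Pi.single v r + Pi.single b s + Pi.single c u ∈ body O := by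
        intro r s u hr hs hu hrsu
        refine ⟨⟨fun w => ?_, ?_⟩, ⟨(v, b, c), h⟩, fun w hw => ?_⟩
        · simp only [Pi.add_apply, Pi.single_apply]
          split_ifs <;> linarith
        · simp [Finset.sum_add_distrib, hrsu]
        · by_contra hw'
          simp only [face, Finset.mem_insert, Finset.mem_singleton, not_or] at hw'
          simp [hw'.1, hw'.2.1, hw'.2.2] at hw
      by_cases hsu : s + u ≤ 1
      · refine ⟨_, hmem (1 - s - u) s u (by linarith) hs hu (by ring), ?_⟩
        simp only [map_add, plMap_single]
        rw [← sub_add_cancel y (p v), he]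
        module
      · push Not at hsu
        exfalso
        have hpos : 0 < s + u := by linarith
        obtain ⟨l, hl⟩ : ∃ l, l = (s + u)⁻¹ := ⟨_, rfl⟩
        have hl0 : 0 < l := hl ▸ inv_pos.2 hpos
        have hl1 : l ≤ 1 := hl ▸ inv_le_one_of_one_le₀ hsu.le
        have hls : l * s + l * u = 1 := by rw [← mul_add, hl, inv_mul_cancel₀ hpos.ne']
        have hBm := hdist' _ ⟨l, ⟨hl0.le, hl1⟩, rfl⟩ _ ⟨_, ⟨hmem 0 (l * s) (l * u) le_rfl
          (by positivity) (by positivity) (by linarith), by simp [h1, h3]⟩, rfl⟩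
        have e1 : plMap p (Pi.single v 0 + Pi.single b (l * s) + Pi.single c (l * u)) =
            p v + l • (y - p v) := by
          rw [he]
          simp only [map_add, plMap_single]
          have hls' : (l * s + l * u : ℂ) = 1 := by exact_mod_cast hls
          simp only [Complex.real_smul]
          push_cast
          linear_combination p v * hls'
        have e2 : plMap p ((1 - l) • Pi.single v 1 + l • ξ) = p v + l • (plMap p ξ - p v) := by
          simp only [map_add, map_smul, plMap_single]; module
        simp only at hBm
        rw [e1, e2, dist_add_left, dist_smul₀, dist_sub_right, Real.norm_of_nonneg hl0.le,
          dist_comm] at hBm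
        nlinarith [dist_nonneg (x := y) (y := plMap p ξ)]
  rw [hK]
  refine Convex.inter ?_ (convex_ball _ _)
  intro y hy z hz a b ha hb hab
  have := hcone v hy hz ha hb hab
  have e : a • (y - p v) + b • (z - p v) = a • y + b • z - p v := by
    have : p v = (a + b) • p v := by rw [hab, one_smul]
    conv_rhs => rw [this]
    module
  rwa [e] at this

/-- If an embedded disk is convex, a bound for the contraction of the triangles is a bound for the
contraction of the whole disk. -/
theorem mul_norm_le_of_convex {p : V → ℂ} (hinj : InjOn (plMap p) (body O))
    (hconv : Convex ℝ (plMap p '' body O)) {κ : ℝ} (hκ : 0 ≤ κ)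
    (hloc : ∀ c : V → ℝ, ∑ v, c v = 0 → ∀ t : Corner O, (∀ v, c v ≠ 0 → v ∈ t.face) →
      κ * ‖c‖ ≤ ‖plMap p c‖) {x y : V → ℝ} (hx : x ∈ body O) (hy : y ∈ body O) :
    κ * ‖y - x‖ ≤ ‖plMap p (y - x)‖ := by
  have : CompactSpace (body O) := isCompact_iff_compactSpace.1 isCompact_body
  set e₀ : body O ≃ plMap p '' body O := Equiv.Set.imageOfInjOn _ _ hinj with he₀
  have hec : Continuous e₀ := ((continuous_plMap p).comp continuous_subtype_val).subtype_mk _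
  set e : body O ≃ₜ plMap p '' body O := hec.homeoOfEquivCompactToT2 with he
  have hγ : ∀ t : Icc (0 : ℝ) 1, plMap p x + t.1 • plMap p (y - x) ∈ plMap p '' body O := by
    intro t
    have := hconv ⟨x, hx, rfl⟩ ⟨y, hy, rfl⟩ (by linarith [t.2.2] : 0 ≤ 1 - t.1) t.2.1 (by ring)
    convert this using 1
    rw [map_sub]; module
  -- the preimage of the segment between the images
  set ξ : ℝ → V → ℝ := fun t => (e.symm ⟨_, hγ (projIcc 0 1 zero_le_one t)⟩ : body O) with hξ
  have hξc : Continuous ξ := by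
    refine continuous_subtype_val.comp (e.symm.continuous.comp (Continuous.subtype_mk ?_ _))
    have : Continuous fun t : ℝ => (projIcc (0 : ℝ) 1 zero_le_one t : ℝ) :=
      continuous_subtype_val.comp continuous_projIcc
    fun_prop
  have hξb : ∀ t, ξ t ∈ body O := fun t => (e.symm _).2
  have hpl : ∀ t ∈ Icc (0 : ℝ) 1, plMap p (ξ t) = plMap p x + t • plMap p (y - x) := by
    intro t ht
    have h1 := congrArg Subtype.val (e.apply_symm_apply ⟨_, hγ (projIcc 0 1 zero_le_one t)⟩)
    have h2 : plMap p (ξ t) = (e (e.symm ⟨_, hγ (projIcc 0 1 zero_le_one t)⟩) : ℂ) := rfl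
    rw [h2, h1, projIcc_of_mem _ ht]
  set D := ‖plMap p (y - x)‖ with hD
  have hS : Icc (0 : ℝ) 1 ⊆ {t | κ * ‖ξ t - ξ 0‖ ≤ t * D} := by
    refine IsClosed.Icc_subset_of_forall_mem_nhdsWithin ?_ (by simp) ?_
    · exact (isClosed_le (by fun_prop) (by fun_prop)).inter isClosed_Icc
    · rintro t ⟨htS, ht⟩
      have hev : ∀ᶠ t' in 𝓝[>] t, ∀ v, 0 < ξ t v → 0 < ξ t' v := by
        refine eventually_all.2 fun v => ?_
        by_cases hv : 0 < ξ t v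
        · have : ContinuousAt (fun t => ξ t v) t := by fun_prop
          filter_upwards [(this.tendsto.mono_left nhdsWithin_le_nhds).eventually (lt_mem_nhds hv)]
            with t' h _ using h
        · exact Eventually.of_forall fun _ h => absurd h hv
      filter_upwards [hev, Ioo_mem_nhdsGT ht.2] with t' h1 ht'
      -- by `h1`, the triangle that contains `ξ t'` also contains `ξ t`
      obtain ⟨τ, hτ⟩ := (hξb t').2
      have h2 := hloc (ξ t' - ξ t) (by
        simp [Finset.sum_sub_distrib, (hξb t').1.2, (hξb t).1.2]) τ (fun v hv => by
        refine hτ v fun h0 => hv ?_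
        have h3 : ξ t v = 0 := by
          by_contra hne
          have := h1 v (lt_of_le_of_ne ((hξb t).1.1 v) (Ne.symm hne))
          exact this.ne' h0
        simp [h0, h3])
      have h3 : plMap p (ξ t' - ξ t) = (t' - t) • plMap p (y - x) := by
        rw [map_sub, hpl t' ⟨ht.1.trans ht'.1.le, ht'.2.le⟩, hpl t ⟨ht.1, ht.2.le⟩]
        module
      rw [h3, norm_smul, Real.norm_of_nonneg (by linarith [ht'.1])] at h2
      have h4 : ‖ξ t' - ξ 0‖ ≤ ‖ξ t' - ξ t‖ + ‖ξ t - ξ 0‖ := by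
        simpa using norm_add_le (ξ t' - ξ t) (ξ t - ξ 0)
      have h5 : κ * ‖ξ t - ξ 0‖ ≤ t * D := htS
      have h6 := mul_le_mul_of_nonneg_left h4 hκ
      change κ * ‖ξ t' - ξ 0‖ ≤ t' * D
      linarith
  have h1 : κ * ‖ξ 1 - ξ 0‖ ≤ 1 * D := hS ⟨zero_le_one, le_rfl⟩
  have e0 : ξ 0 = x := hinj (hξb 0) hx (by rw [hpl 0 (by simp)]; simp)
  have e1 : ξ 1 = y := hinj (hξb 1) hy (by rw [hpl 1 (by simp)]; simp)
  rwa [e0, e1, one_mul] at h1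

theorem eq_zero_of_plMap_eq_zero {p : V → ℂ} (hp : IsPositive O p) {c : V → ℝ}
    (hc : ∑ v, c v = 0) {t : Corner O} (ht : ∀ v, c v ≠ 0 → v ∈ t.face) (h : plMap p c = 0) :
    c = 0 := by
  obtain ⟨⟨v, b, d⟩, hO'⟩ := t
  have h1 := plMap_eq_of_support p hO' ht hc
  rw [h, zero_smul, zero_add] at h1
  obtain ⟨hb, hd⟩ := eq_zero_of_cross_ne_zero (hp.cross_pos ⟨(v, b, d), hO'⟩).ne' h1.symm
  simp only at hb hd
  have h0 : ∀ w, w ∉ ({v, b, d} : Finset V) → c w = 0 := fun w hw => by_contra fun h => hw (ht w h)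
  rw [sum_eq_of_support hO' h0, hb, hd, add_zero, add_zero] at hc
  ext w
  by_cases hw : w ∈ ({v, b, d} : Finset V)
  · simp only [Finset.mem_insert, Finset.mem_singleton] at hw
    rcases hw with rfl | rfl | rfl
    · exact hc
    · exact hb
    · exact hd
  · exact h0 w hw

/-- Along a path of positively oriented maps with convex angles at the vertices, the map remains an
embedding. By `mul_norm_le_of_convex`, embeddings are uniformly far from non-injective maps. -/
theorem injOn_of_path {P : ℝ → V → ℂ} (hP : Continuous P)
    (hpos : ∀ t ∈ Icc (0 : ℝ) 1, IsPositive O (P t))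
    (hcone : ∀ t ∈ Icc (0 : ℝ) 1, ∀ v, Convex ℝ (cone O (P t) v)) (hconn : IsPreconnected (body O))
    (h0 : InjOn (plMap (P 0)) (body O)) : InjOn (plMap (P 1)) (body O) := by
  have hcont : Continuous fun z : ℝ × (V → ℝ) => plMap (P z.1) z.2 := by
    simp only [Fintype.linearCombination_apply]
    fun_prop
  -- a common bound for the contraction of the triangles, by compactness
  obtain ⟨κ, hκ, hloc⟩ : ∃ κ > (0 : ℝ), ∀ t ∈ Icc (0 : ℝ) 1, ∀ c : V → ℝ, ∑ v, c v = 0 →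
      ∀ τ : Corner O, (∀ v, c v ≠ 0 → v ∈ τ.face) → κ * ‖c‖ ≤ ‖plMap (P t) c‖ := by
    set S : Set (V → ℝ) := Metric.sphere 0 1 ∩ ({c | ∑ v, c v = 0} ∩
      ⋃ τ : Corner O, ⋂ v : V, ⋂ _ : v ∉ τ.face, {c | c v = 0}) with hS
    have hSc : IsCompact S := by
      refine (isCompact_sphere _ _).inter_right (IsClosed.inter
        (isClosed_eq (by fun_prop) continuous_const) (isClosed_iUnion_of_finite fun τ => ?_))
      exact isClosed_iInter fun v => isClosed_iInter fun _ =>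
        isClosed_eq (continuous_apply v) continuous_const
    have hSm : ∀ c : V → ℝ, c ∈ S ↔ ‖c‖ = 1 ∧ ∑ v, c v = 0 ∧
        ∃ τ : Corner O, ∀ v, c v ≠ 0 → v ∈ τ.face := by
      intro c
      simp only [hS, mem_inter_iff, mem_sphere_zero_iff_norm, mem_ofPred_eq, mem_iUnion, mem_iInter]
      refine and_congr_right fun _ => and_congr_right fun _ => exists_congr fun t =>
        forall_congr' fun v => ?_
      rw [not_imp_comm]
    obtain ⟨κ, hκ, h⟩ := (isCompact_Icc.prod hSc).exists_forall_le' (a := 0)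
      (f := fun z : ℝ × (V → ℝ) => ‖plMap (P z.1) z.2‖) hcont.norm.continuousOn (by
        rintro ⟨t, c⟩ ⟨ht, hc⟩
        obtain ⟨h1, h2, τ, hτ⟩ := (hSm c).1 hc
        refine norm_pos_iff.2 fun h0 => ?_
        have := eq_zero_of_plMap_eq_zero (hpos t ht) h2 hτ h0
        rw [this, norm_zero] at h1
        exact zero_ne_one h1)
    refine ⟨κ, hκ, fun t ht c hc τ hτ => ?_⟩
    by_cases hc0 : c = 0
    · simp [hc0]
    have hn := norm_pos_iff.2 hc0
    have := h (t, ‖c‖⁻¹ • c) ⟨ht, (hSm _).2 ⟨by simp [norm_smul, hn.ne'], by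
      simp [← Finset.mul_sum, hc], τ, fun v hv => hτ v fun h => hv (by simp [h])⟩⟩
    simp only [map_smul, norm_smul, norm_inv, norm_norm] at this
    rw [inv_mul_eq_div, le_div_iff₀ hn] at this
    exact this
  set S : Set ℝ := {t | ∀ x ∈ body O, ∀ y ∈ body O, κ * ‖y - x‖ ≤ ‖plMap (P t) (y - x)‖} with hS
  have hSinj : ∀ t ∈ S, InjOn (plMap (P t)) (body O) := by
    intro t ht x hx y hy he
    have h1 := ht x hx y hy
    rw [map_sub, he, sub_self, norm_zero] at h1
    have h2 : ‖y - x‖ = 0 := le_antisymm (by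
      by_contra! h; exact absurd h1 (not_le.2 (mul_pos hκ h))) (norm_nonneg _)
    exact (sub_eq_zero.1 (norm_eq_zero.1 h2)).symm
  have hinjS : ∀ t ∈ Icc (0 : ℝ) 1, InjOn (plMap (P t)) (body O) → t ∈ S := by
    intro t ht hinj x hx y hy
    exact mul_norm_le_of_convex hinj (convex_image hinj hconn (hcone t ht)) hκ.le (hloc t ht) hx hy
  have hsub : Icc (0 : ℝ) 1 ⊆ S := by
    refine IsClosed.Icc_subset_of_forall_mem_nhdsWithin ?_ (hinjS 0 (by simp) h0) ?_
    · refine IsClosed.inter ?_ isClosed_Icc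
      have : S = ⋂ x ∈ body O, ⋂ y ∈ body O, {t | κ * ‖y - x‖ ≤ ‖plMap (P t) (y - x)‖} := by
        ext t; simp [hS]
      rw [this]
      refine isClosed_biInter fun x _ => isClosed_biInter fun y _ => isClosed_le continuous_const ?_
      exact (hcont.comp (by fun_prop : Continuous fun t : ℝ => (t, y - x))).norm
    · rintro t ⟨htS, ht⟩
      set C : ℝ := (Fintype.card V : ℝ) with hC
      have hC0 : (0 : ℝ) ≤ C := Nat.cast_nonneg _
      have hev : ∀ᶠ t' in 𝓝[>] t, C * ‖P t' - P t‖ < κ := by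
        have : ContinuousAt (fun t' => C * ‖P t' - P t‖) t := by fun_prop
        refine (this.tendsto.mono_left nhdsWithin_le_nhds).eventually (gt_mem_nhds ?_)
        simpa using hκ
      filter_upwards [hev, Ioo_mem_nhdsGT ht.2] with t' h1 ht'
      refine hinjS t' ⟨ht.1.trans ht'.1.le, ht'.2.le⟩ fun x hx y hy he => ?_
      by_contra hne
      have hn : 0 < ‖y - x‖ := norm_pos_iff.2 (sub_ne_zero.2 (Ne.symm hne))
      have h2 := htS x hx y hy
      have h3 : plMap (P t') (y - x) = 0 := by rw [map_sub, he, sub_self]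
      have h4 : ‖plMap (P t') (y - x) - plMap (P t) (y - x)‖ ≤ C * (‖y - x‖ * ‖P t' - P t‖) := by
        simp only [Fintype.linearCombination_apply]
        rw [← Finset.sum_sub_distrib]
        calc _ ≤ ∑ v : V, ‖y - x‖ * ‖P t' - P t‖ := by
              refine norm_sum_le_of_le _ fun v _ => ?_
              rw [← smul_sub, norm_smul]
              exact mul_le_mul (norm_le_pi_norm (y - x) v) (norm_le_pi_norm (P t' - P t) v)
                (norm_nonneg _) (norm_nonneg _)
          _ = _ := by simp [hC]
      rw [h3, zero_sub, norm_neg] at h4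
      have := mul_lt_mul_of_pos_right h1 hn
      linarith
  exact hSinj 1 (hsub ⟨zero_le_one, le_rfl⟩)

end Corner

/-! ### The space of convex Delaunay triangulations -/

/-- A bounded open convex set is homeomorphic to the whole space. -/
theorem nonempty_homeomorph_of_isOpen_of_convex {E : Type*} [NormedAddCommGroup E] [NormedSpace ℝ E]
    {s : Set E} (ho : IsOpen s) (hc : Convex ℝ s) (hne : s.Nonempty) (hb : Bornology.IsBounded s) :
    Nonempty (s ≃ₜ E) := by
  obtain ⟨h, h1, -, -⟩ := exists_homeomorph_image_interior_closure_frontier_eq_unitBall hc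
    (by rwa [ho.interior_eq]) hb
  rw [ho.interior_eq] at h1
  exact ⟨(h.image s).trans ((Homeomorph.setCongr h1).trans Homeomorph.unitBall.symm)⟩

theorem isOpen_and_convex_of_forall_lt {E ι : Type*} [NormedAddCommGroup E] [NormedSpace ℝ E]
    [FiniteDimensional ℝ E] [Finite ι] (f : ι → E →ₗ[ℝ] ℝ) (c : ι → ℝ) :
    IsOpen {w | ∀ i, f i w < c i} ∧ Convex ℝ {w | ∀ i, f i w < c i} := by
  have h : {w | ∀ i, f i w < c i} = ⋂ i, {w | f i w < c i} := by ext; simp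
  rw [h]
  exact ⟨isOpen_iInter_of_finite fun i =>
      isOpen_lt (LinearMap.continuous_of_finiteDimensional _) continuous_const,
    convex_iInter fun i => convex_halfSpace_lt (f i).isLinear _⟩

namespace Corner

variable {V : Type*} [Fintype V] [DecidableEq V] {O : V → V → V → Prop} [hO : OrientedDisk O]

/-- The angle sums at the vertices are determined by the sums over the edges. -/
theorem sum_eq_zero_of_edgeSum_eq_zero {β : Corner O → ℝ} (h : edgeSum O β = 0)
    (h3 : ∀ t, β t + β t.nxt + β t.nxt.nxt = 0) (v : V) :
    ∑ t : Corner O with t.1.1 = v, β t = 0 := by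
  have h' : ∀ t, β t.twin = -β t := fun t => by
    have := congrFun h t
    simp only [edgeSum, LinearMap.coe_mk, AddHom.coe_mk, Pi.zero_apply] at this
    linarith
  have e1 : ∑ t : Corner O, (if t.1.1 = v then β t.nxt else 0) =
      ∑ t : Corner O, (if t.1.2.2 = v then β t else 0) := by
    exact sum_nxt (fun t : Corner O => if t.1.2.2 = v then β t else 0)
  have e2 : ∑ t : Corner O, (if t.1.1 = v then β t.nxt.nxt else 0) =
      ∑ t : Corner O, (if t.1.2.1 = v then β t else 0) := by
    exact (sum_nxt (fun t : Corner O => if t.nxt.1.2.1 = v then β t.nxt else 0)).trans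
      (sum_nxt (fun t : Corner O => if t.1.2.1 = v then β t else 0))
  have e3 : ∑ t : Corner O, (if t.1.2.2 = v then β t else 0) =
      -∑ t : Corner O, (if t.1.2.1 = v then β t else 0) := by
    rw [← sum_twin, ← Finset.sum_neg_distrib]
    refine Finset.sum_congr rfl fun t _ => ?_
    obtain ⟨⟨a, b, c⟩, ht⟩ := t
    by_cases hb : IsBdry (⟨(a, b, c), ht⟩ : Corner O)
    · have h0 := h' ⟨(a, b, c), ht⟩
      rw [twin_of_isBdry hb] at h0 ⊢
      have : β ⟨(a, b, c), ht⟩ = 0 := by linarith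
      simp [this]
    · obtain ⟨d, hd, e⟩ := twin_fst_ne ht hb
      have h0 := h' ⟨(a, b, c), ht⟩
      rw [e] at h0 ⊢
      simp only [h0]
      split_ifs <;> simp
  rw [Finset.sum_filter]
  have h4 : ∀ t : Corner O, (if t.1.1 = v then β t else 0) =
      -(if t.1.1 = v then β t.nxt else 0) - (if t.1.1 = v then β t.nxt.nxt else 0) := by
    intro t
    have := h3 t
    split_ifs <;> linarith
  rw [Finset.sum_congr rfl fun t _ => h4 t, Finset.sum_sub_distrib, Finset.sum_neg_distrib, e1, e2,
    e3]
  ring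

theorem ratio_of_similar {p p' : V → ℂ} {q : ℂ} (hq : q ≠ 0)
    (h : ∀ a b, p' a - p' b = q * (p a - p b)) (t : Corner O) : ratio p' t = ratio p t := by
  rw [ratio, ratio, h, h, mul_div_mul_left _ _ hq]

theorem ang_of_similar {p p' : V → ℂ} {q : ℂ} (hq : q ≠ 0)
    (h : ∀ a b, p' a - p' b = q * (p a - p b)) : (ang p' : Corner O → ℝ) = ang p := by
  ext t; rw [ang, ang, ratio_of_similar hq h]

theorem injOn_of_similar {p p' : V → ℂ} {q : ℂ} (hq : q ≠ 0)
    (h : ∀ a b, p' a - p' b = q * (p a - p b)) (hp : InjOn (plMap p) (body O)) :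
    InjOn (plMap p') (body O) := by
  obtain ⟨a, -, -, -⟩ := hO.exists_boundary
  have key : ∀ x ∈ body O, plMap p' x = p' a - q * p a + q * plMap p x := by
    intro x hx
    have h1 : p' a - q * p a = ∑ v, x v • (p' a - q * p a) := by
      rw [← Finset.sum_smul, hx.1.2, one_smul]
    rw [h1, Fintype.linearCombination_apply, Fintype.linearCombination_apply, Finset.mul_sum,
      ← Finset.sum_add_distrib]
    refine Finset.sum_congr rfl fun v _ => ?_
    have := h v a
    simp only [Complex.real_smul]
    linear_combination (x v : ℂ) * this
  intro x hx y hy he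
  rw [key x hx, key y hy] at he
  exact hp hx hy (mul_left_cancel₀ hq (add_left_cancel he))

variable (O) in
/-- The vertex positions `p` define a positively oriented strictly Delaunay triangulation of a
convex polygon. That the angles at inner vertices add up to `2π` follows from injectivity. -/
structure IsConvexDelaunay (p : V → ℂ) : Prop where
  pos : IsPositive O p
  inj : InjOn (plMap p) (body O)
  delaunay : ∀ t : Corner O, ¬ IsBdry t → ang p t + ang p t.twin < Real.pi
  boundary : ∀ v, ¬ Inner O v → ∑ t : Corner O with t.1.1 = v, ang p t < Real.pi
  inner : ∀ v, Inner O v → ∑ t : Corner O with t.1.1 = v, ang p t = 2 * Real.pi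

theorem IsConvexDelaunay.of_similar {p p' : V → ℂ} {q : ℂ} (hq : q ≠ 0)
    (h : ∀ a b, p' a - p' b = q * (p a - p b)) (hp : IsConvexDelaunay O p) :
    IsConvexDelaunay O p' where
  pos t := by rw [ratio_of_similar hq h]; exact hp.pos t
  inj := injOn_of_similar hq h hp.inj
  delaunay := by rw [ang_of_similar hq h]; exact hp.delaunay
  boundary := by rw [ang_of_similar hq h]; exact hp.boundary
  inner := by rw [ang_of_similar hq h]; exact hp.inner

theorem IsConvexDelaunay.sub_mem {p p' : V → ℂ} (hp : IsConvexDelaunay O p)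
    (hp' : IsConvexDelaunay O p') : ang p - ang p' ∈ angleChange O := by
  refine ⟨fun t => ?_, fun v hv => ?_⟩
  · have := ang_sum hp.pos t
    have := ang_sum hp'.pos t
    simp only [Pi.sub_apply]; linarith
  · simp [Finset.sum_sub_distrib, hp.inner v hv, hp'.inner v hv]

/-- A triangulation with given Delaunay edge sums is unique up to similarity. -/
theorem eq_of_edgeSum_eq {p p' : V → ℂ} (hp : IsPositive O p) (hp' : IsPositive O p')
    (hd : ∀ t : Corner O, ¬ IsBdry t → ang p t + ang p t.twin < Real.pi)
    (h : edgeSum O (ang p) = edgeSum O (ang p')) : (ang p : Corner O → ℝ) = ang p' := by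
  refine (isGeometric_ang hp hd).unique (isGeometric_ang hp' fun t ht => ?_) h fun t => by
    rw [ang_sum hp, ang_sum hp']
  have : ang p t + ang p t.twin = ang p' t + ang p' t.twin := congrFun h t
  rw [← this]; exact hd t ht

/-- Normalized convex Delaunay triangulations are parametrized continuously by their edge sums,
which form a bounded open convex set in a vector space. -/
theorem exists_parametrization {p₀ : V → ℂ} (hp₀ : IsConvexDelaunay O p₀)
    (hconn : IsPreconnected (body O)) {i j : V}
    (hij : ∃ t : Corner O, (t.1.2.1 = i ∧ t.1.2.2 = j) ∨ (t.1.2.1 = j ∧ t.1.2.2 = i)) :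
    ∃ S : Set ((angleChange O).map (edgeSum O)), IsOpen S ∧ Convex ℝ S ∧ S.Nonempty ∧
      Bornology.IsBounded S ∧ ∃ Q : S → V → ℂ, Continuous Q ∧
      (∀ ω : S, Q ω i = 0 ∧ Q ω j = 1 ∧ IsConvexDelaunay O (Q ω) ∧
        edgeSum O (ang (Q ω) - ang p₀) = ω.1) ∧
      ∀ p, IsConvexDelaunay O p → ∃ ω : S, edgeSum O (ang p - ang p₀) = ω.1 := by
  set L : angleChange O →ₗ[ℝ] (angleChange O).map (edgeSum O) :=
    (edgeSum O).submoduleMap (angleChange O) with hL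
  have hLs : Function.Surjective L := LinearMap.submoduleMap_surjective _ _
  have hLv : ∀ w, (L w : Corner O → ℝ) = edgeSum O w := fun _ => rfl
  have hedge : ∀ (α : Corner O → ℝ) t, edgeSum O α t = α t + α t.twin := fun _ _ => rfl
  -- the changes of the angles of `p₀` that preserve the inequalities
  set ev : Corner O → angleChange O →ₗ[ℝ] ℝ := fun t => LinearMap.proj t ∘ₗ (angleChange O).subtype
    with hev
  set Ω : Set (angleChange O) := ({w | ∀ t, (-ev t) w < ang p₀ t} ∩
    {w | ∀ t : {t : Corner O // ¬ IsBdry t}, (ev t.1 + ev t.1.twin) w <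
      Real.pi - (ang p₀ t.1 + ang p₀ t.1.twin)}) ∩
    {w | ∀ v : {v : V // ¬ Inner O v}, (∑ t : Corner O with t.1.1 = v.1, ev t) w <
      Real.pi - ∑ t : Corner O with t.1.1 = v.1, ang p₀ t} with hΩ
  have hΩm : ∀ w, w ∈ Ω ↔ (∀ t, 0 < ang p₀ t + w.1 t) ∧ (∀ t, ¬ IsBdry t →
      (ang p₀ t + w.1 t) + (ang p₀ t.twin + w.1 t.twin) < Real.pi) ∧
      ∀ v, ¬ Inner O v → ∑ t : Corner O with t.1.1 = v, (ang p₀ t + w.1 t) < Real.pi := by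
    intro w
    simp only [hΩ, hev, mem_inter_iff, mem_ofPred_eq, LinearMap.neg_apply, LinearMap.add_apply,
      LinearMap.sum_apply, LinearMap.comp_apply, LinearMap.proj_apply, Submodule.subtype_apply,
      and_assoc, Finset.sum_add_distrib]
    refine and_congr (forall_congr' fun t => ?_) (and_congr ?_ ?_)
    · constructor <;> intro h <;> linarith
    · refine ⟨fun h t ht => ?_, fun h t => ?_⟩
      · have := h ⟨t, ht⟩; linarith
      · have := h t.1 t.2; linarith
    · refine ⟨fun h v hv => ?_, fun h v => ?_⟩
      · have := h ⟨v, hv⟩; linarith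
      · have := h v.1 v.2; linarith
  have hΩo : IsOpen Ω := ((isOpen_and_convex_of_forall_lt _ _).1.inter
    (isOpen_and_convex_of_forall_lt _ _).1).inter (isOpen_and_convex_of_forall_lt _ _).1
  have hΩc : Convex ℝ Ω := ((isOpen_and_convex_of_forall_lt _ _).2.inter
    (isOpen_and_convex_of_forall_lt _ _).2).inter (isOpen_and_convex_of_forall_lt _ _).2
  have hΩ0 : (0 : angleChange O) ∈ Ω := by
    rw [hΩm]
    exact ⟨fun t => by simpa using ang_pos hp₀.pos t, fun t ht => by simpa using hp₀.delaunay t ht,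
      fun v hv => by simpa using hp₀.boundary v hv⟩
  have hLo : IsOpenMap L := L.isOpenMap_of_finiteDimensional hLs
  have hLc : Continuous L := L.continuous_of_finiteDimensional
  -- the developed triangulations
  obtain ⟨α, R, hα, hR, hαR⟩ := exists_isGeometric (O := O)
  set f : Ω → DelaunayAngles O := fun w => ⟨ang p₀ + w.1.1, ((hΩm _).1 w.2).1, fun t ht =>
    ((hΩm _).1 w.2).2.1 t ht⟩ with hf
  have hfc : Continuous f := by
    refine Continuous.subtype_mk ?_ _
    exact continuous_const.add (continuous_subtype_val.comp continuous_subtype_val)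
  obtain ⟨Γ, hΓc, hΓ⟩ := exists_develop hp₀.pos (α := α ∘ f) (R := R ∘ f) (hα.comp hfc)
    (hR.comp hfc) (fun w => (hαR (f w)).1) (fun w => by
      have h1 := (hαR (f w)).2.2
      have h2 : (α ∘ f) w - ang p₀ = (α (f w) - (f w : Corner O → ℝ)) + w.1.1 := by
        simp only [hf, Function.comp_apply]; abel
      rw [h2]
      exact (angleChange O).add_mem h1 w.1.2) hij
  have hang : ∀ w : Ω, edgeSum O (ang (Γ w)) = edgeSum O (ang p₀) + edgeSum O w.1.1 := by
    intro w
    rw [(hΓ w).2.2.2, Function.comp_apply, (hαR (f w)).2.1, ← map_add]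
  have hdel : ∀ w : Ω, ∀ t : Corner O, ¬ IsBdry t → ang (Γ w) t + ang (Γ w) t.twin < Real.pi := by
    intro w
    rw [(hΓ w).2.2.2]
    exact (hαR (f w)).1.lt_pi
  have hmem : ∀ w : Ω, ang (Γ w) - ang p₀ - w.1.1 ∈ angleChange O := by
    intro w
    have h1 := (hαR (f w)).2.2
    have h2 : ang (Γ w) - ang p₀ - w.1.1 = α (f w) - (f w : Corner O → ℝ) := by
      rw [(hΓ w).2.2.2]; simp only [hf, Function.comp_apply]; abel
    rw [h2]; exact h1
  have hsum : ∀ (w : Ω) (v : V), ∑ t : Corner O with t.1.1 = v, ang (Γ w) t =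
      ∑ t : Corner O with t.1.1 = v, (ang p₀ t + w.1.1 t) := by
    intro w v
    have := sum_eq_zero_of_edgeSum_eq_zero (β := ang (Γ w) - ang p₀ - w.1.1) (by
      rw [map_sub, map_sub, hang]; abel) (hmem w).1 v
    rw [← sub_eq_zero, ← Finset.sum_sub_distrib, ← this]
    refine Finset.sum_congr rfl fun t _ => ?_
    simp only [Pi.sub_apply]; ring
  have hbdry : ∀ (w : Ω) (v : V), ¬ Inner O v →
      ∑ t : Corner O with t.1.1 = v, ang (Γ w) t < Real.pi := fun w v hv => by
    rw [hsum]; exact ((hΩm _).1 w.2).2.2 v hv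
  have hinj : ∀ w : Ω, InjOn (plMap (Γ w)) (body O) := by
    intro w
    have hstar : ∀ t ∈ Icc (0 : ℝ) 1, t • w.1 ∈ Ω := fun t ht =>
      (hΩc.starConvex hΩ0).smul_mem w.2 ht.1 ht.2
    set P : ℝ → Ω := fun t => ⟨(projIcc (0 : ℝ) 1 zero_le_one t : ℝ) • w.1,
      hstar _ (projIcc (0 : ℝ) 1 zero_le_one t).2⟩ with hP
    have hPc : Continuous P := by
      refine Continuous.subtype_mk ?_ _
      have : Continuous fun t : ℝ => (projIcc (0 : ℝ) 1 zero_le_one t : ℝ) :=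
        continuous_subtype_val.comp continuous_projIcc
      fun_prop
    have hP1 : P 1 = w := Subtype.ext (by simp [hP])
    have hP0 : (P 0 : angleChange O) = 0 := by simp [hP]
    have := injOn_of_path (P := fun t => Γ (P t)) (O := O) (hΓc.comp hPc)
      (fun t _ => (hΓ (P t)).2.2.1) (fun t _ v => ?_) hconn ?_
    · simpa only [hP1] using this
    · by_cases hv : Inner O v
      · exact convex_cone_of_inner (hΓ _).2.2.1 hv
      · exact convex_cone_of_sum_lt (hΓ _).2.2.1 hv (hbdry _ v hv)
    · have h1 : (ang p₀ : Corner O → ℝ) = ang (Γ (P 0)) :=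
        eq_of_edgeSum_eq hp₀.pos (hΓ _).2.2.1 hp₀.delaunay (by rw [hang, hP0]; simp)
      obtain ⟨q, hq, h2⟩ := exists_similarity hp₀.pos (hΓ (P 0)).2.2.1 h1
      exact injOn_of_similar hq h2 hp₀.inj
  have hCD : ∀ w : Ω, IsConvexDelaunay O (Γ w) := fun w =>
    { pos := (hΓ w).2.2.1
      inj := hinj w
      delaunay := hdel w
      boundary := hbdry w
      inner := fun v hv => by
        rw [hsum, Finset.sum_add_distrib, hp₀.inner v hv, w.1.2.2 v hv, add_zero] }
  -- they depend only on the edge sums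
  have hΓL : ∀ w w' : Ω, L w = L w' → Γ w = Γ w' := by
    intro w w' h
    have h1 : (ang (Γ w) : Corner O → ℝ) = ang (Γ w') :=
      eq_of_edgeSum_eq (hΓ w).2.2.1 (hΓ w').2.2.1 (hdel w) (by
        rw [hang, hang, ← hLv, ← hLv, h])
    obtain ⟨q, hq, h2⟩ := exists_similarity (hΓ w).2.2.1 (hΓ w').2.2.1 h1
    have h3 := h2 j i
    rw [(hΓ w).1, (hΓ w).2.1, (hΓ w').1, (hΓ w').2.1] at h3
    have hq1 : q = 1 := by linear_combination -h3
    ext v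
    have h4 := h2 v i
    rw [(hΓ w).1, (hΓ w').1, hq1] at h4
    linear_combination -h4
  set π : Ω → (L '' Ω : Set _) := fun w => ⟨L w, mem_image_of_mem L w.2⟩ with hπ
  have hπs : Function.Surjective π := by
    rintro ⟨_, w, hw, rfl⟩; exact ⟨⟨w, hw⟩, rfl⟩
  have hπq : IsQuotientMap π := by
    refine IsOpenMap.isQuotientMap ?_ ((hLc.comp continuous_subtype_val).subtype_mk _) hπs
    exact (hLo.comp hΩo.isOpenMap_subtype_val).subtype_mk _
  set Q : (L '' Ω : Set _) → V → ℂ := fun ω => Γ (Function.surjInv hπs ω) with hQ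
  have hQπ : ∀ w, Q (π w) = Γ w := fun w => hΓL _ _ (by
    have := Function.surjInv_eq hπs (π w)
    exact congrArg Subtype.val this)
  refine ⟨L '' Ω, hLo _ hΩo, hΩc.linear_image L, ⟨_, mem_image_of_mem L hΩ0⟩, ?_, Q, ?_, ?_, ?_⟩
  · refine isBounded_iff_forall_norm_le.2 ⟨2 * Real.pi, ?_⟩
    rintro _ ⟨w, hw, rfl⟩
    have hpi := Real.pi_pos
    have hb : ∀ t, |w.1 t| ≤ Real.pi := by
      intro t
      have h1 := ((hΩm w).1 hw).1
      have h2 := w.2.1 t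
      have h3 := ang_sum hp₀.pos t
      have h4 := ang_pos hp₀.pos t
      rw [abs_le]
      constructor <;> linarith [h1 t, h1 t.nxt, h1 t.nxt.nxt, ang_lt_pi hp₀.pos t]
    change ‖(L w : Corner O → ℝ)‖ ≤ _
    rw [hLv, pi_norm_le_iff_of_nonneg (by positivity)]
    intro t
    rw [hedge, Real.norm_eq_abs]
    linarith [abs_add_le (w.1 t) (w.1 t.twin), hb t, hb t.twin]
  · rw [hπq.continuous_iff]
    have : Q ∘ π = Γ := funext hQπ
    rw [this]; exact hΓc
  · intro ω
    obtain ⟨w, rfl⟩ := hπs ω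
    rw [hQπ]
    refine ⟨(hΓ w).1, (hΓ w).2.1, hCD w, ?_⟩
    rw [map_sub, hang]
    simp [hπ, hLv]
  · intro p hp
    have hw : (⟨ang p - ang p₀, hp.sub_mem hp₀⟩ : angleChange O) ∈ Ω := by
      rw [hΩm]
      refine ⟨fun t => ?_, fun t ht => ?_, fun v hv => ?_⟩
      · have := ang_pos hp.pos t
        simp only [Pi.sub_apply]; linarith
      · have := hp.delaunay t ht
        simp only [Pi.sub_apply]; linarith
      · have := hp.boundary v hv
        simpa using this
    exact ⟨⟨_, mem_image_of_mem L hw⟩, rfl⟩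

/-- Edge sums, position of `i` and length of the edge from `i` to `j` are coordinates. -/
theorem nonempty_homeomorph {p₀ : V → ℂ} (hp₀ : IsConvexDelaunay O p₀)
    (hconn : IsPreconnected (body O)) {i j : V}
    (hij : ∃ t : Corner O, (t.1.2.1 = i ∧ t.1.2.2 = j) ∨ (t.1.2.1 = j ∧ t.1.2.2 = i)) :
    Nonempty ({p : V → ℂ | IsConvexDelaunay O p ∧ ∃ l : ℝ, 0 < l ∧ p j - p i = l} ≃ₜ
      EuclideanSpace ℝ (Fin (2 * Fintype.card V - 1))) := by
  obtain ⟨S, hSo, hSc, hSn, hSb, Q, hQc, hQ, hS⟩ := exists_parametrization hp₀ hconn hij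
  choose g hg using hS
  set D := {p : V → ℂ | IsConvexDelaunay O p ∧ ∃ l : ℝ, 0 < l ∧ p j - p i = l} with hD
  have hform : ∀ p : D, p.1 j - p.1 i = (Real.exp (Real.log ‖p.1 j - p.1 i‖) : ℝ) := by
    intro p
    obtain ⟨l, hl, h⟩ := p.2.2
    rw [h, Complex.norm_real, Real.norm_of_nonneg hl.le, Real.exp_log hl]
  have hne : ∀ p : D, p.1 j - p.1 i ≠ 0 := by
    intro p
    obtain ⟨l, hl, h⟩ := p.2.2
    rw [h]; exact_mod_cast hl.ne'
  have hval : ∀ (ω : S) (z : ℂ) (τ : ℝ),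
      (fun v => z + (Real.exp τ : ℝ) * Q ω v) ∈ D := by
    intro ω z τ
    have h0 : ((Real.exp τ : ℝ) : ℂ) ≠ 0 := by exact_mod_cast (Real.exp_pos τ).ne'
    refine ⟨(hQ ω).2.2.1.of_similar h0 fun a b => by ring, Real.exp τ, Real.exp_pos τ, ?_⟩
    simp [(hQ ω).1, (hQ ω).2.1]
  have hnorm : ∀ p : D, ∀ v, p.1 v = p.1 i + (p.1 j - p.1 i) * Q (g p.1 p.2.1) v := by
    intro p v
    set ω := g p.1 p.2.1 with hω
    have h1 : (ang (Q ω) : Corner O → ℝ) = ang p.1 := by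
      refine eq_of_edgeSum_eq (hQ ω).2.2.1.pos p.2.1.pos (hQ ω).2.2.1.delaunay ?_
      have h2 := (hQ ω).2.2.2
      rw [hω, ← hg p.1 p.2.1, map_sub, map_sub] at h2
      exact sub_left_injective h2
    obtain ⟨q, hq, h2⟩ := exists_similarity (hQ ω).2.2.1.pos p.2.1.pos h1
    have h3 := h2 j i
    rw [(hQ ω).1, (hQ ω).2.1] at h3
    have h4 := h2 v i
    rw [(hQ ω).1] at h4
    linear_combination h4 - h3 * Q ω v
  have hcoord : ∀ v, Continuous fun p : D => p.1 v := fun v =>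
    (continuous_apply v).comp continuous_subtype_val
  set e : D ≃ₜ S × ℂ × ℝ :=
    { toFun := fun p => (g p.1 p.2.1, p.1 i, Real.log ‖p.1 j - p.1 i‖)
      invFun := fun z => ⟨_, hval z.1 z.2.1 z.2.2⟩
      left_inv := by
        intro p
        refine Subtype.ext (funext fun v => ?_)
        simp only
        rw [← hform, ← hnorm]
      right_inv := by
        rintro ⟨ω, z, τ⟩
        have h0 : ((Real.exp τ : ℝ) : ℂ) ≠ 0 := by exact_mod_cast (Real.exp_pos τ).ne'
        refine Prod.ext (Subtype.ext (Subtype.ext ?_)) (Prod.ext ?_ ?_)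
        · simp only
          rw [← hg, ang_of_similar h0 (p := Q ω) fun a b => by ring]
          exact (hQ ω).2.2.2
        · simp [(hQ ω).1]
        · simp only [(hQ ω).1, (hQ ω).2.1]
          rw [mul_one, mul_zero, add_zero, add_sub_cancel_left, Complex.norm_real,
            Real.norm_of_nonneg (Real.exp_pos τ).le, Real.log_exp]
      continuous_toFun := by
        refine Continuous.prodMk ?_ (Continuous.prodMk ?_ ?_)
        · refine continuous_induced_rng.2 (continuous_induced_rng.2 ?_)
          have : (Subtype.val ∘ Subtype.val ∘ fun p : D => g p.1 p.2.1) =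
              fun p : D => edgeSum O (ang p.1 - ang p₀) := funext fun p => (hg p.1 p.2.1).symm
          rw [this]
          refine (LinearMap.continuous_of_finiteDimensional (edgeSum O)).comp
            (Continuous.sub (continuous_pi fun t => ?_) continuous_const)
          refine continuous_iff_continuousAt.2 fun p => ?_
          exact (continuousAt_ang p.2.1.pos t).comp continuous_subtype_val.continuousAt
        · exact hcoord i
        · exact ((hcoord j).sub (hcoord i)).norm.log fun p => norm_ne_zero_iff.2 (hne p)
      continuous_invFun := by
        refine Continuous.subtype_mk (continuous_pi fun v => ?_) _
        have : Continuous fun z : S × ℂ × ℝ => Q z.1 v :=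
          (continuous_apply v).comp (hQc.comp continuous_fst)
        fun_prop }
  obtain ⟨eS⟩ := nonempty_homeomorph_of_isOpen_of_convex hSo hSc hSn hSb
  have hdim : Module.finrank ℝ ((angleChange O).map (edgeSum O) × ℂ × ℝ) =
      Module.finrank ℝ (EuclideanSpace ℝ (Fin (2 * Fintype.card V - 1))) := by
    have := finrank_map_edgeSum (O := O)
    simp only [Module.finrank_prod, Complex.finrank_real_complex, Module.finrank_self,
      finrank_euclideanSpace_fin]
    omega
  exact ⟨e.trans ((eS.prodCongr (Homeomorph.refl _)).trans
    (ContinuousLinearEquiv.ofFinrankEq hdim).toHomeomorph)⟩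

end Corner

/-! ### Planar geometry in complex coordinates -/

theorem arg_add_arg_lt_pi_iff {z w : ℂ} (hz : 0 < z.im) (hw : 0 < w.im) :
    z.arg + w.arg < Real.pi ↔ 0 < (z * w).im := by
  have hz0 : z ≠ 0 := by rintro rfl; simp at hz
  have hw0 : w ≠ 0 := by rintro rfl; simp at hw
  have h1 : (z * w).im = ‖z‖ * ‖w‖ * Real.sin (z.arg + w.arg) := by
    have n1 := norm_ne_zero_iff.2 hz0
    have n2 := norm_ne_zero_iff.2 hw0
    rw [Real.sin_add, Complex.sin_arg, Complex.sin_arg, Complex.cos_arg hz0, Complex.cos_arg hw0,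
      Complex.mul_im]
    field_simp
    ring
  have h2 := mul_pos (norm_pos_iff.2 hz0) (norm_pos_iff.2 hw0)
  have b1 := arg_pos_of_im_pos hz
  have b2 := arg_pos_of_im_pos hw
  have b3 := arg_lt_pi_of_im_pos hz
  have b4 := arg_lt_pi_of_im_pos hw
  rw [h1, mul_pos_iff_of_pos_left h2]
  constructor
  · exact fun h => Real.sin_pos_of_pos_of_lt_pi (by linarith) h
  · intro h
    by_contra! hle
    have := Real.sin_nonneg_of_nonneg_of_le_pi (x := z.arg + w.arg - Real.pi) (by linarith)
      (by linarith)
    rw [Real.sin_sub_pi] at this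
    linarith

/-- The sign of the imaginary part of a cross ratio tells on which side of the circle through
`a`, `b`, `c` the point `d` lies. -/
theorem im_mul_conj_eq {a b c d o : ℂ} {r : ℝ} (ha : Complex.normSq (a - o) = r)
    (hb : Complex.normSq (b - o) = r) (hc : Complex.normSq (c - o) = r) :
    ((b - c) * (a - d) * (starRingEnd ℂ) ((a - c) * (b - d))).im =
      (Complex.normSq (d - o) - r) * cross (b - a) (c - a) := by
  simp only [Complex.normSq_apply, Complex.sub_re, Complex.sub_im, cross, map_mul, Complex.mul_im,
    Complex.mul_re, map_sub, Complex.conj_re, Complex.conj_im] at *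
  linear_combination
    (-((b.re - d.re) * (c.im - d.im) - (b.im - d.im) * (c.re - d.re))) * ha +
    (-((c.re - d.re) * (a.im - d.im) - (c.im - d.im) * (a.re - d.re))) * hb +
    (-((a.re - d.re) * (b.im - d.im) - (a.im - d.im) * (b.re - d.re))) * hc

theorem exists_circumcenter {a b c : ℂ} (h : cross (b - a) (c - a) ≠ 0) :
    ∃ o : ℂ, Complex.normSq (b - o) = Complex.normSq (a - o) ∧
      Complex.normSq (c - o) = Complex.normSq (a - o) := by
  obtain ⟨D, hD⟩ : ∃ D, D = cross (b - a) (c - a) := ⟨_, rfl⟩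
  rw [← hD] at h
  simp only [cross, Complex.sub_re, Complex.sub_im] at hD
  refine ⟨a + ⟨(Complex.normSq (b - a) * (c - a).im - Complex.normSq (c - a) * (b - a).im) / (2 * D),
    (Complex.normSq (c - a) * (b - a).re - Complex.normSq (b - a) * (c - a).re) / (2 * D)⟩, ?_, ?_⟩
  · simp only [Complex.normSq_apply, Complex.sub_re, Complex.sub_im, Complex.add_re, Complex.add_im]
    field_simp
    rw [hD]; ring
  · simp only [Complex.normSq_apply, Complex.sub_re, Complex.sub_im, Complex.add_re, Complex.add_im]
    field_simp
    rw [hD]; ring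

/-- The local Delaunay condition in terms of the angles opposite to an edge. -/
theorem exists_circle_iff {a b c d : ℂ} (h : 0 < cross (b - a) (c - a))
    (h' : 0 < cross (a - b) (d - b)) :
    (∃ o r, ‖a - o‖ = r ∧ ‖b - o‖ = r ∧ ‖c - o‖ = r ∧ r < ‖d - o‖) ↔
      ((b - c) / (a - c)).arg + ((a - d) / (b - d)).arg < Real.pi := by
  have h1 : 0 < cross (a - c) (b - c) := by
    simp only [cross, Complex.sub_re, Complex.sub_im] at h ⊢; linarith
  have h2 : 0 < cross (b - d) (a - d) := by
    simp only [cross, Complex.sub_re, Complex.sub_im] at h' ⊢; linarith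
  have hac : a - c ≠ 0 := by intro h; simp [h, cross] at h1
  have hbd : b - d ≠ 0 := by intro h; simp [h, cross] at h2
  rw [arg_add_arg_lt_pi_iff (im_div_pos_iff.2 h1) (im_div_pos_iff.2 h2)]
  have h3 : 0 < ((b - c) / (a - c) * ((a - d) / (b - d))).im ↔
      0 < ((b - c) * (a - d) * (starRingEnd ℂ) ((a - c) * (b - d))).im := by
    have hn : 0 < Complex.normSq ((a - c) * (b - d)) := Complex.normSq_pos.2 (mul_ne_zero hac hbd)
    have e : (b - c) / (a - c) * ((a - d) / (b - d)) = (b - c) * (a - d) *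
        (starRingEnd ℂ) ((a - c) * (b - d)) * ((Complex.normSq ((a - c) * (b - d)))⁻¹ : ℝ) := by
      rw [div_mul_div_comm, div_eq_mul_inv _ ((a - c) * (b - d)), Complex.inv_def]
      ring
    rw [e, Complex.im_mul_ofReal, mul_pos_iff_of_pos_right (inv_pos.2 hn)]
  have hsq : ∀ z : ℂ, Complex.normSq z = ‖z‖ ^ 2 := Complex.normSq_eq_norm_sq
  rw [h3]
  constructor
  · rintro ⟨o, r, ha, hb, hc, hd⟩
    rw [im_mul_conj_eq (o := o) (r := r ^ 2) (by rw [hsq, ha]) (by rw [hsq, hb]) (by rw [hsq, hc]),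
      hsq]
    refine mul_pos ?_ h
    have : 0 ≤ r := ha ▸ norm_nonneg _
    nlinarith
  · intro hpos
    obtain ⟨o, hb, hc⟩ := exists_circumcenter h.ne'
    rw [im_mul_conj_eq rfl hb hc, mul_pos_iff_of_pos_right h, sub_pos, hsq, hsq,
      sq_lt_sq₀ (norm_nonneg _) (norm_nonneg _)] at hpos
    rw [hsq, hsq, sq_eq_sq₀ (norm_nonneg _) (norm_nonneg _)] at hb hc
    exact ⟨o, _, rfl, hb, hc, hpos⟩

theorem cross_map_eq (B : ℂ →ₗ[ℝ] ℂ) (z w : ℂ) :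
    cross (B z) (B w) = LinearMap.det B * cross z w := by
  have hB : ∀ z : ℂ, B z = z.re • B 1 + z.im • B Complex.I := by
    intro z
    rw [← map_smul, ← map_smul, ← map_add]
    congr 1
    simp [Complex.re_add_im]
  have hdet : LinearMap.det B = cross (B 1) (B Complex.I) := by
    rw [← LinearMap.det_toMatrix Complex.basisOneI, Matrix.det_fin_two]
    simp [LinearMap.toMatrix_apply, cross]
    ring
  rw [hdet, hB z, hB w]
  simp only [cross, Complex.add_re, Complex.add_im, Complex.real_smul, Complex.re_ofReal_mul,
    Complex.im_ofReal_mul]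
  ring

theorem exists_linearMap_of_cross_pos {u v u' v' : ℂ} (h : 0 < cross u v) (h' : 0 < cross u' v') :
    ∃ B : ℂ →ₗ[ℝ] ℂ, 0 < LinearMap.det B ∧ B u = u' ∧ B v = v' := by
  set B : ℂ →ₗ[ℝ] ℂ :=
    { toFun := fun z => (cross z v / cross u v) • u' + (cross u z / cross u v) • v'
      map_add' := fun x y => by
        have e1 : cross (x + y) v = cross x v + cross y v := by simp [cross]; ring
        have e2 : cross u (x + y) = cross u x + cross u y := by simp [cross]; ring
        rw [e1, e2]; module
      map_smul' := fun r x => by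
        have e1 : cross (r • x) v = r * cross x v := by simp [cross]; ring
        have e2 : cross u (r • x) = r * cross u x := by simp [cross]; ring
        rw [e1, e2, RingHom.id_apply, smul_add, smul_smul, smul_smul, mul_div_assoc,
          mul_div_assoc] } with hB
  have hself : ∀ z, cross z z = 0 := fun z => by simp [cross]; ring
  have hu : B u = u' := by simp [hB, h.ne', hself]
  have hv : B v = v' := by simp [hB, h.ne', hself]
  refine ⟨B, ?_, hu, hv⟩
  have := cross_map_eq B u v
  rw [hu, hv] at this
  rw [this] at h'
  exact pos_of_mul_pos_left h' h.le

/-- The plane with complex coordinates. -/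
noncomputable def planeComplex : Plane ≃ₗᵢ[ℝ] ℂ := Complex.orthonormalBasisOneI.repr.symm

theorem planeComplex_apply (x : Plane) : planeComplex x = x 0 + x 1 * Complex.I := by
  have := Complex.orthonormalBasisOneI.sum_repr_symm x
  rw [planeComplex, ← this]
  simp [Fin.sum_univ_two]

section

variable {V : Type*} [Fintype V] [DecidableEq V] {T : AbstractSimplicialComplex V}

/-- The images of the vertices, in complex coordinates. -/
noncomputable def vertexPos (φ : C(realization T, Plane)) (v : V) : ℂ :=
  planeComplex (vertexImage φ v)

theorem IsPolygonTriangulation.planeComplex_apply {φ : C(realization T, Plane)}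
    (hφ : IsPolygonTriangulation φ) (x : realization T) :
    planeComplex (φ x) = plMap (vertexPos φ) x := by
  rw [hφ.linear x, map_sum, Fintype.linearCombination_apply]
  simp [vertexPos]

theorem IsPolygonTriangulation.injOn {φ : C(realization T, Plane)}
    (hφ : IsPolygonTriangulation φ) : InjOn (plMap (vertexPos φ)) (realization T) := by
  intro x hx y hy he
  have h1 := hφ.planeComplex_apply ⟨x, hx⟩
  have h2 := hφ.planeComplex_apply ⟨y, hy⟩
  have h3 : planeComplex (φ ⟨x, hx⟩) = planeComplex (φ ⟨y, hy⟩) := by rw [h1, h2]; exact he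
  exact congrArg Subtype.val (hφ.isEmbedding.injective (planeComplex.injective h3))

theorem dist_vertexImage (φ : C(realization T, Plane)) (v : V) (x : Plane) :
    dist (vertexImage φ v) x = ‖vertexPos φ v - planeComplex x‖ := by
  rw [← planeComplex.dist_map, dist_eq_norm]; rfl

theorem angle_vertexImage (φ : C(realization T, Plane)) {a b c : V}
    (hb : vertexPos φ b - vertexPos φ a ≠ 0) (hc : vertexPos φ c - vertexPos φ a ≠ 0) :
    EuclideanGeometry.angle (vertexImage φ b) (vertexImage φ a) (vertexImage φ c) =
      |((vertexPos φ c - vertexPos φ a) / (vertexPos φ b - vertexPos φ a)).arg| := by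
  rw [EuclideanGeometry.angle, InnerProductGeometry.angle_comm, ← Complex.angle_eq_abs_arg hc hb]
  simp only [vertexPos, ← map_sub, vsub_eq_sub]
  exact (LinearIsometry.angle_map planeComplex.toLinearIsometry _ _).symm

end

open Corner

/-! ### From maps of the disk to vertex positions -/

section

variable {V : Type*} [Fintype V] [DecidableEq V] {T : AbstractSimplicialComplex V} {p₀ : V → ℂ}

/-- The triangles cover `|T|`. -/
theorem realization_eq_body (hT : IsDisk T) (h₀ : InjOn (plMap p₀) (realization T)) :
    realization T = body (OrientedTriangle T p₀) := by
  ext x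
  refine and_congr_right fun hx => ?_
  constructor
  · rintro ⟨s, hs, hxs⟩
    obtain ⟨a, b, c, h, hsub⟩ := hT.exists_subset_triangle h₀ hs
    exact ⟨⟨(a, b, c), h⟩, fun v hv => hsub ((hxs v).1 hv)⟩
  · rintro ⟨⟨⟨a, b, c⟩, h⟩, ht⟩
    exact (mem_realization hx h.1 ht).2

variable [hO : OrientedDisk (OrientedTriangle T p₀)]

theorem OrientedTriangle.isTriangle {a b c : V} (h : OrientedTriangle T p₀ a b c) :
    IsTriangle T {a, b, c} :=
  ⟨h.1, Finset.card_eq_three.2 ⟨a, b, c, h.ne, h.ne'.1, h.ne'.2, rfl⟩⟩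

theorem IsTriangle.ne {a b c : V} (h : IsTriangle T {a, b, c}) : a ≠ b ∧ a ≠ c ∧ b ≠ c := by
  have h3 := h.2
  refine ⟨?_, ?_, ?_⟩ <;> rintro rfl
  · have := (Finset.card_le_two (a := a) (b := c)); simp at h3; omega
  · have := (Finset.card_le_two (a := a) (b := b))
    have e : ({a, b, a} : Finset V) = {a, b} := by ext; simp; tauto
    rw [e] at h3; omega
  · have := (Finset.card_le_two (a := a) (b := b)); simp at h3; omega

theorem IsTriangle.exists_eq {f : Finset V} (hf : IsTriangle T f) {v : V} (hv : v ∈ f)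
    (h₀ : InjOn (plMap p₀) (realization T)) :
    ∃ b c, OrientedTriangle T p₀ v b c ∧ f = {v, b, c} := by
  have h2 : (f.erase v).card = 2 := by rw [Finset.card_erase_of_mem hv, hf.2]
  obtain ⟨b, c, hbc, he⟩ := Finset.card_eq_two.1 h2
  have hfe : f = {v, b, c} := by rw [← he, Finset.insert_erase hv]
  have hvb : v ≠ b := by rintro rfl; have : v ∈ f.erase v := by rw [he]; simp
                         simp at this
  have hvc : v ≠ c := by rintro rfl; have : v ∈ f.erase v := by rw [he]; simp
                         simp at this
  rcases orientedTriangle_or h₀ hvb hvc hbc (hfe ▸ hf.1) with h | h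
  · exact ⟨_, _, h, hfe⟩
  · exact ⟨_, _, h, hfe.trans (by ext; simp; tauto)⟩

theorem isBoundaryEdge_of_unique {a b c : V} (h₀ : InjOn (plMap p₀) (realization T))
    (h : OrientedTriangle T p₀ a b c) (hb : ∀ d, ¬ OrientedTriangle T p₀ b a d) :
    IsBoundaryEdge T {a, b} := by
  refine ⟨faces_subset h.1 (by intro; simp; tauto) (by simp), Finset.card_pair h.ne, {a, b, c},
    ⟨h.isTriangle, by intro; simp; tauto⟩, ?_⟩
  rintro f ⟨hf, hsub⟩
  obtain ⟨x, y, hxy, rfl⟩ := hf.exists_eq (hsub (by simp : a ∈ ({a, b} : Finset V))) h₀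
  have hbm : b ∈ ({a, x, y} : Finset V) := hsub (by simp)
  simp only [Finset.mem_insert, Finset.mem_singleton, h.ne.symm, false_or] at hbm
  rcases hbm with rfl | rfl
  · rw [hO.unique h hxy]
  · exact absurd hxy.rot.rot (hb x)

theorem isBoundaryVertex_iff (h₀ : InjOn (plMap p₀) (realization T)) (v : V) :
    IsBoundaryVertex T v ↔ ¬ Inner (OrientedTriangle T p₀) v := by
  constructor
  · rintro ⟨e, ⟨-, he, f, ⟨hf, hef⟩, hu⟩, hv⟩ hin
    obtain ⟨w, hw⟩ : ∃ w, e.erase v = {w} := Finset.card_eq_one.1 (by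
      rw [Finset.card_erase_of_mem hv, he])
    have hwe : w ∈ e.erase v := by rw [hw]; simp
    have hev : e = {v, w} := by rw [← hw, Finset.insert_erase hv]
    obtain ⟨x, y, h, rfl⟩ := hf.exists_eq (hef hv) h₀
    have hwf : w ∈ ({v, x, y} : Finset V) := hef (Finset.mem_of_mem_erase hwe)
    simp only [Finset.mem_insert, Finset.mem_singleton, Finset.ne_of_mem_erase hwe,
      false_or] at hwf
    have key : ∀ d, {v, d, w} ⊆ ({v, x, y} : Finset V) → d = v ∨ d = x ∨ d = y := by
      intro d hd
      have : d ∈ ({v, x, y} : Finset V) := hd (by simp)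
      simpa using this
    rcases hwf with rfl | rfl
    · obtain ⟨d, hd⟩ := (hin _ _ h).2
      have h1 := hu _ ⟨hd.isTriangle, by rw [hev]; intro; simp; tauto⟩
      rcases key d h1.le with rfl | rfl | rfl
      · exact hd.ne rfl
      · exact hd.rot.ne rfl
      · exact hO.asymm h (hO.rot (hO.rot hd))
    · obtain ⟨d, hd⟩ := (hin _ _ h).1
      have h1 := hu _ ⟨hd.isTriangle, by rw [hev]; intro; simp; tauto⟩
      have h2 : d = v ∨ d = x ∨ d = w := key d (by rw [← h1]; intro; simp; tauto)
      rcases h2 with rfl | rfl | rfl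
      · exact hd.rot.rot.ne rfl
      · exact hO.asymm h (hO.rot (hO.rot hd))
      · exact hd.rot.ne rfl
  · intro hin
    simp only [Corner.Inner, not_forall, not_and_or, not_exists] at hin
    obtain ⟨b, c, h, hb | hb⟩ := hin
    · refine ⟨{c, v}, isBoundaryEdge_of_unique h₀ h.rot.rot fun d hd => hb d hd, by simp⟩
    · refine ⟨{v, b}, isBoundaryEdge_of_unique h₀ h fun d hd => hb d hd.rot, by simp⟩

theorem cornerAngle_eq (φ : C(realization T, Plane))
    (hφ : IsPositive (OrientedTriangle T p₀) (vertexPos φ)) (t : Corner (OrientedTriangle T p₀)) :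
    cornerAngle φ t.1.1 t.face = ang (vertexPos φ) t := by
  obtain ⟨⟨v, b, c⟩, h⟩ := t
  have hc := hφ.cross_pos ⟨(v, b, c), h⟩
  simp only at hc
  have hb0 : vertexPos φ b - vertexPos φ v ≠ 0 := by intro h; simp [h, cross] at hc
  have hc0 : vertexPos φ c - vertexPos φ v ≠ 0 := by intro h; simp [h, cross] at hc
  have he : (face (⟨(v, b, c), h⟩ : Corner (OrientedTriangle T p₀))).erase v = {b, c} := by
    ext x
    simp only [face, Finset.mem_erase, Finset.mem_insert, Finset.mem_singleton]
    constructor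
    · tauto
    · rintro (rfl | rfl)
      · exact ⟨h.ne.symm, by simp⟩
      · exact ⟨h.ne'.1.symm, by simp⟩
  have hoff : ({b, c} : Finset V).offDiag = {(b, c), (c, b)} := by
    ext ⟨x, y⟩
    simp only [Finset.mem_offDiag, Finset.mem_insert, Finset.mem_singleton, Prod.mk.injEq]
    have := h.ne'.2
    constructor
    · rintro ⟨rfl | rfl, rfl | rfl, hne⟩ <;> simp_all
    · rintro (⟨rfl, rfl⟩ | ⟨rfl, rfl⟩)
      · simp [this]
      · simp [this.symm]
  have hne : ((b, c) : V × V) ≠ (c, b) := fun e => h.ne'.2 (Prod.ext_iff.1 e).1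
  rw [cornerAngle, he, hoff, Finset.sum_pair hne, EuclideanGeometry.angle_comm (vertexImage φ c),
    angle_vertexImage φ hb0 hc0]
  have := ang_pos hφ ⟨(v, b, c), h⟩
  rw [ang, ratio] at this ⊢
  simp only at this ⊢
  rw [abs_of_pos this]
  ring

theorem innerAngle_eq (h₀ : InjOn (plMap p₀) (realization T)) (φ : C(realization T, Plane))
    (hφ : IsPositive (OrientedTriangle T p₀) (vertexPos φ)) (v : V) :
    innerAngle φ v = ∑ t : Corner (OrientedTriangle T p₀) with t.1.1 = v, ang (vertexPos φ) t := by
  classical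
  rw [innerAngle]
  symm
  refine Finset.sum_bij (fun t _ => t.face) ?_ ?_ ?_ ?_
  · rintro ⟨⟨a, b, c⟩, h⟩ ht
    obtain rfl : a = v := by simpa using ht
    simpa [face] using h.isTriangle
  · intro s hs t ht he
    simp only [Finset.mem_filter, Finset.mem_univ, true_and] at hs ht
    rcases face_eq_iff.1 he with h | h | h
    · exact h
    · refine absurd ?_ (hO.ne t.2)
      rw [ht, ← hs, h]; rfl
    · refine absurd ?_ (hO.ne (hO.rot (hO.rot t.2)))
      rw [ht, ← hs, h]; rfl
  · intro f hf
    simp only [Finset.mem_filter, Finset.mem_univ, true_and] at hf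
    obtain ⟨b, c, h, rfl⟩ := hf.1.exists_eq hf.2 h₀
    exact ⟨⟨(v, b, c), h⟩, by simp, rfl⟩
  · rintro t ht
    obtain rfl : t.1.1 = v := by simpa using ht
    exact (cornerAngle_eq φ hφ t).symm

/-- The Delaunay condition in terms of angles. In `IsStrictlyDelaunay`, the circle is attached to
one of the two triangles; the condition on the angles is symmetric. -/
theorem isStrictlyDelaunay_iff (h₀ : InjOn (plMap p₀) (realization T))
    (φ : C(realization T, Plane)) (hφ : IsPositive (OrientedTriangle T p₀) (vertexPos φ)) :
    IsStrictlyDelaunay φ ↔ ∀ t : Corner (OrientedTriangle T p₀), ¬ IsBdry t →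
      ang (vertexPos φ) t + ang (vertexPos φ) t.twin < Real.pi := by
  have hsphere : ∀ a b c d : V, (∃ S : EuclideanGeometry.Sphere Plane,
      vertexImage φ a ∈ S ∧ vertexImage φ b ∈ S ∧ vertexImage φ c ∈ S ∧
        S.radius < dist (vertexImage φ d) S.center) ↔
      ∃ o r, ‖vertexPos φ a - o‖ = r ∧ ‖vertexPos φ b - o‖ = r ∧ ‖vertexPos φ c - o‖ = r ∧
        r < ‖vertexPos φ d - o‖ := by
    intro a b c d
    constructor
    · rintro ⟨S, ha, hb, hc, hd⟩
      simp only [EuclideanGeometry.mem_sphere, dist_vertexImage] at ha hb hc hd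
      exact ⟨_, _, ha, hb, hc, hd⟩
    · rintro ⟨o, r, ha, hb, hc, hd⟩
      refine ⟨⟨planeComplex.symm o, r⟩, ?_⟩
      simp only [EuclideanGeometry.mem_sphere, dist_vertexImage, LinearIsometryEquiv.apply_symm_apply]
      exact ⟨ha, hb, hc, hd⟩
  have key : ∀ a b c d (h : OrientedTriangle T p₀ a b c) (h' : OrientedTriangle T p₀ b a d),
      (∃ S : EuclideanGeometry.Sphere Plane, vertexImage φ a ∈ S ∧ vertexImage φ b ∈ S ∧
        vertexImage φ c ∈ S ∧ S.radius < dist (vertexImage φ d) S.center) ↔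
      ang (vertexPos φ) ⟨(c, a, b), hO.rot (hO.rot h)⟩ +
        ang (vertexPos φ) ⟨(d, b, a), hO.rot (hO.rot h')⟩ < Real.pi := by
    intro a b c d h h'
    rw [hsphere, exists_circle_iff (hφ.cross_pos ⟨(a, b, c), h⟩) (hφ.cross_pos ⟨(b, a, d), h'⟩)]
    rfl
  constructor
  · rintro hD ⟨⟨c, a, b⟩, h⟩ ht
    obtain ⟨d, hd, e⟩ := twin_fst_ne h ht
    rw [e, ← key a b c d (hO.rot h) (hO.rot hd)]
    have h1 := (hO.rot h).isTriangle
    have h2 := (hO.rot hd).isTriangle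
    refine hD a b c d ?_ h1 ?_
    · rintro rfl
      exact hO.asymm (hO.rot h) (hO.rot hd)
    · have : ({a, b, d} : Finset V) = {b, a, d} := by ext; simp; tauto
      rwa [this]
  · intro hA a b c d hcd hc hd
    have hnc := hc.ne
    have hnd := hd.ne
    have hmain : ∀ a b c d, OrientedTriangle T p₀ a b c → OrientedTriangle T p₀ b a d →
        ∃ S : EuclideanGeometry.Sphere Plane, vertexImage φ a ∈ S ∧ vertexImage φ b ∈ S ∧
        vertexImage φ c ∈ S ∧ S.radius < dist (vertexImage φ d) S.center := by
      intro a b c d h h'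
      rw [key a b c d h h']
      have h1 := hA ⟨(c, a, b), hO.rot (hO.rot h)⟩ fun hb => hb d (hO.rot (hO.rot h'))
      rwa [twin_eq (hO.rot (hO.rot h)) (hO.rot (hO.rot h'))] at h1
    rcases orientedTriangle_or h₀ hnc.1 hnc.2.1 hnc.2.2 hc.1 with h | h <;>
      rcases orientedTriangle_or h₀ hnd.1 hnd.2.1 hnd.2.2 hd.1 with h' | h'
    · exact absurd (hO.unique h h') hcd
    · exact hmain a b c d h h'.rot.rot
    · obtain ⟨S, h1, h2, h3, h4⟩ := hmain b a c d h.rot.rot h'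
      exact ⟨S, h2, h1, h3, h4⟩
    · exact absurd (hO.unique h.rot.rot h'.rot.rot) hcd

theorem cross_vertexPos (φ ψ : C(realization T, Plane)) {A : Plane →ₗ[ℝ] Plane} {a b c : V}
    (hb : A (vertexImage φ b - vertexImage φ a) = vertexImage ψ b - vertexImage ψ a)
    (hc : A (vertexImage φ c - vertexImage φ a) = vertexImage ψ c - vertexImage ψ a) :
    cross (vertexPos ψ b - vertexPos ψ a) (vertexPos ψ c - vertexPos ψ a) = LinearMap.det A *
      cross (vertexPos φ b - vertexPos φ a) (vertexPos φ c - vertexPos φ a) := by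
  rw [← LinearMap.det_conj A planeComplex.toLinearEquiv, ← cross_map_eq]
  simp only [vertexPos, ← map_sub, ← hb, ← hc]
  simp

/-- Having the orientation of `ψ` means to be positive on the triangles in the order given by
`ψ`. -/
theorem sameOrientation_iff (φ ψ : C(realization T, Plane))
    (h₀ : InjOn (plMap (vertexPos ψ)) (realization T))
    [hO : OrientedDisk (OrientedTriangle T (vertexPos ψ))] :
    SameOrientation φ ψ ↔ IsPositive (OrientedTriangle T (vertexPos ψ)) (vertexPos φ) := by
  constructor
  · rintro h ⟨⟨a, b, c⟩, ht⟩
    obtain ⟨A, hA, hAf⟩ := h _ ht.isTriangle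
    refine im_div_pos_iff.2 ?_
    have h1 := cross_vertexPos φ ψ (hAf a (by simp) b (by simp)) (hAf a (by simp) c (by simp))
    have h2 := ht.2
    rw [h1] at h2
    exact pos_of_mul_pos_right h2 hA.le
  · intro h f hf
    obtain ⟨a, ha⟩ : f.Nonempty := Finset.card_pos.1 (by rw [hf.2]; norm_num)
    obtain ⟨b, c, ht, rfl⟩ := hf.exists_eq ha h₀
    obtain ⟨B, hB, hb, hc⟩ := exists_linearMap_of_cross_pos (h.cross_pos ⟨(a, b, c), ht⟩) ht.2
    refine ⟨planeComplex.symm.toLinearEquiv.toLinearMap ∘ₗ B ∘ₗ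
      planeComplex.symm.toLinearEquiv.symm.toLinearMap, by rwa [LinearMap.det_conj], ?_⟩
    set A : Plane →ₗ[ℝ] Plane := planeComplex.symm.toLinearEquiv.toLinearMap ∘ₗ B ∘ₗ
      planeComplex.symm.toLinearEquiv.symm.toLinearMap with hA
    have hAw : ∀ w ∈ ({a, b, c} : Finset V),
        A (vertexImage φ w - vertexImage φ a) = vertexImage ψ w - vertexImage ψ a := by
      intro w hw
      apply planeComplex.injective
      have e : planeComplex (A (vertexImage φ w - vertexImage φ a)) =
          B (vertexPos φ w - vertexPos φ a) := by
        simp [hA, vertexPos]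
      rw [e]
      simp only [Finset.mem_insert, Finset.mem_singleton] at hw
      rcases hw with rfl | rfl | rfl
      · simp
      · exact hb.trans (map_sub planeComplex _ _).symm
      · exact hc.trans (map_sub planeComplex _ _).symm
    intro v hv w hw
    have h1 : vertexImage φ w - vertexImage φ v =
      (vertexImage φ w - vertexImage φ a) - (vertexImage φ v - vertexImage φ a) := by abel
    rw [h1, map_sub, hAw w hw, hAw v hv]
    abel

/-- Delaunay triangulations of convex polygons in terms of the vertex positions. -/
theorem mem_delaunaySpace_iff (hT : IsDisk T) {φ ψ : C(realization T, Plane)}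
    (h₀ : InjOn (plMap (vertexPos ψ)) (realization T))
    [hO : OrientedDisk (OrientedTriangle T (vertexPos ψ))] (hφ : IsPolygonTriangulation φ) :
    φ ∈ delaunaySpace ψ ↔
      IsConvexDelaunay (OrientedTriangle T (vertexPos ψ)) (vertexPos φ) := by
  constructor
  · rintro ⟨hc, hd, hs⟩
    have hpos := (sameOrientation_iff φ ψ h₀).1 hs
    have hmono : ∀ {a b c}, OrientedTriangle T (vertexPos ψ) a b c →
        OrientedTriangle T (vertexPos φ) a b c := fun {a b c} h =>
      ⟨h.1, hpos.cross_pos ⟨(a, b, c), h⟩⟩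
    refine ⟨hpos, realization_eq_body hT h₀ ▸ hφ.injOn, (isStrictlyDelaunay_iff h₀ φ hpos).1 hd,
      fun v hv => ?_, fun v hv => ?_⟩
    · rw [← innerAngle_eq h₀ φ hpos]
      exact hc.innerAngle_lt v ((isBoundaryVertex_iff h₀ v).2 hv)
    · refine sum_ang_eq hpos hv fun b c b' c' h h' s t s' t' hs ht hs' ht' e => ?_
      exact (hmono h).eq_of_mem_cone hφ.injOn (hmono h') hs ht hs' ht' e
  · intro h
    refine ⟨⟨hφ, fun v hv => ?_⟩, (isStrictlyDelaunay_iff h₀ φ h.pos).2 h.delaunay,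
      (sameOrientation_iff φ ψ h₀).2 h.pos⟩
    rw [innerAngle_eq h₀ φ h.pos]
    exact h.boundary v ((isBoundaryVertex_iff h₀ v).1 hv)

/-- The piecewise linear map with given vertex positions. -/
noncomputable def plContinuousMap (T : AbstractSimplicialComplex V) (p : V → ℂ) :
    C(realization T, Plane) :=
  ⟨fun x => planeComplex.symm (plMap p x),
    planeComplex.symm.continuous.comp ((continuous_plMap p).comp continuous_subtype_val)⟩

theorem vertexPos_plContinuousMap (p : V → ℂ) : vertexPos (plContinuousMap T p) = p := by
  ext v
  simp only [vertexPos, vertexImage, plContinuousMap, ContinuousMap.coe_mk,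
    LinearIsometryEquiv.apply_symm_apply, vertexPt]
  rw [plMap_single, one_smul]

theorem isPolygonTriangulation_plContinuousMap [CompactSpace (realization T)] {p : V → ℂ}
    (hp : InjOn (plMap p) (realization T)) : IsPolygonTriangulation (plContinuousMap T p) where
  isEmbedding := by
    refine ((plContinuousMap T p).continuous.isClosedEmbedding fun x y h => ?_).isEmbedding
    exact Subtype.ext (hp x.2 y.2 (planeComplex.symm.injective h))
  linear x := by
    apply planeComplex.injective
    rw [map_sum]
    have h : ∀ v, planeComplex ((x : V → ℝ) v • vertexImage (plContinuousMap T p) v) =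
        (x : V → ℝ) v • p v := by
      intro v
      rw [map_smul]
      congr 1
      exact congrFun (vertexPos_plContinuousMap p) v
    simp only [h]
    simp only [plContinuousMap, ContinuousMap.coe_mk, LinearIsometryEquiv.apply_symm_apply]
    rw [Fintype.linearCombination_apply]

theorem continuous_plContinuousMap : Continuous (plContinuousMap T : (V → ℂ) → _) := by
  refine ContinuousMap.continuous_of_continuous_uncurry _ ?_
  refine planeComplex.symm.continuous.comp ?_
  simp only [Fintype.linearCombination_apply]
  refine continuous_finsetSum _ fun v _ => Continuous.smul (f := fun z : (V → ℂ) × realization T =>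
    z.2.1 v) (g := fun z => z.1 v) ?_ ?_
  · exact (continuous_apply v).comp (continuous_subtype_val.comp continuous_snd)
  · exact (continuous_apply v).comp continuous_fst

theorem continuous_vertexPos : Continuous (vertexPos : C(realization T, Plane) → V → ℂ) :=
  continuous_pi fun _ => planeComplex.continuous.comp (continuous_eval_const _)

theorem vertexImage_sub_eq_iff (φ : C(realization T, Plane)) (i j : V) (l : ℝ) :
    vertexImage φ j - vertexImage φ i = !₂[l, 0] ↔ vertexPos φ j - vertexPos φ i = l := by
  rw [← planeComplex.injective.eq_iff, map_sub]
  have : planeComplex !₂[l, 0] = l := by simp [planeComplex_apply]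
  rw [this]; rfl

end

theorem corollary3p1 {V : Type*} [Fintype V] [DecidableEq V] (T : AbstractSimplicialComplex V)
    (hT : IsDisk T) (ψ : C(realization T, Plane)) (hψ : IsConvexPolygonTriangulation ψ)
    (hψD : IsStrictlyDelaunay ψ) (i j : V) (hne : i ≠ j) (hij : {i, j} ∈ T.faces) :
    Nonempty (normalizedDelaunaySpace ψ i j ≃ₜ
      EuclideanSpace ℝ (Fin (2 * Fintype.card V - 1))) := by
  have h₀ := hψ.toIsPolygonTriangulation.injOn
  have hO : OrientedDisk (OrientedTriangle T (vertexPos ψ)) := hT.orientedDisk h₀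
  have hbody := realization_eq_body hT h₀
  have hcomp : CompactSpace (realization T) := isCompact_iff_compactSpace.1 (hbody ▸ isCompact_body)
  have hconn : IsPreconnected (body (OrientedTriangle T (vertexPos ψ))) := by
    rw [← hbody]; exact isPreconnected_iff_preconnectedSpace.2 hT.preconnectedSpace
  have hp₀ : IsConvexDelaunay (OrientedTriangle T (vertexPos ψ)) (vertexPos ψ) :=
    (mem_delaunaySpace_iff hT h₀ hψ.toIsPolygonTriangulation).1
      ⟨hψ, hψD, fun f _ => ⟨LinearMap.id, by simp, fun v _ w _ => rfl⟩⟩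
  obtain ⟨u, hui, huj, hf⟩ := hT.exists_triangle hne hij
  obtain ⟨e⟩ := nonempty_homeomorph hp₀ hconn (i := i) (j := j) (by
    rcases orientedTriangle_or h₀ hne hui.symm huj.symm hf with h | h
    · exact ⟨⟨(u, i, j), h.rot.rot⟩, .inl ⟨rfl, rfl⟩⟩
    · exact ⟨⟨(u, j, i), h.rot⟩, .inr ⟨rfl, rfl⟩⟩)
  refine ⟨Homeomorph.trans ?_ e⟩
  exact
    { toFun := fun φ => ⟨vertexPos φ.1,
        (mem_delaunaySpace_iff hT h₀ φ.2.1.1.toIsPolygonTriangulation).1 φ.2.1, by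
          obtain ⟨l, hl, h⟩ := φ.2.2
          exact ⟨l, hl, (vertexImage_sub_eq_iff _ _ _ _).1 h⟩⟩
      invFun := fun p => ⟨plContinuousMap T p.1,
        (mem_delaunaySpace_iff hT h₀ (isPolygonTriangulation_plContinuousMap
          (hbody ▸ p.2.1.inj))).2 (by rw [vertexPos_plContinuousMap]; exact p.2.1), by
          obtain ⟨l, hl, h⟩ := p.2.2
          refine ⟨l, hl, (vertexImage_sub_eq_iff _ _ _ _).2 ?_⟩
          rw [vertexPos_plContinuousMap]; exact h⟩
      left_inv := fun φ => Subtype.ext (ContinuousMap.ext fun x => by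
        apply planeComplex.injective
        rw [φ.2.1.1.toIsPolygonTriangulation.planeComplex_apply]
        exact planeComplex.apply_symm_apply _)
      right_inv := fun p => Subtype.ext (vertexPos_plContinuousMap p.1)
      continuous_toFun := (continuous_vertexPos.comp continuous_subtype_val).subtype_mk _
      continuous_invFun := (continuous_plContinuousMap.comp continuous_subtype_val).subtype_mk _ }
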